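/- **Setting.** Let $x(t)\in\mathbb R^M$, $t\in\mathbb R$, be a zero-mean, finite-variance, jointly wide-sense stationary process with power spectral density (PSD) matrix $C_x(f)$, where $C_x(f)=0$ for $|f|>f_{\rm nyq}/2$. Let $s\in\mathbb R^N$ be a zero-mean, square-integrable task vector whose MMSE estimate from $x$ is linear: $\tilde s=\mathbb E[s\mid x]=(\Gamma*x)(0)$ for some multivariate filter $\Gamma$. An acquisition system with $K\ge 1$ ADCs, sampling rate $f_s=1/T_s$ and $b\ge 1$ bits per sample works as follows. 1. An analog filter $H$ with $K$ outputs gives $y=H*x$, sampled as $y_k[n]=T_s\,y_k(nT_s)$. 2. Each sample is quantized by a non-overloading, nonsubtractive dithered uniform mid-rise quantizer, $z_k[n]=\Delta\big(\lfloor (y_k[n]+w_k[n])/\Delta\rfloor+\tfrac12\big)$. Here $\Delta=2\gamma/2^b$ and $\gamma^2=\eta^2\max_k\mathbb E\{(y_k[n]+w_k[n])^2\}$ for a fixed $\eta>0$. The dither $w_k[n]$ is i.i.d. over $k$ and $n$, independent of $(x,s)$, with triangular density $\frac1\Delta(1-|w|/\Delta)$ on $[-\Delta,\Delta]$. 3.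 A linear digital filter $G$ gives $\hat s=\sum_n G[-n]\,z[n]$. Filtering, and the series for $\hat s$, are understood in the mean-square sense. Let $\mathrm{MSE}(f_s,b)$ be the infimum of $\mathbb E\|s-\hat s\|^2$ over all $H$ and $G$, for the given $K$. Only configurations with $f_s>0$, $f_s\ge f_{\rm nyq}$, $b\in\mathbb N$, $b\ge1$ and $2\eta^2<3\cdot 2^{2b}$ (so that a dynamic range $\gamma$ exists) are considered. **Corollary.** Fix $K$ and a rate budget $R$. 1. Among the configurations $(f_s,b)$ with $K f_s b=R$, the one with the largest $b$ minimizes $\mathrm{MSE}(f_s,b)$. If $\tilde s\neq 0$ (not almost surely zero), it is the only minimizer. 2. Oversampling with fewer bits is inferior: if $(f_s,b)$ and $(f_s',b')$ both use the budget with resolution $b=\lfloor R/(Kf_s)\rfloor$ and $b'=\lfloor R/(Kf_s')\rfloor$ (which includes the case of equality $Kf_sb=R=Kf_s'b'$), and $b<b'$, then $\mathrm{MSE}(f_s',b')\le\mathrm{MSE}(f_s,b)$, with strict inequality if $\tilde s\neq0$. -/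

import Mathlib

open MeasureTheory ProbabilityTheory Filter Topology
open scoped ENNReal Matrix FourierTransform ComplexOrder

noncomputable section

namespace TaskADC

variable {Ω : Type*} [MeasurableSpace Ω] {M N K : ℕ}

/-! ### Signal model -/

/-- The real processes `x 0, …, x (M-1)` are zero-mean, of finite variance, jointly wide-sense
stationary, and `C` is their joint power spectral density:
`E[x_i(t+τ) x_j(t)] = ∫ C_ij(f) e^{2πi f τ} df`. -/
structure IsWSSWithPSD (μ : Measure Ω) (x : Fin M → ℝ → Ω → ℝ)
    (C : ℝ → Matrix (Fin M) (Fin M) ℂ) : Prop where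
  measurable : ∀ m, Measurable (fun p : ℝ × Ω => x m p.1 p.2)
  memLp : ∀ m t, MemLp (x m t) 2 μ
  mean_zero : ∀ m t, ∫ ω, x m t ω ∂μ = 0
  psd_posSemidef : ∀ f, (C f).PosSemidef
  psd_integrable : ∀ i j, Integrable (fun f => C f i j)
  correlation : ∀ i j t τ,
    ((∫ ω, x i (t + τ) ω * x j t ω ∂μ : ℝ) : ℂ)
      = ∫ f : ℝ, C f i j * Complex.exp (2 * Real.pi * Complex.I * (f : ℂ) * (τ : ℂ))

/-- The σ-algebra generated by a family of real random variables. -/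
abbrev sigmaGen {ι : Type*} (X : ι → Ω → ℝ) : MeasurableSpace Ω :=
  ⨆ i, MeasurableSpace.comap (X i) inferInstance

/-- The σ-algebra generated by the whole observed process `{x_m(t)}`. -/
abbrev inputSigma (x : Fin M → ℝ → Ω → ℝ) : MeasurableSpace Ω :=
  sigmaGen (fun p : Fin M × ℝ => x p.1 p.2)

/-! ### Multivariate linear time-invariant filters -/

/-- Frequency response (entrywise Fourier transform) of a real matrix impulse response. -/
def freqResp (h : ℝ → Matrix (Fin K) (Fin M) ℝ) (f : ℝ) : Matrix (Fin K) (Fin M) ℂ :=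
  fun k m => 𝓕 (fun τ : ℝ => ((h τ k m : ℝ) : ℂ)) f

/-- The convolution `∑ m, (h_{k,m} * x_m)(t)`, along each sample path. -/
def convOut (h : ℝ → Matrix (Fin K) (Fin M) ℝ) (x : Fin M → ℝ → Ω → ℝ)
    (k : Fin K) (t : ℝ) (ω : Ω) : ℝ :=
  ∑ m, ∫ τ : ℝ, h τ k m * x m (t - τ) ω

/-- `y` is the response to `x` of the filter with frequency response `H`. For a filter with an
integrable impulse response it is the convolution `convOut`; for other filters (whose impulse
response need not be an integrable function, e.g. ideal band-pass filters) it is the mean-square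
limit of such convolutions along impulse responses whose frequency responses converge to `H` in
the mean-square sense weighted by the PSD `C` of `x`. -/
structure IsFilterOutput (μ : Measure Ω) (C : ℝ → Matrix (Fin M) (Fin M) ℂ)
    (x : Fin M → ℝ → Ω → ℝ) (H : ℝ → Matrix (Fin K) (Fin M) ℂ)
    (y : Fin K → ℝ → Ω → ℝ) : Prop where
  measurable : ∀ k m, Measurable (fun f => H f k m)
  memLp : ∀ k t, MemLp (y k t) 2 μ
  approx : ∃ h : ℕ → ℝ → Matrix (Fin K) (Fin M) ℝ,
    (∀ j k m, Integrable (fun τ => h j τ k m)) ∧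
    Tendsto (fun j => ∫⁻ f : ℝ, ENNReal.ofReal
      (((freqResp (h j) f - H f) * C f * (freqResp (h j) f - H f)ᴴ).trace.re)) atTop (𝓝 0) ∧
    ∀ k t, Tendsto (fun j => eLpNorm (fun ω => convOut (h j) x k t ω - y k t ω) 2 μ)
      atTop (𝓝 0)

/-! ### Sampling and quantization -/

/-- The samples `y_k[n] = T_s y_k(n T_s)`, with `T_s = 1 / f_s`. -/
def samples (fs : ℝ) (y : Fin K → ℝ → Ω → ℝ) (k : Fin K) (n : ℤ) (ω : Ω) : ℝ :=
  (1 / fs) * y k ((n : ℝ) * (1 / fs)) ω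

/-- Quantization step `Δ = 2γ / 2^b`. -/
def stepSize (γ : ℝ) (b : ℕ) : ℝ := 2 * γ / 2 ^ b

/-- The triangular law on `[-1, 1]`, with density `1 - |w|`. -/
def triangularLaw : Measure ℝ :=
  (volume : Measure ℝ).withDensity (fun w => ENNReal.ofReal (max 0 (1 - |w|)))

/-- Normalized dither `v`: i.i.d. in time and space, triangular on `[-1, 1]`, and independent of
the input process `x` and the task `s`. The dither of a quantizer with step `Δ` is `Δ * v`, which
has the triangular density `(1 - |w| / Δ) / Δ` on `[-Δ, Δ]`. -/
structure IsDither (μ : Measure Ω) (x : Fin M → ℝ → Ω → ℝ) (s : Fin N → Ω → ℝ)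
    (v : Fin K → ℤ → Ω → ℝ) : Prop where
  measurable : ∀ k n, Measurable (v k n)
  law : ∀ k n, μ.map (v k n) = triangularLaw
  iIndep : iIndepFun (fun p : Fin K × ℤ => v p.1 p.2) μ
  indep_input : Indep (sigmaGen (fun p : Fin K × ℤ => v p.1 p.2))
    (inputSigma x ⊔ sigmaGen s) μ

/-- `γ` is the dynamic range of the quantizers: `γ² = η² max_k E[(y_k[n] + w_k[n])²]`, where
`w = Δ v` is the dither and `Δ` depends on `γ` itself. -/
def IsDynamicRange (μ : Measure Ω) (η : ℝ) (b : ℕ) (y v : Fin K → ℤ → Ω → ℝ) (γ : ℝ) : Prop :=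
  0 ≤ γ ∧ ∀ n, γ ^ 2 = η ^ 2 * ⨆ k, ∫ ω, (y k n ω + stepSize γ b * v k n ω) ^ 2 ∂μ

/-- Mid-rise uniform quantizer of step `Δ` within its dynamic range (no overload). -/
def midRise (Δ a : ℝ) : ℝ := Δ * ((⌊a / Δ⌋ : ℝ) + 1 / 2)

/-- Output `z_k[n]` of the non-overloading nonsubtractive dithered quantizers. -/
def quantized (γ : ℝ) (b : ℕ) (y v : Fin K → ℤ → Ω → ℝ) (k : Fin K) (n : ℤ) (ω : Ω) : ℝ :=
  midRise (stepSize γ b) (y k n ω + stepSize γ b * v k n ω)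

/-! ### Digital recovery and mean-squared error -/

/-- `shat = ∑ n, G[-n] z[n]`, the series converging in mean square. -/
def IsLinearEstimate (μ : Measure Ω) (G : ℤ → Matrix (Fin N) (Fin K) ℝ)
    (z : Fin K → ℤ → Ω → ℝ) (shat : Fin N → Ω → ℝ) : Prop :=
  ∀ i, MemLp (shat i) 2 μ ∧
    Tendsto (fun J : ℕ => eLpNorm (fun ω =>
      (∑ n ∈ Finset.Icc (-(J : ℤ)) (J : ℤ), ∑ k, G (-n) i k * z k n ω) - shat i ω) 2 μ)
      atTop (𝓝 0)

/-- The mean-squared error `E ‖s - shat‖²` (Euclidean norm). -/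
def mse (μ : Measure Ω) (s shat : Fin N → Ω → ℝ) : ℝ :=
  ∫ ω, ∑ i, (s i ω - shat i ω) ^ 2 ∂μ

/-- The MSEs achieved by the acquisition systems with `K` ADCs, sampling rate `fs` and `b` bits per
sample, over all analog filters `H` and all linear digital filters `G`. -/
def achievableMSE (μ : Measure Ω) (x : Fin M → ℝ → Ω → ℝ) (C : ℝ → Matrix (Fin M) (Fin M) ℂ)
    (s : Fin N → Ω → ℝ) (v : Fin K → ℤ → Ω → ℝ) (η fs : ℝ) (b : ℕ) : Set ℝ :=
  {e | ∃ (H : ℝ → Matrix (Fin K) (Fin M) ℂ) (y : Fin K → ℝ → Ω → ℝ) (γ : ℝ)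
      (G : ℤ → Matrix (Fin N) (Fin K) ℝ) (shat : Fin N → Ω → ℝ),
      IsFilterOutput μ C x H y ∧
      IsDynamicRange μ η b (samples fs y) v γ ∧
      IsLinearEstimate μ G (quantized γ b (samples fs y) v) shat ∧
      e = mse μ s shat}

/-- The minimum achievable MSE for the ADC configuration `(K, fs, b)`. -/
def minMSE (μ : Measure Ω) (x : Fin M → ℝ → Ω → ℝ) (C : ℝ → Matrix (Fin M) (Fin M) ℂ)
    (s : Fin N → Ω → ℝ) (v : Fin K → ℤ → Ω → ℝ) (η fs : ℝ) (b : ℕ) : ℝ :=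
  sInf (achievableMSE μ x C s v η fs b)

/-! ### Configurations -/

/-- Sampling rate at or above the Nyquist rate, at least one bit per sample, and a resolution for
which the quantizers have a dynamic range: `γ² = η² (max_k E[y_k²] + 2γ² / (3·2^{2b}))` is solvable
for nonzero `y` exactly when `2 η² < 3 · 2^{2b}`. -/
def IsConfig (η fnyq fs : ℝ) (b : ℕ) : Prop :=
  0 < fs ∧ fnyq ≤ fs ∧ 1 ≤ b ∧ 2 * η ^ 2 < 3 * 2 ^ (2 * b)

/-- The pairs `(fs, b)` that exhaust the rate budget: `R = K · fs · b`. -/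
def budgetConfigs (K : ℕ) (η fnyq R : ℝ) : Set (ℝ × ℕ) :=
  {p | IsConfig η fnyq p.1 p.2 ∧ R = K * p.1 * p.2}

/-- As `budgetConfigs`, for arbitrary sampling rates, the resolution being rounded down to an
integer: `b = ⌊R / (K · fs)⌋`. -/
def roundedConfigs (K : ℕ) (η fnyq R : ℝ) : Set (ℝ × ℕ) :=
  {p | IsConfig η fnyq p.1 p.2 ∧ p.2 = ⌊R / (K * p.1)⌋₊}

end TaskADC

end

noncomputable section

namespace TaskADC

/-! ### Sesquilinear forms of spectral density matrices -/

/-! The error of any system with finitely many digital taps splits orthogonally into three terms: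
the error of the MMSE estimate itself, the distortion of recovering that estimate from unquantized
samples, and a noise term `noiseFactor η b * peakPower C H / fs ^ 2 * tapEnergy S g`. The noise is
this simple because triangular dither makes the first two conditional moments of the quantization
error independent of the signal, so the error is white and orthogonal to all square-integrable
functions of the input and the task (`isWhiteNoise_quantError`). Solving the self-referential
equation for the dynamic range gives the factor `η² / (2^(2b) - 2η²/3)`.

Now keep the analog filter and lower the rate from `fs` to `fs'`, still at least Nyquist. Only the
digital response on `[-fs'/2, fs'/2]` matters, since the PSD vanishes outside. Restricting it to
this band and rescaling by `fs'/fs` leaves the recovered signal unchanged, while by Parseval the tap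
energy drops at least by the factor `fs'/fs` (`IsFilterOutput.exists_resampled`, up to approximation
by finitely many taps). The noise term is thus multiplied by at most `noiseFactor η b' * fs /
(noiseFactor η b * fs')`. One extra bit gains a factor of about four, while the rate falls only
about like `b / b'`; even with rounded resolutions the quotient is at most `3/4`
(`noiseFactor_mul_le`). This proves the weak inequality.

For strictness it is not enough that each system improves, because the infima need not be attained;
a uniform gap is needed. If the noise term of a competitor is not small, resampling removes a
quarter of it. If it is small, then the product of signal power and tap energy is small, so the
digital output carries almost nothing of the target and the error is close to that of the zero
estimate (`exists_recoveryError_ge`). But the better configuration strictly beats the zero estimate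
when the MMSE estimate is nonzero (`minMSE_lt_of_not_ae_eq_zero`). Balancing the two cases bounds
the gap below.

All second-order computations use `SpectralFamily`: covariances of filtered samples are inner
products of frequency responses weighted by the PSD, so no stochastic spectral integral is needed.
-/

/-- The sesquilinear form `a A bᴴ` of a square matrix `A`. -/
def specForm {M : ℕ} (A : Matrix (Fin M) (Fin M) ℂ) (a b : Fin M → ℂ) : ℂ :=
  ∑ i, ∑ j, a i * A i j * star (b j)

section SpecForm

variable {M : ℕ} {A : Matrix (Fin M) (Fin M) ℂ}

lemma specForm_eq_dotProduct (a b : Fin M → ℂ) :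
    specForm A a b = a ⬝ᵥ (A *ᵥ star b) := by
  simp [specForm, dotProduct, Matrix.mulVec, Finset.mul_sum, mul_assoc]

lemma specForm_add_left (a a' b : Fin M → ℂ) :
    specForm A (a + a') b = specForm A a b + specForm A a' b := by
  simp [specForm_eq_dotProduct, add_dotProduct]

lemma specForm_add_right (a b b' : Fin M → ℂ) :
    specForm A a (b + b') = specForm A a b + specForm A a b' := by
  simp [specForm_eq_dotProduct, Matrix.mulVec_add, dotProduct_add]

lemma specForm_smul_left (c : ℂ) (a b : Fin M → ℂ) :
    specForm A (c • a) b = c * specForm A a b := by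
  simp [specForm_eq_dotProduct, smul_dotProduct]

lemma specForm_smul_right (c : ℂ) (a b : Fin M → ℂ) :
    specForm A a (c • b) = star c * specForm A a b := by
  simp [specForm_eq_dotProduct, Matrix.mulVec_smul, dotProduct_smul]

lemma specForm_sub_left (a a' b : Fin M → ℂ) :
    specForm A (a - a') b = specForm A a b - specForm A a' b := by
  simp [specForm_eq_dotProduct, sub_dotProduct]

lemma specForm_sub_right (a b b' : Fin M → ℂ) :
    specForm A a (b - b') = specForm A a b - specForm A a b' := by
  simp [specForm_eq_dotProduct, Matrix.mulVec_sub, dotProduct_sub]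

lemma specForm_sum_left {ι : Type*} (F : Finset ι) (a : ι → Fin M → ℂ) (b : Fin M → ℂ) :
    specForm A (∑ i ∈ F, a i) b = ∑ i ∈ F, specForm A (a i) b := by
  simp [specForm_eq_dotProduct, sum_dotProduct]

lemma specForm_sum_right {ι : Type*} (F : Finset ι) (a : Fin M → ℂ) (b : ι → Fin M → ℂ) :
    specForm A a (∑ i ∈ F, b i) = ∑ i ∈ F, specForm A a (b i) := by
  classical
  induction F using Finset.induction_on with
  | empty => simp [specForm]
  | insert i F hi ih => rw [Finset.sum_insert hi, Finset.sum_insert hi, specForm_add_right, ih]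

lemma specForm_zero_matrix (a b : Fin M → ℂ) : specForm 0 a b = 0 := by
  simp [specForm]

-- Factoring `A` as `star B * B` turns the form into a genuine inner product, from which
-- Cauchy-Schwarz, positivity and Hermitian symmetry are inherited. The arguments are swapped
-- because the inner product is conjugate-linear in its first slot.
open scoped MatrixOrder Matrix.Norms.L2Operator in
lemma exists_specForm_eq_inner (hA : A.PosSemidef) :
    ∃ T : (Fin M → ℂ) → EuclideanSpace ℂ (Fin M),
      ∀ a b, specForm A a b = inner ℂ (T b) (T a) := by
  obtain ⟨B, hB⟩ := CStarAlgebra.nonneg_iff_eq_star_mul_self.mp hA.nonneg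
  refine ⟨fun a => WithLp.toLp 2 (fun k => ∑ i, a i * star (B k i)), fun a b => ?_⟩
  subst hB
  simp only [specForm, EuclideanSpace.inner_eq_star_dotProduct, dotProduct, Matrix.mul_apply,
    Matrix.star_apply, Pi.star_apply, star_sum, star_mul', star_star, Finset.mul_sum,
    Finset.sum_mul]
  calc ∑ i, ∑ j, ∑ k, a i * (star (B k i) * B k j) * star (b j)
      = ∑ i, ∑ k, ∑ j, a i * (star (B k i) * B k j) * star (b j) :=
        Finset.sum_congr rfl fun i _ => Finset.sum_comm
    _ = ∑ k, ∑ i, ∑ j, a i * (star (B k i) * B k j) * star (b j) := Finset.sum_comm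
    _ = _ := by
      refine Finset.sum_congr rfl fun k _ => ?_
      rw [Finset.sum_comm]
      refine Finset.sum_congr rfl fun j _ => Finset.sum_congr rfl fun i _ => by ring

lemma specForm_self (hA : A.PosSemidef) (a : Fin M → ℂ) :
    specForm A a a = ((specForm A a a).re : ℂ) := by
  obtain ⟨T, hT⟩ := exists_specForm_eq_inner hA
  rw [hT, inner_self_eq_norm_sq_to_K]
  norm_cast

lemma specForm_self_re_nonneg (hA : A.PosSemidef) (a : Fin M → ℂ) :
    0 ≤ (specForm A a a).re := by
  obtain ⟨T, hT⟩ := exists_specForm_eq_inner hA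
  rw [hT]
  exact inner_self_nonneg (𝕜 := ℂ)

lemma norm_specForm_le (hA : A.PosSemidef) (a b : Fin M → ℂ) :
    ‖specForm A a b‖ ≤ √(specForm A a a).re * √(specForm A b b).re := by
  obtain ⟨T, hT⟩ := exists_specForm_eq_inner hA
  have h : ∀ a, √(specForm A a a).re = ‖T a‖ := fun a => by
    have : (specForm A a a).re = ‖T a‖ ^ 2 := by
      rw [hT, inner_self_eq_norm_sq_to_K]; norm_cast
    rw [this, Real.sqrt_sq (norm_nonneg _)]
  rw [h, h, hT, mul_comm]
  exact norm_inner_le_norm _ _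

/-- A weighted arithmetic-geometric version of the Cauchy-Schwarz inequality. -/
lemma two_mul_norm_specForm_le (hA : A.PosSemidef) (a b : Fin M → ℂ) {r : ℝ} (hr : 0 < r) :
    2 * ‖specForm A a b‖ ≤ r * (specForm A a a).re + r⁻¹ * (specForm A b b).re := by
  have h := norm_specForm_le hA a b
  have ha := Real.sq_sqrt (specForm_self_re_nonneg hA a)
  have hb := Real.sq_sqrt (specForm_self_re_nonneg hA b)
  set x := √(specForm A a a).re
  set y := √(specForm A b b).re
  rw [← ha, ← hb]
  have hrr : r * r⁻¹ = 1 := mul_inv_cancel₀ hr.ne'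
  have : r * x ^ 2 + r⁻¹ * y ^ 2 - 2 * (x * y) = r⁻¹ * (r * x - y) ^ 2 := by
    field_simp; ring
  have := mul_nonneg (inv_nonneg.2 hr.le) (sq_nonneg (r * x - y))
  linarith

/-- The parallelogram law with the nonnegative term of `a - b` dropped. -/
lemma specForm_add_self_re_le (hA : A.PosSemidef) (a b : Fin M → ℂ) :
    (specForm A (a + b) (a + b)).re ≤ 2 * (specForm A a a).re + 2 * (specForm A b b).re := by
  have h := specForm_self_re_nonneg hA (a - b)
  simp only [specForm_add_left, specForm_add_right, specForm_sub_left, specForm_sub_right,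
    Complex.add_re, Complex.sub_re] at h ⊢
  linarith

end SpecForm

/-! ### Square-integrable random variables -/

section L2

variable {Ω : Type*} [MeasurableSpace Ω] {μ : Measure Ω}

/-- Continuity of the inner product of `L²`, transported to representatives. -/
lemma tendsto_integral_mul_of_tendsto_eLpNorm {X Y : Ω → ℝ} {Xn Yn : ℕ → Ω → ℝ}
    (hX : MemLp X 2 μ) (hY : MemLp Y 2 μ) (hXn : ∀ n, MemLp (Xn n) 2 μ)
    (hYn : ∀ n, MemLp (Yn n) 2 μ)
    (hXl : Tendsto (fun n => eLpNorm (fun ω => Xn n ω - X ω) 2 μ) atTop (𝓝 0))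
    (hYl : Tendsto (fun n => eLpNorm (fun ω => Yn n ω - Y ω) 2 μ) atTop (𝓝 0)) :
    Tendsto (fun n => ∫ ω, Xn n ω * Yn n ω ∂μ) atTop (𝓝 (∫ ω, X ω * Y ω ∂μ)) := by
  have key : ∀ {U V : Ω → ℝ} (hU : MemLp U 2 μ) (hV : MemLp V 2 μ),
      ∫ ω, U ω * V ω ∂μ = inner ℝ (hV.toLp V) (hU.toLp U) := by
    intro U V hU hV
    rw [MeasureTheory.L2.inner_def]
    refine integral_congr_ae ?_
    filter_upwards [hU.coeFn_toLp, hV.coeFn_toLp] with ω h1 h2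
    simp [h1, h2]
  have hlim : ∀ {U : Ω → ℝ} {Un : ℕ → Ω → ℝ} (hU : MemLp U 2 μ) (hUn : ∀ n, MemLp (Un n) 2 μ),
      Tendsto (fun n => eLpNorm (fun ω => Un n ω - U ω) 2 μ) atTop (𝓝 0) →
      Tendsto (fun n => (hUn n).toLp (Un n)) atTop (𝓝 (hU.toLp U)) := by
    intro U Un hU hUn h
    rw [Lp.tendsto_Lp_iff_tendsto_eLpNorm'']
    exact h
  rw [key hX hY]
  simp_rw [fun n => key (hXn n) (hYn n)]
  exact (hlim hY hYn hYl).inner (hlim hX hXn hXl)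

lemma MemLp.integrable_mul_two {X Y : Ω → ℝ} (hX : MemLp X 2 μ) (hY : MemLp Y 2 μ) :
    Integrable (fun ω => X ω * Y ω) μ :=
  MemLp.integrable_mul hX hY

end L2

/-! ### Spectral representations of families of random variables -/

section Spectral

variable {Ω : Type*} [MeasurableSpace Ω] {μ : Measure Ω} {M : ℕ}
  {C : ℝ → Matrix (Fin M) (Fin M) ℂ}

/-- The random variables `X i` have the frequency responses `a i` with respect to the power
spectral density `C`: their inner products are those of the `a i` in the `C`-weighted `L²` space. -/
structure SpectralFamily (μ : Measure Ω) (C : ℝ → Matrix (Fin M) (Fin M) ℂ) {ι : Type*}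
    (X : ι → Ω → ℝ) (a : ι → ℝ → Fin M → ℂ) : Prop where
  memLp : ∀ i, MemLp (X i) 2 μ
  measurable : ∀ i m, Measurable (fun f => a i f m)
  integrable : ∀ i, Integrable (fun f => (specForm (C f) (a i f) (a i f)).re)
  inner : ∀ i j, ((∫ ω, X i ω * X j ω ∂μ : ℝ) : ℂ) = ∫ f, specForm (C f) (a i f) (a j f)

lemma aestronglyMeasurable_specForm (hC : ∀ i j, AEStronglyMeasurable (fun f => C f i j))
    {a b : ℝ → Fin M → ℂ} (ha : ∀ m, Measurable fun f => a f m)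
    (hb : ∀ m, Measurable fun f => b f m) :
    AEStronglyMeasurable (fun f => specForm (C f) (a f) (b f)) := by
  unfold specForm
  refine Finset.aestronglyMeasurable_fun_sum _ fun i _ =>
    Finset.aestronglyMeasurable_fun_sum _ fun j _ => ?_
  exact ((ha i).aestronglyMeasurable.mul (hC i j)).mul
    (continuous_star.comp_aestronglyMeasurable (hb j).aestronglyMeasurable)

lemma integrable_specForm (hpsd : ∀ f, (C f).PosSemidef)
    (hC : ∀ i j, AEStronglyMeasurable (fun f => C f i j))
    {a b : ℝ → Fin M → ℂ} (ha : ∀ m, Measurable fun f => a f m)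
    (hb : ∀ m, Measurable fun f => b f m)
    (hai : Integrable fun f => (specForm (C f) (a f) (a f)).re)
    (hbi : Integrable fun f => (specForm (C f) (b f) (b f)).re) :
    Integrable (fun f => specForm (C f) (a f) (b f)) := by
  refine (hai.add hbi).mono' (aestronglyMeasurable_specForm hC ha hb) (.of_forall fun f => ?_)
  have := two_mul_norm_specForm_le (hpsd f) (a f) (b f) one_pos
  have := norm_nonneg (specForm (C f) (a f) (b f))
  simp only [one_mul, inv_one, Pi.add_apply] at *
  linarith

/-- The free weight `r` substitutes for Cauchy-Schwarz in the `C`-weighted `L²` space, which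
therefore never has to be constructed. -/
lemma norm_integral_specForm_le (hpsd : ∀ f, (C f).PosSemidef)
    {a b : ℝ → Fin M → ℂ}
    (hai : Integrable fun f => (specForm (C f) (a f) (a f)).re)
    (hbi : Integrable fun f => (specForm (C f) (b f) (b f)).re) {r : ℝ} (hr : 0 < r) :
    2 * ‖∫ f, specForm (C f) (a f) (b f)‖ ≤
      r * (∫ f, (specForm (C f) (a f) (a f)).re) +
        r⁻¹ * ∫ f, (specForm (C f) (b f) (b f)).re := by
  have h1 : ‖∫ f, specForm (C f) (a f) (b f)‖ ≤ ∫ f, (r / 2 * (specForm (C f) (a f) (a f)).re +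
      r⁻¹ / 2 * (specForm (C f) (b f) (b f)).re) := by
    refine norm_integral_le_of_norm_le ((hai.const_mul _).add (hbi.const_mul _))
      (.of_forall fun f => ?_)
    have := two_mul_norm_specForm_le (hpsd f) (a f) (b f) hr
    linarith
  rw [integral_add (hai.const_mul _) (hbi.const_mul _), integral_const_mul,
    integral_const_mul] at h1
  linarith

namespace SpectralFamily

variable {ι : Type*} {X : ι → Ω → ℝ} {a : ι → ℝ → Fin M → ℂ}

lemma integrable_cross (h : SpectralFamily μ C X a) (hpsd : ∀ f, (C f).PosSemidef)
    (hC : ∀ i j, AEStronglyMeasurable (fun f => C f i j)) (i j : ι) :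
    Integrable (fun f => specForm (C f) (a i f) (a j f)) :=
  integrable_specForm hpsd hC (h.measurable i) (h.measurable j) (h.integrable i) (h.integrable j)

lemma integral_sq (h : SpectralFamily μ C X a) (hpsd : ∀ f, (C f).PosSemidef)
    (i : ι) : ∫ ω, X i ω ^ 2 ∂μ = ∫ f, (specForm (C f) (a i f) (a i f)).re := by
  have := h.inner i i
  rw [integral_congr_ae (.of_forall fun f => specForm_self (hpsd f) (a i f)),
    integral_complex_ofReal] at this
  simpa [sq] using Complex.ofReal_injective this

/-- Real linear combinations. -/
lemma sum (h : SpectralFamily μ C X a) (hpsd : ∀ f, (C f).PosSemidef)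
    (hC : ∀ i j, AEStronglyMeasurable (fun f => C f i j)) {κ : Type*}
    (F : Finset ι) (c : κ → ι → ℝ) :
    SpectralFamily μ C (fun k ω => ∑ i ∈ F, c k i * X i ω)
      (fun k f => ∑ i ∈ F, (c k i : ℂ) • a i f) := by
  have hint : ∀ k l, Integrable fun f => specForm (C f) (∑ i ∈ F, (c k i : ℂ) • a i f)
      (∑ i ∈ F, (c l i : ℂ) • a i f) := by
    intro k l
    simp_rw [specForm_sum_left, specForm_sum_right, specForm_smul_left, specForm_smul_right]
    exact integrable_finsetSum _ fun i _ => integrable_finsetSum _ fun j _ =>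
      ((h.integrable_cross hpsd hC i j).const_mul _).const_mul _
  refine ⟨fun k => memLp_finsetSum _ fun i _ => (h.memLp i).const_mul _, fun k m => ?_,
    fun k => (hint k k).re, fun k l => ?_⟩
  · simp only [Finset.sum_apply, Pi.smul_apply, smul_eq_mul]
    exact Finset.measurable_fun_sum _ fun i _ => (h.measurable i m).const_mul _
  · simp_rw [specForm_sum_left, specForm_sum_right, specForm_smul_left, specForm_smul_right]
    rw [integral_finsetSum _ fun i _ => integrable_finsetSum _ fun j _ =>
      ((h.integrable_cross hpsd hC i j).const_mul _).const_mul _]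
    simp_rw [Finset.sum_mul_sum]
    have hm : ∀ i j, Integrable (fun ω => c k i * X i ω * (c l j * X j ω)) μ := fun i j =>
      MemLp.integrable_mul_two ((h.memLp i).const_mul _) ((h.memLp j).const_mul _)
    rw [integral_finsetSum _ fun i _ => integrable_finsetSum _ fun j _ => hm i j]
    push_cast
    refine Finset.sum_congr rfl fun i _ => ?_
    rw [integral_finsetSum _ fun j _ => hm i j,
      integral_finsetSum _ fun j _ => ((h.integrable_cross hpsd hC i j).const_mul _).const_mul _]
    push_cast
    refine Finset.sum_congr rfl fun j _ => ?_
    rw [integral_const_mul, integral_const_mul, ← h.inner i j,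
      integral_congr_ae (g := fun ω => (c k i * c l j) * (X i ω * X j ω))
        (.of_forall fun ω => by ring), integral_const_mul]
    simp only [Complex.star_def, Complex.conj_ofReal]
    push_cast
    ring

/-- The real part of a complex linear combination has at most the power of the combination. -/
lemma integral_sq_sum_re_le (h : SpectralFamily μ C X a) (hpsd : ∀ f, (C f).PosSemidef)
    (hC : ∀ i j, AEStronglyMeasurable (fun f => C f i j)) (F : Finset ι) (c : ι → ℂ) :
    ∫ ω, (∑ i ∈ F, (c i).re * X i ω) ^ 2 ∂μ ≤
      ∫ f, (specForm (C f) (∑ i ∈ F, c i • a i f) (∑ i ∈ F, c i • a i f)).re := by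
  have hs := h.sum hpsd hC F (fun (k : Bool) i => bif k then (c i).re else (c i).im)
  set Y := fun (k : Bool) ω => ∑ i ∈ F, (bif k then (c i).re else (c i).im) * X i ω with hY
  set b : Bool → ℝ → Fin M → ℂ :=
    fun k f => ∑ i ∈ F, ((bif k then (c i).re else (c i).im : ℝ) : ℂ) • a i f with hb
  -- The coefficients are split as real part plus `I` times imaginary part; `b true` and `b false`
  -- are the responses of the two real combinations.
  have hsum : ∀ f, ∑ i ∈ F, c i • a i f = b true f + Complex.I • b false f := by
    intro f
    simp only [hb, cond_true, cond_false, Finset.smul_sum, ← Finset.sum_add_distrib, smul_smul,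
      ← add_smul]
    refine Finset.sum_congr rfl fun i _ => ?_
    rw [mul_comm, Complex.re_add_im]
  have hexp : ∀ f, specForm (C f) (∑ i ∈ F, c i • a i f) (∑ i ∈ F, c i • a i f) =
      specForm (C f) (b true f) (b true f) + specForm (C f) (b false f) (b false f) +
      Complex.I * (specForm (C f) (b false f) (b true f) -
        specForm (C f) (b true f) (b false f)) := by
    intro f
    rw [hsum]
    simp only [specForm_add_left, specForm_add_right, specForm_smul_left, specForm_smul_right,
      Complex.star_def, Complex.conj_I]
    linear_combination -(specForm (C f) (b false f) (b false f)) * Complex.I_mul_I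
  have hi := hs.integrable_cross hpsd hC
  have hint : Integrable fun f =>
      specForm (C f) (∑ i ∈ F, c i • a i f) (∑ i ∈ F, c i • a i f) := by
    simp_rw [hexp]
    exact ((hi _ _).add (hi _ _)).add (((hi _ _).sub (hi _ _)).const_mul _)
  have e1 : ∫ f, (specForm (C f) (∑ i ∈ F, c i • a i f) (∑ i ∈ F, c i • a i f)).re =
      (∫ f, specForm (C f) (∑ i ∈ F, c i • a i f) (∑ i ∈ F, c i • a i f)).re :=
    integral_re hint
  rw [e1]
  simp_rw [hexp]
  have hsub : Integrable fun f => specForm (C f) (b false f) (b true f) -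
      specForm (C f) (b true f) (b false f) := (hi _ _).sub (hi _ _)
  rw [integral_add ((hi _ _).fun_add (hi _ _)) (hsub.const_mul _),
    integral_add (hi _ _) (hi _ _), integral_const_mul, integral_sub (hi _ _) (hi _ _),
    ← hs.inner, ← hs.inner, ← hs.inner, ← hs.inner]
  -- The cross terms of the real and imaginary parts equal inner products of real random variables;
  -- these are symmetric, so their difference vanishes. What remains besides the real part is a
  -- nonnegative power.
  have hcomm : ∫ ω, Y false ω * Y true ω ∂μ = ∫ ω, Y true ω * Y false ω ∂μ := by
    simp_rw [mul_comm]
  rw [hcomm, sub_self, mul_zero, add_zero, Complex.add_re, Complex.ofReal_re, Complex.ofReal_re]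
  have : 0 ≤ ∫ ω, Y false ω * Y false ω ∂μ := integral_nonneg fun ω => mul_self_nonneg _
  simp only [sq]
  exact le_add_of_nonneg_right this

/-- Mean-square limits. -/
lemma of_tendsto {Xn : ℕ → ι → Ω → ℝ} {an : ℕ → ι → ℝ → Fin M → ℂ}
    (hpsd : ∀ f, (C f).PosSemidef) (hC : ∀ i j, AEStronglyMeasurable (fun f => C f i j))
    (h : ∀ n, SpectralFamily μ C (Xn n) (an n))
    (hX : ∀ i, MemLp (X i) 2 μ) (ha : ∀ i m, Measurable fun f => a i f m)
    (hXl : ∀ i, Tendsto (fun n => eLpNorm (fun ω => Xn n i ω - X i ω) 2 μ) atTop (𝓝 0))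
    (hal : ∀ i, Tendsto (fun n => ∫⁻ f, ENNReal.ofReal
      (specForm (C f) (an n i f - a i f) (an n i f - a i f)).re) atTop (𝓝 0)) :
    SpectralFamily μ C X a := by
  have hdm : ∀ n i m, Measurable fun f => (an n i f - a i f) m := fun n i m =>
    ((h n).measurable i m).sub (ha i m)
  have hdre : ∀ n i, AEStronglyMeasurable fun f =>
      (specForm (C f) (an n i f - a i f) (an n i f - a i f)).re := fun n i =>
    Complex.continuous_re.comp_aestronglyMeasurable
      (aestronglyMeasurable_specForm hC (hdm n i) (hdm n i))
  have hd_int : ∀ i, ∀ᶠ n in atTop, Integrable fun f =>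
      (specForm (C f) (an n i f - a i f) (an n i f - a i f)).re := by
    intro i
    filter_upwards [(hal i).eventually (gt_mem_nhds ENNReal.zero_lt_top)] with n hn
    exact ⟨hdre n i, (hasFiniteIntegral_iff_ofReal
      (.of_forall fun f => specForm_self_re_nonneg (hpsd f) _)).2 hn⟩
  -- A single index `n` at finite weighted distance suffices: the limit response is the `n`-th
  -- response minus an error of finite power.
  have hai : ∀ i, Integrable fun f => (specForm (C f) (a i f) (a i f)).re := by
    intro i
    obtain ⟨n, hn⟩ := (hd_int i).exists
    refine ((((h n).integrable i).const_mul 2).add (hn.const_mul 2)).mono'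
      (Complex.continuous_re.comp_aestronglyMeasurable
        (aestronglyMeasurable_specForm hC (ha i) (ha i))) (.of_forall fun f => ?_)
    rw [Real.norm_eq_abs, abs_of_nonneg (specForm_self_re_nonneg (hpsd f) _)]
    have := specForm_add_self_re_le (hpsd f) (an n i f) (-(an n i f - a i f))
    have e : an n i f + -(an n i f - a i f) = a i f := by abel
    rw [e] at this
    have e' : ∀ b : Fin M → ℂ, specForm (C f) (-b) (-b) = specForm (C f) b b := fun b => by
      simp [specForm]
    rw [e'] at this
    simpa using this
  have hdl : ∀ i, Tendsto (fun n => ∫ f, (specForm (C f) (an n i f - a i f)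
      (an n i f - a i f)).re) atTop (𝓝 0) := by
    intro i
    have h0 := (ENNReal.tendsto_toReal ENNReal.zero_ne_top).comp (hal i)
    simp only [ENNReal.toReal_zero] at h0
    refine h0.congr fun n => ?_
    rw [integral_eq_lintegral_of_nonneg_ae
      (.of_forall fun f => specForm_self_re_nonneg (hpsd f) _) (hdre n i)]
    rfl
  have small : ∀ i (b : ℝ → Fin M → ℂ), (Integrable fun f => (specForm (C f) (b f) (b f)).re) →
      Tendsto (fun n => ∫ f, specForm (C f) (an n i f - a i f) (b f)) atTop (𝓝 0) := by
    intro i b hb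
    rw [Metric.tendsto_nhds]
    intro ε hε
    set B := ∫ f, (specForm (C f) (b f) (b f)).re with hB
    have hB0 : 0 ≤ B := integral_nonneg fun f => specForm_self_re_nonneg (hpsd f) _
    -- With this weight the fixed factor contributes `r⁻¹ * B ≤ ε`, and the vanishing factor is then
    -- taken below `ε / r`. The `+ 1` keeps `r` positive when `B = 0`.
    set r : ℝ := (B + 1) / ε with hr
    have hr0 : 0 < r := by positivity
    filter_upwards [hd_int i, (hdl i).eventually (gt_mem_nhds (show 0 < ε / r by positivity))]
      with n hn1 hn2
    have := norm_integral_specForm_le hpsd hn1 hb hr0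
    rw [dist_zero_right]
    have h2 : r⁻¹ * B ≤ ε := by
      rw [hr, inv_div, div_mul_eq_mul_div, div_le_iff₀ (by positivity)]
      nlinarith
    have h3 : r * (∫ f, (specForm (C f) (an n i f - a i f) (an n i f - a i f)).re) < ε := by
      rwa [lt_div_iff₀' hr0] at hn2
    linarith
  refine ⟨hX, ha, hai, fun i j => ?_⟩
  have hconj : ∀ {p q : ℝ → Fin M → ℂ}, ∫ f, specForm (C f) (p f) (q f) =
      star (∫ f, specForm (C f) (q f) (p f)) := by
    intro p q
    rw [Complex.star_def, ← integral_conj]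
    refine integral_congr_ae (.of_forall fun f => ?_)
    obtain ⟨T, hT⟩ := exists_specForm_eq_inner (hpsd f)
    simp only [hT]
    exact (inner_conj_symm _ _).symm
  have l1 : Tendsto (fun n => ((∫ ω, Xn n i ω * Xn n j ω ∂μ : ℝ) : ℂ)) atTop
      (𝓝 ((∫ ω, X i ω * X j ω ∂μ : ℝ) : ℂ)) :=
    (Complex.continuous_ofReal.tendsto _).comp (tendsto_integral_mul_of_tendsto_eLpNorm
      (hX i) (hX j) (fun n => (h n).memLp i) (fun n => (h n).memLp j) (hXl i) (hXl j))
  refine tendsto_nhds_unique l1 ?_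
  simp_rw [fun n => (h n).inner i j]
  -- the cross terms of the errors
  have cross : Tendsto (fun n => ∫ f, specForm (C f) (an n i f - a i f) (an n j f - a j f))
      atTop (𝓝 0) := by
    rw [tendsto_zero_iff_norm_tendsto_zero]
    have hz : Tendsto (fun n => (∫ f, (specForm (C f) (an n i f - a i f) (an n i f - a i f)).re) +
      ∫ f, (specForm (C f) (an n j f - a j f) (an n j f - a j f)).re) atTop (𝓝 0) := by
      simpa using (hdl i).add (hdl j)
    refine tendsto_of_tendsto_of_tendsto_of_le_of_le' tendsto_const_nhds hz
      (.of_forall fun n => norm_nonneg _) ?_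
    filter_upwards [hd_int i, hd_int j] with n h1 h2
    have := norm_integral_specForm_le hpsd h1 h2 one_pos
    have := norm_nonneg (∫ f, specForm (C f) (an n i f - a i f) (an n j f - a j f))
    simp only [one_mul, inv_one] at *
    linarith
  have s1 := small i (a j) (hai j)
  have s2 := (continuous_star.tendsto _).comp (small j (a i) (hai i))
  have htot := ((cross.add s1).add s2).add_const (∫ f, specForm (C f) (a i f) (a j f))
  simp only [star_zero, add_zero, zero_add] at htot
  refine htot.congr' ?_
  filter_upwards [hd_int i, hd_int j] with n h1 h2
  have i1 := integrable_specForm hpsd hC (hdm n i) (hdm n j) h1 h2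
  have i2 := integrable_specForm hpsd hC (hdm n i) (ha j) h1 (hai j)
  have i3 := integrable_specForm hpsd hC (ha i) (hdm n j) (hai i) h2
  have i4 := integrable_specForm hpsd hC (ha i) (ha j) (hai i) (hai j)
  simp only [Function.comp]
  rw [← hconj, ← integral_add i1 i2, ← integral_add (i1.fun_add i2) i3,
    ← integral_add ((i1.fun_add i2).fun_add i3) i4]
  refine integral_congr_ae (.of_forall fun f => ?_)
  simp only [specForm_sub_left, specForm_sub_right]
  ring

end SpectralFamily

end Spectral

end TaskADC

end

noncomputable section

namespace TaskADC

/-! ### Convolutions of second-order processes -/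

section Convolution

variable {Ω : Type*} [MeasurableSpace Ω] {μ : Measure Ω}

/-- Cauchy-Schwarz for the measure `|h| dτ`, from integrating `|h| (|g| - l)² ≥ 0` with `l` close to
its optimal value. The `+ 1` avoids a division by zero when `h` vanishes almost everywhere. -/
lemma sq_integral_mul_le {h g : ℝ → ℝ} (hh : Integrable h)
    (hg : Integrable fun τ => |h τ| * g τ ^ 2) (hhg : Integrable fun τ => h τ * g τ) :
    (∫ τ, h τ * g τ) ^ 2 ≤ ((∫ τ, |h τ|) + 1) * ∫ τ, |h τ| * g τ ^ 2 := by
  set B := ∫ τ, |h τ * g τ| with hB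
  have hB0 : 0 ≤ B := integral_nonneg fun _ => abs_nonneg _
  have h1 : |∫ τ, h τ * g τ| ≤ B := abs_integral_le_integral_abs
  set H := ∫ τ, |h τ| with hH
  have hH0 : 0 ≤ H := integral_nonneg fun _ => abs_nonneg _
  set A := ∫ τ, |h τ| * g τ ^ 2 with hA
  have key : ∀ l : ℝ, 2 * l * B ≤ A + l ^ 2 * H := by
    intro l
    rw [hB, hA, hH, ← integral_const_mul, ← integral_const_mul,
      ← integral_add hg (hh.abs.const_mul _)]
    refine integral_mono (hhg.abs.const_mul _) (hg.add (hh.abs.const_mul _)) fun τ => ?_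
    have h2 := mul_nonneg (abs_nonneg (h τ)) (sq_nonneg (|g τ| - l))
    simp only [abs_mul]
    rw [← sq_abs (g τ)]
    linarith [h2, show |h τ| * (|g τ| - l) ^ 2 = |h τ| * |g τ| ^ 2 - 2 * l * (|h τ| * |g τ|) +
      l ^ 2 * |h τ| by ring]
  have h2 := key (B / (H + 1))
  have h3 : 2 * (B / (H + 1)) * B ≤ A + B ^ 2 / (H + 1) := by
    refine h2.trans (add_le_add le_rfl ?_)
    rw [div_pow, div_mul_eq_mul_div, div_le_div_iff₀ (by positivity) (by positivity)]
    nlinarith [sq_nonneg B, mul_nonneg (sq_nonneg B) hH0]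
  have h4 : B ^ 2 / (H + 1) ≤ A := by
    have : 2 * (B / (H + 1)) * B = 2 * (B ^ 2 / (H + 1)) := by ring
    linarith
  rw [div_le_iff₀ (by positivity)] at h4
  calc (∫ τ, h τ * g τ) ^ 2 = |∫ τ, h τ * g τ| ^ 2 := (sq_abs _).symm
    _ ≤ B ^ 2 := by gcongr
    _ ≤ (H + 1) * A := by linarith

lemma measurable_shift {x : ℝ → Ω → ℝ} (hx : Measurable fun p : ℝ × Ω => x p.1 p.2) (t : ℝ) :
    Measurable fun p : ℝ × Ω => x (t - p.1) p.2 :=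
  hx.comp ((measurable_const.sub measurable_fst).prodMk measurable_snd)

/-- The hypothesis of Fubini for correlating a convolution with `r`. It holds because the power of
`x` is bounded uniformly in time, so the inner integrals are at most a constant times `|h|`. -/
lemma integrable_prod_conv [SFinite μ] {x : ℝ → Ω → ℝ}
    (hx : Measurable fun p : ℝ × Ω => x p.1 p.2)
    (hx2 : ∀ t, MemLp (x t) 2 μ) {P : ℝ} (hP : ∀ t, ∫ ω, x t ω ^ 2 ∂μ ≤ P) {h : ℝ → ℝ}
    (hh : Integrable h) {r : Ω → ℝ} (hr : MemLp r 2 μ) (t : ℝ) :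
    Integrable (fun p : ℝ × Ω => h p.1 * (r p.2 * x (t - p.1) p.2)) (volume.prod μ) := by
  have hm : AEStronglyMeasurable (fun p : ℝ × Ω => h p.1 * (r p.2 * x (t - p.1) p.2))
      (volume.prod μ) :=
    hh.1.comp_fst.mul ((hr.1.comp_snd).mul
      (measurable_shift hx t).aestronglyMeasurable)
  rw [integrable_prod_iff hm]
  refine ⟨.of_forall fun τ =>
    (MemLp.integrable_mul_two hr (hx2 (t - τ))).const_mul (h τ), ?_⟩
  refine (hh.abs.mul_const ((∫ ω, r ω ^ 2 ∂μ) + P)).mono' hm.norm.integral_prod_right'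
    (.of_forall fun τ => ?_)
  rw [Real.norm_eq_abs, abs_of_nonneg (integral_nonneg fun _ => norm_nonneg _)]
  simp only [Real.norm_eq_abs, abs_mul]
  rw [integral_const_mul]
  refine mul_le_mul_of_nonneg_left ?_ (abs_nonneg _)
  refine le_trans ?_ (add_le_add le_rfl (hP (t - τ)))
  rw [← integral_add hr.integrable_sq (hx2 _).integrable_sq]
  have := (MemLp.integrable_mul_two hr (hx2 (t - τ))).abs
  simp only [abs_mul] at this
  refine integral_mono this (hr.integrable_sq.add (hx2 _).integrable_sq) fun ω => ?_
  simp only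
  nlinarith [sq_nonneg (|r ω| - |x (t - τ) ω|), sq_abs (r ω), sq_abs (x (t - τ) ω),
    mul_nonneg (abs_nonneg (r ω)) (abs_nonneg (x (t - τ) ω))]

/-- `sq_integral_mul_le` is applied along almost every path; its right-hand side is integrable by
Fubini and the uniform power bound. -/
lemma memLp_conv [IsFiniteMeasure μ] {x : ℝ → Ω → ℝ}
    (hx : Measurable fun p : ℝ × Ω => x p.1 p.2)
    (hx2 : ∀ t, MemLp (x t) 2 μ) {P : ℝ} (hP : ∀ t, ∫ ω, x t ω ^ 2 ∂μ ≤ P) {h : ℝ → ℝ}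
    (hh : Integrable h) (t : ℝ) :
    MemLp (fun ω => ∫ τ, h τ * x (t - τ) ω) 2 μ := by
  have h1 := integrable_prod_conv hx hx2 hP hh (memLp_const (1 : ℝ)) t
  simp only [one_mul] at h1
  have hm : AEStronglyMeasurable (fun ω => ∫ τ, h τ * x (t - τ) ω) μ :=
    h1.1.prod_swap.integral_prod_right'
  have h2 : Integrable (fun p : ℝ × Ω => |h p.1| * x (t - p.1) p.2 ^ 2) (volume.prod μ) := by
    have hm2 : AEStronglyMeasurable (fun p : ℝ × Ω => |h p.1| * x (t - p.1) p.2 ^ 2)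
        (volume.prod μ) :=
      (hh.abs.1.comp_fst).mul ((measurable_shift hx t).pow_const 2).aestronglyMeasurable
    rw [integrable_prod_iff hm2]
    refine ⟨.of_forall fun τ => (hx2 (t - τ)).integrable_sq.const_mul |h τ|, ?_⟩
    refine (hh.abs.mul_const P).mono' hm2.norm.integral_prod_right' (.of_forall fun τ => ?_)
    rw [Real.norm_eq_abs, abs_of_nonneg (integral_nonneg fun _ => norm_nonneg _)]
    simp only [Real.norm_eq_abs, abs_mul, abs_abs, abs_pow, sq_abs]
    rw [integral_const_mul]
    exact mul_le_mul_of_nonneg_left (hP _) (abs_nonneg _)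
  rw [memLp_two_iff_integrable_sq hm]
  refine (h2.integral_prod_right.const_mul ((∫ τ, |h τ|) + 1)).mono' (hm.pow 2) ?_
  filter_upwards [h1.prod_left_ae, h2.prod_left_ae] with ω ha hb
  rw [Real.norm_eq_abs, abs_of_nonneg (sq_nonneg _)]
  exact sq_integral_mul_le hh hb ha

lemma integral_mul_conv [IsFiniteMeasure μ] {x : ℝ → Ω → ℝ}
    (hx : Measurable fun p : ℝ × Ω => x p.1 p.2)
    (hx2 : ∀ t, MemLp (x t) 2 μ) {P : ℝ} (hP : ∀ t, ∫ ω, x t ω ^ 2 ∂μ ≤ P) {h : ℝ → ℝ}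
    (hh : Integrable h) {r : Ω → ℝ} (hr : MemLp r 2 μ) (t : ℝ) :
    ∫ ω, r ω * (∫ τ, h τ * x (t - τ) ω) ∂μ = ∫ τ, h τ * ∫ ω, r ω * x (t - τ) ω ∂μ := by
  have h1 := integrable_prod_conv hx hx2 hP hh hr t
  calc ∫ ω, r ω * (∫ τ, h τ * x (t - τ) ω) ∂μ
      = ∫ ω, (∫ τ, h τ * (r ω * x (t - τ) ω)) ∂μ := by
        refine integral_congr_ae (.of_forall fun ω => ?_)
        simp only
        rw [← integral_const_mul]
        refine integral_congr_ae (.of_forall fun τ => ?_)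
        ring
    _ = ∫ τ, (∫ ω, h τ * (r ω * x (t - τ) ω) ∂μ) := (integral_integral_swap h1).symm
    _ = _ := by simp_rw [integral_const_mul]

lemma integral_condExp_mul {Ω : Type*} {m m₀ : MeasurableSpace Ω} {μ : Measure Ω}
    [IsFiniteMeasure μ] (hm : m ≤ m₀) {X Z : Ω → ℝ} (hX : MemLp X 2 μ) (hZ : MemLp Z 2 μ)
    (hZm : AEStronglyMeasurable[m] Z μ) :
    ∫ ω, (μ[X|m]) ω * Z ω ∂μ = ∫ ω, X ω * Z ω ∂μ := by
  have h1 : Integrable (X * Z) μ := MemLp.integrable_mul_two hX hZ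
  have h2 := condExp_mul_of_aestronglyMeasurable_right hZm h1 (hX.integrable one_le_two)
  exact (integral_congr_ae h2).symm.trans (integral_condExp hm)

end Convolution

/-! ### Convolutions of a wide-sense stationary process -/

section WSS

lemma measurable_inputSigma {Ω : Type*} {M : ℕ} (x : Fin M → ℝ → Ω → ℝ)
    (m : Fin M) (t : ℝ) : Measurable[inputSigma x] (x m t) := by
  have h : MeasurableSpace.comap (x m t) inferInstance ≤ inputSigma x :=
    le_iSup (fun p : Fin M × ℝ => MeasurableSpace.comap (x p.1 p.2) inferInstance) (m, t)
  exact (comap_measurable (x m t)).mono h le_rfl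

variable {Ω : Type*} [MeasurableSpace Ω] {μ : Measure Ω} {M : ℕ}
  {C : ℝ → Matrix (Fin M) (Fin M) ℂ} {x : Fin M → ℝ → Ω → ℝ}

/-- The convolution of `x` with one row of impulse responses. -/
def rowConv (h : ℝ → Fin M → ℝ) (x : Fin M → ℝ → Ω → ℝ) (t : ℝ) (ω : Ω) : ℝ :=
  ∑ m, ∫ τ : ℝ, h τ m * x m (t - τ) ω

/-- The frequency response of one row of impulse responses. -/
def rowResp (h : ℝ → Fin M → ℝ) (f : ℝ) (m : Fin M) : ℂ :=
  𝓕 (fun τ : ℝ => ((h τ m : ℝ) : ℂ)) f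

/-- The frequency response of the time shift by `t`. -/
def phase (t f : ℝ) : ℂ := Complex.exp (2 * Real.pi * Complex.I * (f : ℂ) * (t : ℂ))

lemma phase_eq (t f : ℝ) : phase t f = Complex.exp ((2 * Real.pi * f * t : ℝ) * Complex.I) := by
  unfold phase; congr 1; push_cast; ring

@[simp] lemma norm_phase (t f : ℝ) : ‖phase t f‖ = 1 := by
  rw [phase_eq, Complex.norm_exp_ofReal_mul_I]

lemma phase_add (s t f : ℝ) : phase (s + t) f = phase s f * phase t f := by
  simp only [phase, ← Complex.exp_add]; congr 1; push_cast; ring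

lemma star_phase (t f : ℝ) : star (phase t f) = phase (-t) f := by
  rw [phase_eq, phase_eq, Complex.star_def, ← Complex.exp_conj]
  congr 1
  rw [map_mul, Complex.conj_ofReal, Complex.conj_I]
  push_cast
  ring

lemma phase_zero (f : ℝ) : phase 0 f = 1 := by simp [phase]

lemma continuous_phase_uncurry : Continuous fun p : ℝ × ℝ => phase p.1 p.2 := by
  unfold phase; fun_prop

lemma measurable_phase (t : ℝ) : Measurable (phase t) :=
  (continuous_phase_uncurry.comp (Continuous.prodMk_right t)).measurable

lemma fourier_eq_integral_phase (h : ℝ → ℂ) (f : ℝ) :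
    𝓕 h f = ∫ τ, h τ * phase (-τ) f := by
  rw [Real.fourier_real_eq_integral_exp_smul]
  refine integral_congr_ae (.of_forall fun τ => ?_)
  simp only [smul_eq_mul]
  rw [mul_comm, phase_eq]
  congr 3
  push_cast; ring

/-- A delay by `τ` multiplies the spectrum by `phase (-τ)`, so averaging the delays against `h`
multiplies it by the Fourier transform of `h`. This is Fubini for an absolutely integrable double
integral. -/
lemma integral_mul_integral_phase {h D : ℝ → ℂ} (hh : Integrable h) (hD : Integrable D) (t : ℝ) :
    ∫ τ, h τ * ∫ f, D f * phase (t - τ) f = ∫ f, D f * phase t f * 𝓕 h f := by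
  have hi : Integrable (fun p : ℝ × ℝ => h p.1 * (D p.2 * phase (t - p.1) p.2))
      (volume.prod volume) := by
    refine ((hh.mul_prod hD).norm).mono' ?_ (.of_forall fun p => ?_)
    · refine hh.1.comp_fst.mul (hD.1.comp_snd.mul ?_)
      exact (continuous_phase_uncurry.comp (by fun_prop :
        Continuous fun p : ℝ × ℝ => (t - p.1, p.2))).aestronglyMeasurable
    · simp
  simp_rw [← integral_const_mul]
  rw [integral_integral_swap hi]
  refine integral_congr_ae (.of_forall fun f => ?_)
  simp only
  rw [fourier_eq_integral_phase, ← integral_const_mul]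
  refine integral_congr_ae (.of_forall fun τ => ?_)
  simp only [sub_eq_add_neg, phase_add]
  ring

lemma integral_mul_integral_phase_star {h D : ℝ → ℂ} (hh : Integrable h) (hD : Integrable D)
    (t : ℝ) : ∫ τ, star (h τ) * ∫ f, D f * phase (t + τ) f =
      ∫ f, D f * phase t f * star (𝓕 h f) := by
  have hD' : Integrable fun f => star (D f) :=
    hD.norm.mono' (continuous_star.comp_aestronglyMeasurable hD.1) (.of_forall fun f => by simp)
  have := congrArg star (integral_mul_integral_phase hh hD' (-t))
  simp only [Complex.star_def, ← integral_conj] at this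
  simp only [← Complex.star_def, star_mul', star_star, star_phase, neg_neg] at this
  rw [← this]
  refine integral_congr_ae (.of_forall fun τ => ?_)
  simp only
  rw [Complex.star_def, ← integral_conj]
  congr 1
  refine integral_congr_ae (.of_forall fun f => ?_)
  simp only [← Complex.star_def, star_mul', star_star, star_phase]
  congr 2
  ring

lemma continuous_fourier_of_integrable {h : ℝ → ℂ} (hh : Integrable h) : Continuous (𝓕 h) :=
  VectorFourier.fourierIntegral_continuous Real.continuous_fourierChar
    (by exact continuous_inner) hh

lemma norm_fourier_le (h : ℝ → ℂ) (f : ℝ) : ‖𝓕 h f‖ ≤ ∫ τ, ‖h τ‖ :=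
  VectorFourier.norm_fourierIntegral_le_integral_norm _ _ _ _ _

namespace IsWSSWithPSD

lemma aestronglyMeasurable_psd (hx : IsWSSWithPSD μ x C) (i j : Fin M) :
    AEStronglyMeasurable (fun f => C f i j) := (hx.psd_integrable i j).1

lemma integral_mul_eq (hx : IsWSSWithPSD μ x C) (i j : Fin M) (s t : ℝ) :
    ((∫ ω, x i s ω * x j t ω ∂μ : ℝ) : ℂ) = ∫ f, C f i j * phase (s - t) f := by
  have := hx.correlation i j t (s - t)
  rwa [add_sub_cancel] at this

lemma exists_power_le (hx : IsWSSWithPSD μ x C) (m : Fin M) :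
    ∃ P, ∀ t, ∫ ω, x m t ω ^ 2 ∂μ ≤ P := by
  refine ⟨‖∫ f, C f m m * phase 0 f‖, fun t => ?_⟩
  have := hx.integral_mul_eq m m t t
  rw [sub_self] at this
  rw [← this, Complex.norm_real]
  simp only [sq]
  exact le_abs_self _

lemma inputSigma_le (hx : IsWSSWithPSD μ x C) : inputSigma x ≤ ‹MeasurableSpace Ω› :=
  iSup_le fun p => Measurable.comap_le
    ((hx.measurable p.1).comp (measurable_prodMk_left : Measurable (Prod.mk p.2)))

variable [IsFiniteMeasure μ] {h : ℝ → Fin M → ℝ}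

lemma memLp_rowConv (hx : IsWSSWithPSD μ x C) (hh : ∀ m, Integrable fun τ => h τ m) (t : ℝ) :
    MemLp (rowConv h x t) 2 μ := by
  refine memLp_finsetSum _ fun m _ => ?_
  obtain ⟨P, hP⟩ := hx.exists_power_le m
  exact memLp_conv (hx.measurable m) (hx.memLp m) hP (hh m) t

lemma integral_mul_rowConv (hx : IsWSSWithPSD μ x C) (hh : ∀ m, Integrable fun τ => h τ m)
    (t : ℝ) {r : Ω → ℝ} (hr : MemLp r 2 μ) :
    ∫ ω, r ω * rowConv h x t ω ∂μ = ∑ m, ∫ τ, h τ m * ∫ ω, r ω * x m (t - τ) ω ∂μ := by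
  simp only [rowConv, Finset.mul_sum]
  have hP := fun m => hx.exists_power_le m
  choose P hP using hP
  rw [integral_finsetSum _ fun m _ => MemLp.integrable_mul_two hr
    (memLp_conv (hx.measurable m) (hx.memLp m) (hP m) (hh m) t)]
  exact Finset.sum_congr rfl fun m _ =>
    integral_mul_conv (hx.measurable m) (hx.memLp m) (hP m) (hh m) hr t

/-- A convolution of the process with an integrable impulse response is a function of the
observed process up to a null event. -/
lemma aestronglyMeasurable_rowConv (hx : IsWSSWithPSD μ x C)
    (hh : ∀ m, Integrable fun τ => h τ m) (t : ℝ) :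
    AEStronglyMeasurable[inputSigma x] (rowConv h x t) μ := by
  have hle := hx.inputSigma_le
  have hc := hx.memLp_rowConv hh t
  set c := rowConv h x t
  have hE : MemLp (μ[c|inputSigma x]) 2 μ := hc.condExp one_le_two
  -- Joint measurability is given only for the ambient σ-algebra, so a projection argument replaces
  -- measurability of a parameter integral. The residual is orthogonal to each `x m (t - τ)`, hence
  -- by Fubini to the convolution itself, and also to the conditional expectation; it is therefore
  -- orthogonal to itself.
  set r := fun ω => c ω - (μ[c|inputSigma x]) ω with hrdef
  have hr : MemLp r 2 μ := hc.sub hE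
  have orth : ∀ Z : Ω → ℝ, MemLp Z 2 μ → AEStronglyMeasurable[inputSigma x] Z μ →
      ∫ ω, r ω * Z ω ∂μ = 0 := by
    intro Z hZ hZm
    simp only [hrdef, sub_mul]
    rw [integral_sub (MemLp.integrable_mul_two hc hZ) (MemLp.integrable_mul_two hE hZ),
      integral_condExp_mul hle hc hZ hZm, sub_self]
  have h1 : ∫ ω, r ω * c ω ∂μ = 0 := by
    rw [hx.integral_mul_rowConv hh t hr]
    refine Finset.sum_eq_zero fun m _ => ?_
    simp_rw [fun τ => orth (x m (t - τ)) (hx.memLp m _)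
      (measurable_inputSigma x m _).stronglyMeasurable.aestronglyMeasurable, mul_zero]
    simp
  have h2 := orth _ hE stronglyMeasurable_condExp.aestronglyMeasurable
  have h3 : ∫ ω, r ω ^ 2 ∂μ = 0 := by
    have : ∀ ω, r ω ^ 2 = r ω * c ω - r ω * (μ[c|inputSigma x]) ω := fun ω => by
      simp only [hrdef]; ring
    simp_rw [this]
    rw [integral_sub (MemLp.integrable_mul_two hr hc) (MemLp.integrable_mul_two hr hE), h1, h2,
      sub_self]
  rw [integral_eq_zero_iff_of_nonneg (fun ω => sq_nonneg _) hr.integrable_sq] at h3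
  refine ⟨μ[c|inputSigma x], stronglyMeasurable_condExp, ?_⟩
  filter_upwards [h3] with ω hω
  have : r ω = 0 := by simpa using hω
  exact sub_eq_zero.1 this

/-- Convolutions of the process have the expected frequency responses. -/
lemma spectralFamily_rowConv (hx : IsWSSWithPSD μ x C) {ι : Type*} {h : ι → ℝ → Fin M → ℝ}
    (hh : ∀ i m, Integrable fun τ => h i τ m) (t : ι → ℝ) :
    SpectralFamily μ C (fun i => rowConv (h i) x (t i))
      (fun i f => phase (t i) f • rowResp (h i) f) := by
  have hhc : ∀ i m, Integrable fun τ => (h i τ m : ℂ) := fun i m => (hh i m).ofReal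
  have hcont : ∀ i m, Continuous fun f => rowResp (h i) f m := fun i m =>
    continuous_fourier_of_integrable (hhc i m)
  have hterm : ∀ i j k l, Integrable fun f => C f k l * (phase (t i - t j) f *
      (rowResp (h i) f k * star (rowResp (h j) f l))) := by
    intro i j k l
    refine (hx.psd_integrable k l).mul_bdd
      (c := (∫ τ, ‖(h i τ k : ℂ)‖) * ∫ τ, ‖(h j τ l : ℂ)‖) ?_ (.of_forall fun f => ?_)
    · exact (((measurable_phase _).mul ((hcont i k).measurable.mul
        (continuous_star.measurable.comp (hcont j l).measurable))).aestronglyMeasurable)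
    · simp only [norm_mul, norm_phase, one_mul, norm_star]
      exact mul_le_mul (norm_fourier_le _ _) (norm_fourier_le _ _) (norm_nonneg _)
        (integral_nonneg fun _ => norm_nonneg _)
  have hexp : ∀ i j f, specForm (C f) (phase (t i) f • rowResp (h i) f)
      (phase (t j) f • rowResp (h j) f) = ∑ k, ∑ l, C f k l * (phase (t i - t j) f *
      (rowResp (h i) f k * star (rowResp (h j) f l))) := by
    intro i j f
    unfold specForm
    refine Finset.sum_congr rfl fun k _ => Finset.sum_congr rfl fun l _ => ?_
    simp only [Pi.smul_apply, smul_eq_mul, star_mul', star_phase, sub_eq_add_neg, phase_add]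
    ring
  have hint : ∀ i j, Integrable fun f => specForm (C f) (phase (t i) f • rowResp (h i) f)
      (phase (t j) f • rowResp (h j) f) := by
    intro i j
    simp_rw [hexp]
    exact integrable_finsetSum _ fun k _ => integrable_finsetSum _ fun l _ => hterm i j k l
  refine ⟨fun i => hx.memLp_rowConv (hh i) (t i),
    fun i m => (measurable_phase _).mul (hcont i m).measurable, fun i => (hint i i).re,
    fun i j => ?_⟩
  simp_rw [hexp]
  rw [integral_finsetSum _ fun k _ => integrable_finsetSum _ fun l _ => hterm i j k l]
  simp_rw [fun k => integral_finsetSum Finset.univ fun l _ => hterm i j k l]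
  simp_rw [mul_comm (rowConv (h i) x (t i) _)]
  rw [hx.integral_mul_rowConv (hh i) (t i) (hx.memLp_rowConv (hh j) (t j))]
  push_cast
  refine Finset.sum_congr rfl fun k _ => ?_
  -- The two convolutions are expanded one at a time. This is the correlation of the raw input with
  -- the second output, written with the spectral density `∑ l, C k l * star (resp l)`; the first
  -- convolution then acts on that density.
  have inner : ∀ τ, ((∫ ω, rowConv (h j) x (t j) ω * x k (t i - τ) ω ∂μ : ℝ) : ℂ) =
      ∫ f, (∑ l, C f k l * star (rowResp (h j) f l) * phase (-t j) f) * phase (t i - τ) f := by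
    intro τ
    simp_rw [mul_comm (rowConv (h j) x (t j) _)]
    rw [hx.integral_mul_rowConv (hh j) (t j) (hx.memLp k _)]
    push_cast
    have hl : ∀ l, Integrable fun f => C f k l * star (rowResp (h j) f l) * phase (-t j) f *
        phase (t i - τ) f := by
      intro l
      simp_rw [mul_assoc]
      refine (hx.psd_integrable k l).mul_bdd (c := ∫ τ, ‖(h j τ l : ℂ)‖) ?_ (.of_forall fun f => ?_)
      · exact ((continuous_star.measurable.comp (hcont j l).measurable).mul
          ((measurable_phase _).mul (measurable_phase _))).aestronglyMeasurable
      · simp only [norm_mul, norm_phase, mul_one, norm_star]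
        exact norm_fourier_le _ _
    simp_rw [Finset.sum_mul]
    rw [integral_finsetSum _ fun l _ => hl l]
    refine Finset.sum_congr rfl fun l _ => ?_
    rw [← integral_complex_ofReal]
    have := integral_mul_integral_phase_star (hhc j l) (hx.psd_integrable k l) (t i - τ - t j)
    rw [show (∫ f, C f k l * star (rowResp (h j) f l) * phase (-t j) f * phase (t i - τ) f) =
      ∫ f, C f k l * phase (t i - τ - t j) f * star (𝓕 (fun τ => (h j τ l : ℂ)) f) from
      integral_congr_ae (.of_forall fun f => by
        simp only [sub_eq_add_neg, phase_add, rowResp]; ring), ← this]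
    refine integral_congr_ae (.of_forall fun σ => ?_)
    simp only [Complex.ofReal_mul, Complex.star_def, Complex.conj_ofReal]
    rw [hx.integral_mul_eq]
    congr 3
    ext f
    congr 2
    ring
  rw [← integral_complex_ofReal]
  simp only [Complex.ofReal_mul]
  simp_rw [inner]
  rw [integral_mul_integral_phase (hhc i k)]
  · rw [← integral_finsetSum _ fun l _ => hterm i j k l]
    refine integral_congr_ae (.of_forall fun f => ?_)
    simp only [Finset.sum_mul, rowResp, sub_eq_add_neg, phase_add]
    exact Finset.sum_congr rfl fun l _ => by ring
  · refine integrable_finsetSum _ fun l _ => ?_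
    simp_rw [mul_assoc]
    refine (hx.psd_integrable k l).mul_bdd (c := ∫ τ, ‖(h j τ l : ℂ)‖) ?_ (.of_forall fun f => ?_)
    · exact ((continuous_star.measurable.comp (hcont j l).measurable).mul
        (measurable_phase _)).aestronglyMeasurable
    · simp only [norm_mul, norm_phase, mul_one, norm_star]
      exact norm_fourier_le _ _

end IsWSSWithPSD

end WSS

end TaskADC

end

noncomputable section

namespace TaskADC

/-! ### Filter outputs -/

/-- Since `c j` is its own conditional expectation, `Y - μ[Y|m]` equals `μ[c j - Y|m] - (c j - Y)`.
Contractivity of conditional expectation bounds its norm by twice that of `c j - Y`, which tends to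
zero. -/
lemma aestronglyMeasurable_of_tendsto_eLpNorm {Ω : Type*} {m m₀ : MeasurableSpace Ω}
    {μ : Measure Ω} [IsFiniteMeasure μ] (hm : m ≤ m₀) {Y : Ω → ℝ} {c : ℕ → Ω → ℝ}
    (hY : MemLp Y 2 μ) (hc : ∀ j, MemLp (c j) 2 μ) (hcm : ∀ j, AEStronglyMeasurable[m] (c j) μ)
    (hl : Tendsto (fun j => eLpNorm (fun ω => c j ω - Y ω) 2 μ) atTop (𝓝 0)) :
    AEStronglyMeasurable[m] Y μ := by
  have hYi := hY.integrable one_le_two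
  have hE : MemLp (μ[Y|m]) 2 μ := hY.condExp one_le_two
  have hb : ∀ j, eLpNorm (fun ω => Y ω - (μ[Y|m]) ω) 2 μ ≤
      2 * eLpNorm (fun ω => c j ω - Y ω) 2 μ := by
    intro j
    have hd : MemLp (c j - Y) 2 μ := (hc j).sub hY
    have h1 : (fun ω => Y ω - (μ[Y|m]) ω) =ᵐ[μ] (μ[c j - Y|m]) - (c j - Y) := by
      filter_upwards [condExp_sub ((hc j).integrable one_le_two) hYi m,
        condExp_of_aestronglyMeasurable' hm (hcm j) ((hc j).integrable one_le_two)] with ω h1 h2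
      simp only [Pi.sub_apply] at *
      rw [h1, h2]; ring
    rw [eLpNorm_congr_ae h1, two_mul]
    refine (eLpNorm_sub_le (hd.condExp one_le_two).1 hd.1 one_le_two).trans ?_
    exact add_le_add (eLpNorm_condExp_le_eLpNorm _ one_le_two) le_rfl
  have hz : eLpNorm (fun ω => Y ω - (μ[Y|m]) ω) 2 μ = 0 := by
    have h2 : Tendsto (fun j => 2 * eLpNorm (fun ω => c j ω - Y ω) 2 μ) atTop (𝓝 0) := by
      simpa using ENNReal.Tendsto.const_mul (a := 2) hl (Or.inr (by simp))
    exact le_antisymm (ge_of_tendsto' h2 hb) bot_le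
  replace hz := (eLpNorm_eq_zero_iff (hY.sub hE).1 (by simp)).1 hz
  refine ⟨μ[Y|m], stronglyMeasurable_condExp, ?_⟩
  filter_upwards [hz] with ω hω
  exact sub_eq_zero.1 hω

section Filters

variable {Ω : Type*} [MeasurableSpace Ω] {μ : Measure Ω} {M N K : ℕ}
  {C : ℝ → Matrix (Fin M) (Fin M) ℂ} {x : Fin M → ℝ → Ω → ℝ}

lemma trace_mul_mul_conjTranspose (D : Matrix (Fin K) (Fin M) ℂ) (A : Matrix (Fin M) (Fin M) ℂ) :
    (D * A * Dᴴ).trace = ∑ k, specForm A (D k) (D k) := by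
  simp only [Matrix.trace, Matrix.diag, Matrix.mul_apply, Matrix.conjTranspose_apply, specForm,
    Finset.sum_mul]
  exact Finset.sum_congr rfl fun k _ => Finset.sum_comm

lemma specForm_phase_smul (A : Matrix (Fin M) (Fin M) ℂ) (t f : ℝ) (a : Fin M → ℂ) :
    specForm A (phase t f • a) (phase t f • a) = specForm A a a := by
  rw [specForm_smul_left, specForm_smul_right, ← mul_assoc, star_phase, ← phase_add,
    add_neg_cancel, phase_zero, one_mul]

/-- The trace is the sum over rows of nonnegative forms, so convergence of the trace integral passes
to each row. -/
lemma tendsto_specForm_of_trace (hx : IsWSSWithPSD μ x C) {H : ℝ → Matrix (Fin K) (Fin M) ℂ}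
    {Hn : ℕ → ℝ → Matrix (Fin K) (Fin M) ℂ}
    (h : Tendsto (fun j => ∫⁻ f : ℝ, ENNReal.ofReal
      (((Hn j f - H f) * C f * (Hn j f - H f)ᴴ).trace.re)) atTop (𝓝 0)) (k : Fin K) :
    Tendsto (fun j => ∫⁻ f : ℝ, ENNReal.ofReal
      (specForm (C f) (Hn j f k - H f k) (Hn j f k - H f k)).re) atTop (𝓝 0) := by
  refine tendsto_of_tendsto_of_tendsto_of_le_of_le tendsto_const_nhds h (fun _ => bot_le)
    fun j => lintegral_mono fun f => ENNReal.ofReal_le_ofReal ?_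
  rw [trace_mul_mul_conjTranspose, Complex.re_sum]
  exact Finset.single_le_sum (f := fun k => (specForm (C f) ((Hn j f - H f) k)
    ((Hn j f - H f) k)).re) (fun k _ => specForm_self_re_nonneg (hx.psd_posSemidef f) _)
    (Finset.mem_univ k)

namespace IsFilterOutput

variable [IsFiniteMeasure μ] {H : ℝ → Matrix (Fin K) (Fin M) ℂ} {y : Fin K → ℝ → Ω → ℝ}
  {Γ : ℝ → Matrix (Fin N) (Fin M) ℂ} {u : Fin N → ℝ → Ω → ℝ}

lemma aestronglyMeasurable_inputSigma (hy : IsFilterOutput μ C x H y) (hx : IsWSSWithPSD μ x C)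
    (k : Fin K) (t : ℝ) : AEStronglyMeasurable[inputSigma x] (y k t) μ := by
  obtain ⟨h, hh, -, hl⟩ := hy.approx
  exact aestronglyMeasurable_of_tendsto_eLpNorm hx.inputSigma_le (hy.memLp k t)
    (fun j => hx.memLp_rowConv (h := fun τ m => h j τ k m) (fun m => hh j k m) t)
    (fun j => hx.aestronglyMeasurable_rowConv (h := fun τ m => h j τ k m)
      (fun m => hh j k m) t) (hl k t)

/-- The outputs of two filters have the expected frequency responses. -/
lemma spectralFamily (hu : IsFilterOutput μ C x Γ u) (hy : IsFilterOutput μ C x H y)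
    (hx : IsWSSWithPSD μ x C) :
    SpectralFamily μ C
      (Sum.elim (fun p : Fin N × ℝ => u p.1 p.2) (fun p : Fin K × ℝ => y p.1 p.2))
      (Sum.elim (fun p f => phase p.2 f • Γ f p.1) (fun p f => phase p.2 f • H f p.1)) := by
  obtain ⟨g, hg, hgl, hgc⟩ := hu.approx
  obtain ⟨h, hh, hhl, hhc⟩ := hy.approx
  -- Both filters, at all times, are put in one family indexed by a sum type, so that the
  -- cross-covariances between their outputs are covered as well.
  set r : ℕ → (Fin N × ℝ) ⊕ (Fin K × ℝ) → ℝ → Fin M → ℝ := fun j =>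
    Sum.elim (fun p τ => g j τ p.1) (fun p τ => h j τ p.1) with hr
  have hri : ∀ j i m, Integrable fun τ => r j i τ m := by
    rintro j (p | p) m
    · exact hg j p.1 m
    · exact hh j p.1 m
  refine SpectralFamily.of_tendsto hx.psd_posSemidef hx.aestronglyMeasurable_psd
    (fun j => hx.spectralFamily_rowConv (hri j) (Sum.elim Prod.snd Prod.snd)) ?_ ?_ ?_ ?_
  · rintro (p | p)
    · exact hu.memLp _ _
    · exact hy.memLp _ _
  · rintro (p | p) m
    · exact (measurable_phase _).mul (hu.measurable p.1 m)
    · exact (measurable_phase _).mul (hy.measurable p.1 m)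
  · rintro (p | p)
    · exact hgc p.1 p.2
    · exact hhc p.1 p.2
  · rintro (p | p)
    · simp only [Sum.elim_inl, ← smul_sub, specForm_phase_smul]
      exact tendsto_specForm_of_trace hx hgl p.1
    · simp only [Sum.elim_inr, ← smul_sub, specForm_phase_smul]
      exact tendsto_specForm_of_trace hx hhl p.1

lemma integrable_power (hy : IsFilterOutput μ C x H y) (hx : IsWSSWithPSD μ x C) (k : Fin K) :
    Integrable fun f => (specForm (C f) (H f k) (H f k)).re := by
  simpa only [Sum.elim_inr, specForm_phase_smul] using
    (hy.spectralFamily hy hx).integrable (Sum.inr (k, 0))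

lemma integral_sq (hy : IsFilterOutput μ C x H y) (hx : IsWSSWithPSD μ x C) (k : Fin K) (t : ℝ) :
    ∫ ω, y k t ω ^ 2 ∂μ = ∫ f, (specForm (C f) (H f k) (H f k)).re := by
  simpa only [Sum.elim_inr, specForm_phase_smul] using
    (hy.spectralFamily hy hx).integral_sq hx.psd_posSemidef (Sum.inr (k, t))

end IsFilterOutput

end Filters

end TaskADC

end

noncomputable section

namespace TaskADC

/-! ### The triangular law -/

section Triangular

lemma measurable_triangular_density :
    Measurable fun w : ℝ => ENNReal.ofReal (max 0 (1 - |w|)) := by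
  fun_prop

lemma ae_abs_le_one_triangularLaw : ∀ᵐ w ∂triangularLaw, |w| ≤ 1 := by
  unfold triangularLaw
  rw [ae_withDensity_iff measurable_triangular_density]
  refine .of_forall fun w hw => ?_
  by_contra h
  exact hw (by rw [max_eq_left (by linarith), ENNReal.ofReal_zero])

lemma integral_triangularLaw (g : ℝ → ℝ) :
    ∫ w, g w ∂triangularLaw = ∫ w in (-1 : ℝ)..1, (1 - |w|) * g w := by
  unfold triangularLaw
  rw [integral_withDensity_eq_integral_toReal_smul measurable_triangular_density
    (.of_forall fun _ => ENNReal.ofReal_lt_top), intervalIntegral.integral_of_le (by norm_num),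
    ← integral_indicator measurableSet_Ioc]
  refine integral_congr_ae ?_
  filter_upwards with w
  rw [ENNReal.toReal_ofReal (le_max_left _ _), smul_eq_mul]
  by_cases hw : w ∈ Set.Ioc (-1 : ℝ) 1
  · rw [Set.indicator_of_mem hw, max_eq_right]
    have := abs_le.2 ⟨hw.1.le, hw.2⟩
    linarith
  · rw [Set.indicator_of_notMem hw, max_eq_left, zero_mul]
    by_contra! h
    have h' : |w| < 1 := by linarith
    rw [abs_lt] at h'
    exact hw ⟨h'.1, h'.2.le⟩

lemma intervalIntegral_linear_mul (a b s c : ℝ) :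
    ∫ w in a..b, (1 + s * w) * c = c * ((b + s * b ^ 2 / 2) - (a + s * a ^ 2 / 2)) := by
  rw [intervalIntegral.integral_mul_const, intervalIntegral.integral_add (by simp)
    (Continuous.intervalIntegrable (by fun_prop) _ _),
    intervalIntegral.integral_const_mul]
  simp
  ring

lemma intervalIntegral_linear_mul_sq (a b s : ℝ) :
    ∫ w in a..b, (1 + s * w) * w ^ 2 =
      (b ^ 3 / 3 + s * b ^ 4 / 4) - (a ^ 3 / 3 + s * a ^ 4 / 4) := by
  have : ∀ w : ℝ, (1 + s * w) * w ^ 2 = w ^ 2 + s * w ^ 3 := fun w => by ring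
  simp_rw [this]
  rw [intervalIntegral.integral_add (Continuous.intervalIntegrable (by fun_prop) _ _)
    (Continuous.intervalIntegrable (by fun_prop) _ _),
    intervalIntegral.integral_const_mul, integral_pow, integral_pow]
  norm_num
  ring

/-- The triangular law, seen through the floor function. -/
lemma integral_triangularLaw_floor (G : ℤ → ℝ) {r : ℝ} (h0 : 0 ≤ r) (h1 : r < 1) :
    ∫ w, G ⌊r + w⌋ ∂triangularLaw =
      G (-1) * ((1 - r) ^ 2 / 2) + G 0 * (1 / 2 + r - r ^ 2) + G 1 * (r ^ 2 / 2) := by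
  rw [integral_triangularLaw]
  -- The interval is cut at `-r` and `1 - r`, where the floor jumps, and at `0`, where the slope of
  -- the density changes sign. On each piece the floor is constant and the density is `1 + s * w`.
  have piece : ∀ (a b s : ℝ) (n : ℤ), a ≤ b → (∀ w ∈ Set.Ioo a b, |w| = -s * w) →
      (∀ w ∈ Set.Ioo a b, ⌊r + w⌋ = n) →
      IntervalIntegrable (fun w => (1 - |w|) * G ⌊r + w⌋) volume a b ∧
      ∫ w in a..b, (1 - |w|) * G ⌊r + w⌋ =
        G n * ((b + s * b ^ 2 / 2) - (a + s * a ^ 2 / 2)) := by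
    intro a b s n hab ha hn
    have heq : Set.EqOn (fun w => (1 + s * w) * G n) (fun w => (1 - |w|) * G ⌊r + w⌋)
        (Set.Ioo a b) := fun w hw => by simp only [ha w hw, hn w hw]; ring
    refine ⟨IntervalIntegrable.congr_uIoo (f := fun w => (1 + s * w) * G n)
      (Continuous.intervalIntegrable (by fun_prop) _ _) (by rwa [Set.uIoo_of_le hab]), ?_⟩
    rw [← intervalIntegral.integral_congr_Ioo_of_le hab heq, intervalIntegral_linear_mul]
  obtain ⟨i1, e1⟩ := piece (-1) (-r) 1 (-1) (by linarith)
    (fun w hw => by rw [abs_of_neg (by linarith [hw.2]), neg_one_mul])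
    (fun w hw => by
      rw [Int.floor_eq_iff]; push_cast; constructor <;> linarith [hw.1, hw.2])
  obtain ⟨i2, e2⟩ := piece (-r) 0 1 0 (by linarith)
    (fun w hw => by rw [abs_of_neg (by linarith [hw.2]), neg_one_mul])
    (fun w hw => by
      rw [Int.floor_eq_iff]; push_cast; constructor <;> linarith [hw.1, hw.2])
  obtain ⟨i3, e3⟩ := piece 0 (1 - r) (-1) 0 (by linarith)
    (fun w hw => by rw [abs_of_pos (by linarith [hw.1]), neg_neg, one_mul])
    (fun w hw => by
      rw [Int.floor_eq_iff]; push_cast; constructor <;> linarith [hw.1, hw.2])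
  obtain ⟨i4, e4⟩ := piece (1 - r) 1 (-1) 1 (by linarith)
    (fun w hw => by rw [abs_of_pos (by linarith [hw.1]), neg_neg, one_mul])
    (fun w hw => by
      rw [Int.floor_eq_iff]; push_cast; constructor <;> linarith [hw.1, hw.2])
  rw [← intervalIntegral.integral_add_adjacent_intervals ((i1.trans i2).trans i3) i4,
    ← intervalIntegral.integral_add_adjacent_intervals (i1.trans i2) i3,
    ← intervalIntegral.integral_add_adjacent_intervals i1 i2, e1, e2, e3, e4]
  ring

lemma integral_sq_triangularLaw : ∫ w, w ^ 2 ∂triangularLaw = 1 / 6 := by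
  rw [integral_triangularLaw]
  have hi : ∀ a b : ℝ, IntervalIntegrable (fun w => (1 - |w|) * w ^ 2) volume a b := fun a b =>
    Continuous.intervalIntegrable (by fun_prop) _ _
  have e1 : ∫ w in (-1 : ℝ)..0, (1 - |w|) * w ^ 2 = ∫ w in (-1 : ℝ)..0, (1 + 1 * w) * w ^ 2 :=
    intervalIntegral.integral_congr_Ioo_of_le (by norm_num) fun w hw => by
      simp only [abs_of_neg hw.2]; ring
  have e2 : ∫ w in (0 : ℝ)..1, (1 - |w|) * w ^ 2 = ∫ w in (0 : ℝ)..1, (1 + (-1) * w) * w ^ 2 :=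
    intervalIntegral.integral_congr_Ioo_of_le (by norm_num) fun w hw => by
      simp only [abs_of_pos hw.1]; ring
  rw [← intervalIntegral.integral_add_adjacent_intervals (hi (-1) 0) (hi 0 1), e1, e2,
    intervalIntegral_linear_mul_sq, intervalIntegral_linear_mul_sq]
  norm_num

lemma integral_id_triangularLaw : ∫ w, w ∂triangularLaw = 0 := by
  rw [integral_triangularLaw]
  have h := intervalIntegral.integral_comp_neg (fun w : ℝ => (1 - |w|) * w) (a := -1) (b := 1)
  simp only [abs_neg, mul_neg, neg_neg, intervalIntegral.integral_neg] at h
  linarith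

/-- The normalized error of the dithered mid-rise quantizer. -/
def quantError (θ w : ℝ) : ℝ := (⌊θ + w⌋ : ℝ) + 1 / 2 - θ

lemma measurable_quantError : Measurable fun p : ℝ × ℝ => quantError p.1 p.2 := by
  unfold quantError
  have : Measurable fun p : ℝ × ℝ => ⌊p.1 + p.2⌋ :=
    Int.measurable_floor.comp (measurable_fst.add measurable_snd)
  exact ((measurable_from_top.comp this).add_const _).sub measurable_fst

/-- The error is 1-periodic in the signal, which reduces its moments to signals in `[0, 1)`. -/
lemma quantError_eq (θ w : ℝ) :
    quantError θ w = (⌊Int.fract θ + w⌋ : ℝ) + 1 / 2 - Int.fract θ := by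
  have : ⌊θ + w⌋ = ⌊θ⌋ + ⌊Int.fract θ + w⌋ := by
    rw [← Int.floor_intCast_add, ← add_assoc, Int.floor_add_fract]
  unfold quantError
  rw [this]
  have := Int.floor_add_fract θ
  push_cast
  linarith

lemma abs_quantError_le {θ w : ℝ} (hw : |w| ≤ 1) : |quantError θ w| ≤ 2 := by
  have h1 := Int.floor_le (θ + w)
  have h2 := Int.lt_floor_add_one (θ + w)
  rw [abs_le] at *
  unfold quantError
  constructor <;> linarith [hw.1, hw.2]

lemma integral_quantError (θ : ℝ) : ∫ w, quantError θ w ∂triangularLaw = 0 := by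
  simp_rw [quantError_eq]
  rw [integral_triangularLaw_floor (fun n => (n : ℝ) + 1 / 2 - Int.fract θ) (Int.fract_nonneg θ)
    (Int.fract_lt_one θ)]
  push_cast
  ring

/-- The decisive property of triangular dither: the conditional second moment, like the mean above,
does not depend on the signal. The error is measured from the undithered signal, and its value `1/4`
is `1/12` for a uniform quantization error plus `1/6` for the dither. -/
lemma integral_sq_quantError (θ : ℝ) : ∫ w, quantError θ w ^ 2 ∂triangularLaw = 1 / 4 := by
  simp_rw [quantError_eq]
  rw [integral_triangularLaw_floor (fun n => ((n : ℝ) + 1 / 2 - Int.fract θ) ^ 2)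
    (Int.fract_nonneg θ) (Int.fract_lt_one θ)]
  push_cast
  ring

end Triangular

/-! ### Quantization noise -/

section Noise

variable {Ω : Type*} [MeasurableSpace Ω] {μ : Measure Ω}

/-- Independence makes the joint law a product, so `V` can be integrated out with `U` frozen. This
is how the conditional moments of the quantization error are used. -/
lemma integral_comp_of_indepFun [IsFiniteMeasure μ] {α : Type*} [MeasurableSpace α]
    {U : Ω → α} {V : Ω → ℝ} {ν : Measure ℝ} (hU : Measurable U) (hV : Measurable V)
    (hlaw : μ.map V = ν) (hUV : IndepFun U V μ) {F : α × ℝ → ℝ} (hF : Measurable F)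
    (hint : Integrable (fun ω => F (U ω, V ω)) μ) :
    ∫ ω, F (U ω, V ω) ∂μ = ∫ ω, ∫ w, F (U ω, w) ∂ν ∂μ := by
  have : IsFiniteMeasure ν := by rw [← hlaw]; infer_instance
  have hmap : μ.map (fun ω => (U ω, V ω)) = (μ.map U).prod ν := by
    rw [(indepFun_iff_map_prod_eq_prod_map_map hU.aemeasurable hV.aemeasurable).1 hUV, hlaw]
  have hFs : AEStronglyMeasurable F (μ.map fun ω => (U ω, V ω)) :=
    hF.stronglyMeasurable.aestronglyMeasurable
  have hint' : Integrable F ((μ.map U).prod ν) := by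
    rw [← hmap]
    exact (integrable_map_measure hFs (hU.prodMk hV).aemeasurable).2 hint
  rw [← integral_map (f := F) (hU.prodMk hV).aemeasurable hFs, hmap, integral_prod _ hint',
    integral_map hU.aemeasurable]
  exact hF.stronglyMeasurable.integral_prod_right'.aestronglyMeasurable

/-- Regroups a product law of three factors. With `W` the signals and `U`, `V` two dithers, it makes
the second dither independent of everything the first quantization error depends on. -/
lemma indepFun_prodMk_assoc [IsFiniteMeasure μ] {α β γ : Type*} [MeasurableSpace α]
    [MeasurableSpace β] [MeasurableSpace γ] {W : Ω → α} {U : Ω → β} {V : Ω → γ}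
    (hW : Measurable W) (hU : Measurable U) (hV : Measurable V)
    (h1 : IndepFun W (fun ω => (U ω, V ω)) μ) (h2 : IndepFun U V μ) :
    IndepFun (fun ω => (W ω, U ω)) V μ := by
  have h3 : IndepFun W U μ := h1.comp measurable_id measurable_fst
  rw [indepFun_iff_map_prod_eq_prod_map_map hW.aemeasurable
    (hU.prodMk hV).aemeasurable] at h1
  rw [indepFun_iff_map_prod_eq_prod_map_map hU.aemeasurable hV.aemeasurable] at h2
  rw [indepFun_iff_map_prod_eq_prod_map_map hW.aemeasurable hU.aemeasurable] at h3
  rw [indepFun_iff_map_prod_eq_prod_map_map (hW.prodMk hU).aemeasurable hV.aemeasurable, h3]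
  have e : (fun ω => ((W ω, U ω), V ω)) =
      MeasurableEquiv.prodAssoc.symm ∘ fun ω => (W ω, U ω, V ω) := rfl
  rw [e, ← Measure.map_map MeasurableEquiv.prodAssoc.symm.measurable
    (hW.prodMk (hU.prodMk hV)), h1, h2, ← Measure.prodAssoc_prod,
    Measure.map_map MeasurableEquiv.prodAssoc.symm.measurable
      MeasurableEquiv.prodAssoc.measurable]
  simp

/-- The variables `e i` are uncorrelated with variance `σ2`, and orthogonal to the
square-integrable functions that are measurable for `m`. -/
structure IsWhiteNoise {Ω : Type*} {m₀ : MeasurableSpace Ω} (μ : Measure Ω)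
    (m : MeasurableSpace Ω) (σ2 : ℝ) {ι : Type*} (e : ι → Ω → ℝ) : Prop where
  memLp : ∀ i, MemLp (e i) 2 μ
  orthogonal : ∀ i, ∀ A : Ω → ℝ, MemLp A 2 μ → AEStronglyMeasurable[m] A μ →
    ∫ ω, A ω * e i ω ∂μ = 0
  uncorrelated : ∀ i j, i ≠ j → ∫ ω, e i ω * e j ω ∂μ = 0
  variance : ∀ i, ∫ ω, e i ω ^ 2 ∂μ = σ2

/-- Pythagoras, adding one noise variable at a time: each is orthogonal to `A` and to those already
present. -/
lemma IsWhiteNoise.integral_sq_sub {Ω : Type*} {m m₀ : MeasurableSpace Ω} {μ : Measure Ω}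
    {σ2 : ℝ} {ι : Type*} {e : ι → Ω → ℝ} (he : IsWhiteNoise μ m σ2 e) {A : Ω → ℝ}
    (hA : MemLp A 2 μ) (hAm : AEStronglyMeasurable[m] A μ) (F : Finset ι) (g : ι → ℝ) :
    ∫ ω, (A ω - ∑ i ∈ F, g i * e i ω) ^ 2 ∂μ = ∫ ω, A ω ^ 2 ∂μ + σ2 * ∑ i ∈ F, g i ^ 2 := by
  classical
  have hE : ∀ F : Finset ι, MemLp (fun ω => ∑ i ∈ F, g i * e i ω) 2 μ := fun F =>
    memLp_finsetSum _ fun i _ => (he.memLp i).const_mul _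
  induction F using Finset.induction_on with
  | empty => simp
  | insert i F hi ih =>
    have hB : MemLp (fun ω => A ω - ∑ i ∈ F, g i * e i ω) 2 μ := hA.sub (hE F)
    have hexp : ∀ ω, (A ω - ∑ j ∈ insert i F, g j * e j ω) ^ 2 =
        (A ω - ∑ j ∈ F, g j * e j ω) ^ 2 + (-2 * g i) * ((A ω - ∑ j ∈ F, g j * e j ω) * e i ω) +
        g i ^ 2 * e i ω ^ 2 := fun ω => by
      rw [Finset.sum_insert hi]; ring
    have hBe := MemLp.integrable_mul_two hB (he.memLp i)
    have hz : ∫ ω, (A ω - ∑ j ∈ F, g j * e j ω) * e i ω ∂μ = 0 := by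
      simp_rw [sub_mul, Finset.sum_mul]
      have hji : ∀ j, Integrable (fun ω => g j * e j ω * e i ω) μ := fun j =>
        MemLp.integrable_mul_two ((he.memLp j).const_mul (g j)) (he.memLp i)
      rw [integral_sub (MemLp.integrable_mul_two hA (he.memLp i))
        (integrable_finsetSum _ fun j _ => hji j), he.orthogonal i A hA hAm,
        integral_finsetSum _ fun j _ => hji j, zero_sub, neg_eq_zero]
      refine Finset.sum_eq_zero fun j hj => ?_
      simp_rw [mul_assoc]
      rw [integral_const_mul, he.uncorrelated j i (fun h => hi (h ▸ hj)), mul_zero]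
    simp_rw [hexp]
    rw [integral_add (hB.integrable_sq.fun_add (hBe.const_mul _))
      ((he.memLp i).integrable_sq.const_mul _), integral_add hB.integrable_sq (hBe.const_mul _),
      integral_const_mul, integral_const_mul, hz, ih, he.variance, Finset.sum_insert hi]
    ring

lemma indepFun_of_measurable {Ω : Type*} {m m' m₀ : MeasurableSpace Ω} {μ : Measure Ω}
    {α β : Type*} [MeasurableSpace α] [MeasurableSpace β] (h : Indep m' m μ) {W : Ω → α} {V : Ω → β}
    (hW : Measurable[m] W) (hV : Measurable[m'] V) : IndepFun W V μ := by
  rw [IndepFun_iff_Indep]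
  exact (indep_of_indep_of_le h hV.comap_le hW.comap_le).symm

lemma measurable_sigmaGen {Ω ι : Type*} (X : ι → Ω → ℝ) (i : ι) : Measurable[sigmaGen X] (X i) :=
  (comap_measurable (X i)).mono
    (le_iSup (fun i => MeasurableSpace.comap (X i) inferInstance) i) le_rfl

/-- The error of the dithered mid-rise quantizer of step `δ`, as a function of the signal and the
normalized dither. -/
def scaledQuantError (δ : ℝ) (p : ℝ × ℝ) : ℝ := δ * quantError (p.1 / δ) p.2

lemma measurable_scaledQuantError (δ : ℝ) : Measurable (scaledQuantError δ) :=
  (measurable_quantError.comp ((measurable_fst.div_const δ).prodMk measurable_snd)).const_mul δ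

/-- The quantization error with triangular dither is white noise. -/
theorem isWhiteNoise_quantError {Ω : Type*} {m m₀ : MeasurableSpace Ω} {μ : Measure Ω}
    [IsProbabilityMeasure μ] (hm : m ≤ m₀) {ι : Type*} {v y : ι → Ω → ℝ}
    (hv : ∀ i, Measurable (v i)) (hlaw : ∀ i, μ.map (v i) = triangularLaw)
    (hvi : iIndepFun v μ) (hind : Indep (sigmaGen v) m μ)
    (hy : ∀ i, AEStronglyMeasurable[m] (y i) μ) (δ : ℝ) :
    IsWhiteNoise μ m (δ ^ 2 / 4) (fun i ω => scaledQuantError δ (y i ω, v i ω)) := by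
  -- The signals are measurable for `m` only up to null sets; genuine representatives are needed to
  -- invoke independence of σ-algebras.
  obtain ⟨y', hy'm, hyy'⟩ : ∃ y' : ι → Ω → ℝ, (∀ i, StronglyMeasurable[m] (y' i)) ∧
      ∀ i, y i =ᵐ[μ] y' i :=
    ⟨fun i => (hy i).mk (y i), fun i => (hy i).stronglyMeasurable_mk, fun i => (hy i).ae_eq_mk⟩
  have hy'0 : ∀ i, Measurable (y' i) := fun i => (hy'm i).measurable.mono hm le_rfl
  set e' : ι → Ω → ℝ := fun i ω => scaledQuantError δ (y' i ω, v i ω) with he'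
  have hee' : ∀ i, (fun ω => scaledQuantError δ (y i ω, v i ω)) =ᵐ[μ] e' i := fun i => by
    filter_upwards [hyy' i] with ω hω
    simp only [he', hω]
  have hq := measurable_scaledQuantError δ
  have he'm : ∀ i, Measurable (e' i) := fun i => hq.comp ((hy'0 i).prodMk (hv i))
  have hbound : ∀ i, ∀ᵐ ω ∂μ, ‖e' i ω‖ ≤ |δ| * 2 := by
    intro i
    have h1 := ae_abs_le_one_triangularLaw
    rw [← hlaw i] at h1
    filter_upwards [ae_of_ae_map (hv i).aemeasurable h1] with ω hω
    simp only [he', scaledQuantError, Real.norm_eq_abs, abs_mul]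
    exact mul_le_mul_of_nonneg_left (abs_quantError_le hω) (abs_nonneg _)
  have heL : ∀ i, MemLp (e' i) 2 μ := fun i =>
    MemLp.of_bound (he'm i).aestronglyMeasurable _ (hbound i)
  -- orthogonality to a function jointly independent with the signal
  have orth : ∀ (i : ι) (A : Ω → ℝ), Measurable A → MemLp A 2 μ →
      IndepFun (fun ω => (y' i ω, A ω)) (v i) μ → ∫ ω, A ω * e' i ω ∂μ = 0 := by
    intro i A hA hAL hI
    have := integral_comp_of_indepFun (U := fun ω => (y' i ω, A ω))
      (F := fun p => p.1.2 * (scaledQuantError δ (p.1.1, p.2))) ((hy'0 i).prodMk hA) (hv i)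
      (hlaw i) hI ((measurable_snd.comp measurable_fst).mul
        (hq.comp ((measurable_fst.comp measurable_fst).prodMk measurable_snd)))
      (MemLp.integrable_mul_two hAL (heL i))
    exact this.trans (integral_eq_zero_of_ae (.of_forall fun ω => by
      simp only [Pi.zero_apply, scaledQuantError]
      rw [integral_const_mul, integral_const_mul, integral_quantError, mul_zero, mul_zero]))
  refine ⟨fun i => (heL i).ae_eq (hee' i).symm, fun i A hA hAm => ?_, fun i j hij => ?_,
    fun i => ?_⟩
  · obtain ⟨A', hA'm, hAA'⟩ := hAm
    have e1 : ∫ ω, A ω * (scaledQuantError δ (y i ω, v i ω)) ∂μ = ∫ ω, A' ω * e' i ω ∂μ := by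
      refine integral_congr_ae ?_
      filter_upwards [hAA', hee' i] with ω h1 h2
      rw [h1, h2]
    rw [e1]
    refine orth i A' (hA'm.measurable.mono hm le_rfl) (hA.ae_eq hAA') ?_
    exact indepFun_of_measurable hind ((hy'm i).measurable.prodMk hA'm.measurable)
      (measurable_sigmaGen v i)
  · have e1 : ∫ ω, (scaledQuantError δ (y i ω, v i ω)) * (scaledQuantError δ (y j ω, v j ω)) ∂μ =
        ∫ ω, e' i ω * e' j ω ∂μ := by
      refine integral_congr_ae ?_
      filter_upwards [hee' i, hee' j] with ω h1 h2
      rw [h1, h2]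
    rw [e1]
    -- The error `e' i` is a function of `y' i` and `v i`, hence is jointly independent, together
    -- with `y' j`, of `v j`; so it may play the role of `A`.
    refine orth j (e' i) (he'm i) (heL i) ?_
    have h1 : IndepFun (fun ω => (y' i ω, y' j ω)) (fun ω => (v i ω, v j ω)) μ :=
      indepFun_of_measurable hind ((hy'm i).measurable.prodMk (hy'm j).measurable)
        ((measurable_sigmaGen v i).prodMk (measurable_sigmaGen v j))
    have h2 := indepFun_prodMk_assoc ((hy'0 i).prodMk (hy'0 j)) (hv i) (hv j) h1
      (hvi.indepFun hij)
    exact h2.comp (φ := fun p : (ℝ × ℝ) × ℝ => (p.1.2, scaledQuantError δ (p.1.1, p.2)))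
      ((measurable_snd.comp measurable_fst).prodMk
        (hq.comp ((measurable_fst.comp measurable_fst).prodMk measurable_snd))) measurable_id
  · have e1 : ∫ ω, (scaledQuantError δ (y i ω, v i ω)) ^ 2 ∂μ = ∫ ω, e' i ω ^ 2 ∂μ := by
      refine integral_congr_ae ?_
      filter_upwards [hee' i] with ω h1
      rw [h1]
    rw [e1]
    have := integral_comp_of_indepFun (U := y' i)
      (F := fun p => scaledQuantError δ (p.1, p.2) ^ 2) (hy'0 i) (hv i)
      (hlaw i) (indepFun_of_measurable hind (hy'm i).measurable (measurable_sigmaGen v i))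
      (hq.pow_const 2) (heL i).integrable_sq
    have e2 : ∀ ω, ∫ w, scaledQuantError δ (y' i ω, w) ^ 2 ∂triangularLaw = δ ^ 2 / 4 := by
      intro ω
      simp only [scaledQuantError, mul_pow]
      rw [integral_const_mul, integral_sq_quantError]
      ring
    rw [this]
    simp only [e2, integral_const, probReal_univ, one_smul]

/-- The dither is centered, independent of the signal and of variance `δ² / 6`, so the powers add.
This evaluates the right-hand side of the dynamic range equation. -/
lemma integral_sq_add_dither {Ω : Type*} {m m₀ : MeasurableSpace Ω} {μ : Measure Ω}
    [IsProbabilityMeasure μ] (hm : m ≤ m₀) {v y : Ω → ℝ}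
    (hv : Measurable v) (hlaw : μ.map v = triangularLaw)
    (hind : Indep (MeasurableSpace.comap v inferInstance) m μ)
    (hy : AEStronglyMeasurable[m] y μ) (hyL : MemLp y 2 μ) (δ : ℝ) :
    ∫ ω, (y ω + δ * v ω) ^ 2 ∂μ = ∫ ω, y ω ^ 2 ∂μ + δ ^ 2 / 6 := by
  obtain ⟨y', hy'm, hyy'⟩ := hy
  have hy'0 : Measurable y' := hy'm.measurable.mono hm le_rfl
  have hvL : MemLp v 2 μ := by
    refine MemLp.of_bound hv.aestronglyMeasurable 1 ?_
    have h1 := ae_abs_le_one_triangularLaw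
    rw [← hlaw] at h1
    filter_upwards [ae_of_ae_map hv.aemeasurable h1] with ω hω using hω
  have hy'L : MemLp y' 2 μ := hyL.ae_eq hyy'
  have hcross : ∫ ω, y ω * v ω ∂μ = 0 := by
    have e1 : ∫ ω, y ω * v ω ∂μ = ∫ ω, y' ω * v ω ∂μ := by
      refine integral_congr_ae ?_
      filter_upwards [hyy'] with ω h1
      rw [h1]
    rw [e1]
    have := integral_comp_of_indepFun (U := y') (F := fun p => p.1 * p.2) hy'0 hv hlaw
      (indepFun_of_measurable hind hy'm.measurable (comap_measurable v))
      (measurable_fst.mul measurable_snd) (MemLp.integrable_mul_two hy'L hvL)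
    exact this.trans (integral_eq_zero_of_ae (.of_forall fun ω => by
      simp only [Pi.zero_apply]
      rw [integral_const_mul, integral_id_triangularLaw, mul_zero]))
  have hsq : ∫ ω, v ω ^ 2 ∂μ = 1 / 6 := by
    rw [← integral_sq_triangularLaw, ← hlaw,
      integral_map (f := fun w => w ^ 2) hv.aemeasurable
        (measurable_id.pow_const 2).aestronglyMeasurable]
  have hexp : ∀ ω, (y ω + δ * v ω) ^ 2 = y ω ^ 2 + 2 * δ * (y ω * v ω) + δ ^ 2 * v ω ^ 2 :=
    fun ω => by ring
  have hyv := MemLp.integrable_mul_two hyL hvL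
  simp_rw [hexp]
  rw [integral_add (hyL.integrable_sq.fun_add (hyv.const_mul _)) (hvL.integrable_sq.const_mul _),
    integral_add hyL.integrable_sq (hyv.const_mul _), integral_const_mul, integral_const_mul,
    hcross, hsq]
  ring

end Noise

end TaskADC

end

noncomputable section

namespace TaskADC

/-! ### Mean-squared error of finite acquisition systems -/

section System

variable {Ω : Type*} [MeasurableSpace Ω] {μ : Measure Ω} {M N K : ℕ}

/-- The input process, the task and its linear MMSE estimate, and the dither. -/
structure IsTaskSetting (μ : Measure Ω) (x : Fin M → ℝ → Ω → ℝ)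
    (C : ℝ → Matrix (Fin M) (Fin M) ℂ) (s : Fin N → Ω → ℝ) (Γ : ℝ → Matrix (Fin N) (Fin M) ℂ)
    (u : Fin N → ℝ → Ω → ℝ) (v : Fin K → ℤ → Ω → ℝ) : Prop where
  pos : 1 ≤ K
  wss : IsWSSWithPSD μ x C
  task_measurable : ∀ i, Measurable (s i)
  task_memLp : ∀ i, MemLp (s i) 2 μ
  estimator : IsFilterOutput μ C x Γ u
  mmse : ∀ i, μ[s i | inputSigma x] =ᵐ[μ] u i 0
  dither : IsDither μ x s v

/-- Finite linear combinations of samples. -/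
def linComb (S : Finset ℤ) (g : Fin K → ℤ → ℝ) (y : Fin K → ℤ → Ω → ℝ) (ω : Ω) : ℝ :=
  ∑ k, ∑ n ∈ S, g k n * y k n ω

/-- The largest power of the outputs of the filter `H`. -/
def peakPower (C : ℝ → Matrix (Fin M) (Fin M) ℂ) (H : ℝ → Matrix (Fin K) (Fin M) ℂ) : ℝ :=
  ⨆ k, ∫ f, (specForm (C f) (H f k) (H f k)).re

/-- The variance of the quantization noise of unit-rate quantizers for a signal of unit power. -/
def noiseFactor (η : ℝ) (b : ℕ) : ℝ := η ^ 2 / (2 ^ (2 * b) - 2 * η ^ 2 / 3)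

/-- The energy of a finite family of digital filter coefficients. -/
def tapEnergy (S : Finset ℤ) (g : Fin N → Fin K → ℤ → ℝ) : ℝ :=
  ∑ i, ∑ k, ∑ n ∈ S, g i k n ^ 2

lemma tapEnergy_nonneg (S : Finset ℤ) (g : Fin N → Fin K → ℤ → ℝ) : 0 ≤ tapEnergy S g :=
  Finset.sum_nonneg fun _ _ => Finset.sum_nonneg fun _ _ => Finset.sum_nonneg fun _ _ => sq_nonneg _

/-- The distortion of the MMSE estimate caused by the recovery from unquantized samples. -/
def recoveryError (μ : Measure Ω) (u : Fin N → ℝ → Ω → ℝ) (fs : ℝ) (y : Fin K → ℝ → Ω → ℝ)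
    (S : Finset ℤ) (g : Fin N → Fin K → ℤ → ℝ) : ℝ :=
  ∑ i, ∫ ω, (u i 0 ω - linComb S (g i) (samples fs y) ω) ^ 2 ∂μ

/-- The error of the MMSE estimate itself. -/
def mmseError (μ : Measure Ω) (s : Fin N → Ω → ℝ) (u : Fin N → ℝ → Ω → ℝ) : ℝ :=
  ∑ i, ∫ ω, (s i ω - u i 0 ω) ^ 2 ∂μ

/-- The MSE of an acquisition system with finitely many digital filter taps. -/
def finiteMSE (μ : Measure Ω) (C : ℝ → Matrix (Fin M) (Fin M) ℂ) (s : Fin N → Ω → ℝ)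
    (u : Fin N → ℝ → Ω → ℝ) (η fs : ℝ) (b : ℕ) (H : ℝ → Matrix (Fin K) (Fin M) ℂ)
    (y : Fin K → ℝ → Ω → ℝ) (S : Finset ℤ) (g : Fin N → Fin K → ℤ → ℝ) : ℝ :=
  mmseError μ s u + recoveryError μ u fs y S g +
    noiseFactor η b * peakPower C H / fs ^ 2 * tapEnergy S g

lemma IsConfig.noiseFactor_denom_pos {η fnyq fs : ℝ} {b : ℕ} (h : IsConfig η fnyq fs b) :
    0 < (2 : ℝ) ^ (2 * b) - 2 * η ^ 2 / 3 := by
  have := h.2.2.2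
  linarith

lemma IsConfig.noiseFactor_nonneg {η fnyq fs : ℝ} {b : ℕ} (h : IsConfig η fnyq fs b) :
    0 ≤ noiseFactor η b :=
  div_nonneg (sq_nonneg _) h.noiseFactor_denom_pos.le

lemma memLp_samples {C : ℝ → Matrix (Fin M) (Fin M) ℂ} {x : Fin M → ℝ → Ω → ℝ}
    {H : ℝ → Matrix (Fin K) (Fin M) ℂ} {y : Fin K → ℝ → Ω → ℝ} (hy : IsFilterOutput μ C x H y)
    (fs : ℝ) (k : Fin K) (n : ℤ) : MemLp (samples fs y k n) 2 μ :=
  (hy.memLp k _).const_mul _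

lemma aestronglyMeasurable_finset_sum {Ω ι : Type*} {m m₀ : MeasurableSpace Ω} {μ : Measure[m₀] Ω}
    {f : ι → Ω → ℝ} (F : Finset ι) (hf : ∀ i ∈ F, AEStronglyMeasurable[m] (f i) μ) :
    AEStronglyMeasurable[m] (fun ω => ∑ i ∈ F, f i ω) μ := by
  classical
  induction F using Finset.induction_on with
  | empty => simpa using aestronglyMeasurable_const
  | insert i F hi ih =>
    simp_rw [Finset.sum_insert hi]
    exact (hf i (Finset.mem_insert_self i F)).add
      (ih fun j hj => hf j (Finset.mem_insert_of_mem hj))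

lemma memLp_linComb {y : Fin K → ℤ → Ω → ℝ} (hy : ∀ k n, MemLp (y k n) 2 μ) (S : Finset ℤ)
    (g : Fin K → ℤ → ℝ) : MemLp (linComb S g y) 2 μ :=
  memLp_finsetSum _ fun k _ => memLp_finsetSum _ fun n _ => (hy k n).const_mul _

lemma peakPower_le {C : ℝ → Matrix (Fin M) (Fin M) ℂ} {H : ℝ → Matrix (Fin K) (Fin M) ℂ}
    (k : Fin K) : ∫ f, (specForm (C f) (H f k) (H f k)).re ≤ peakPower C H :=
  le_ciSup (f := fun k => ∫ f, (specForm (C f) (H f k) (H f k)).re) (Set.finite_range _).bddAbove k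

lemma peakPower_nonneg {C : ℝ → Matrix (Fin M) (Fin M) ℂ} (hC : ∀ f, (C f).PosSemidef)
    (H : ℝ → Matrix (Fin K) (Fin M) ℂ) : 0 ≤ peakPower C H :=
  Real.iSup_nonneg fun _ => integral_nonneg fun f => specForm_self_re_nonneg (hC f) _

namespace IsTaskSetting

variable {C : ℝ → Matrix (Fin M) (Fin M) ℂ} {x : Fin M → ℝ → Ω → ℝ}
  {s : Fin N → Ω → ℝ} {Γ : ℝ → Matrix (Fin N) (Fin M) ℂ} {u : Fin N → ℝ → Ω → ℝ}
  {v : Fin K → ℤ → Ω → ℝ} {H : ℝ → Matrix (Fin K) (Fin M) ℂ} {y : Fin K → ℝ → Ω → ℝ}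

lemma sup_sigma_le (h : IsTaskSetting μ x C s Γ u v) :
    inputSigma x ⊔ sigmaGen s ≤ ‹MeasurableSpace Ω› :=
  sup_le h.wss.inputSigma_le (iSup_le fun i => (h.task_measurable i).comap_le)

variable [IsProbabilityMeasure μ]

lemma aestronglyMeasurable_samples (h : IsTaskSetting μ x C s Γ u v)
    (hy : IsFilterOutput μ C x H y) (fs : ℝ) (k : Fin K) (n : ℤ) :
    AEStronglyMeasurable[inputSigma x] (samples fs y k n) μ :=
  (hy.aestronglyMeasurable_inputSigma h.wss k _).const_mul _

/-- By stationarity the sample powers do not depend on `n`, so the infinitely many conditions on `γ`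
collapse to one quadratic equation involving only the peak power of the filter. -/
lemma isDynamicRange_iff (h : IsTaskSetting μ x C s Γ u v) (hy : IsFilterOutput μ C x H y)
    (η fs γ : ℝ) (b : ℕ) :
    IsDynamicRange μ η b (samples fs y) v γ ↔
      0 ≤ γ ∧ γ ^ 2 = η ^ 2 * (peakPower C H / fs ^ 2 + stepSize γ b ^ 2 / 6) := by
  have hne : Nonempty (Fin K) := ⟨⟨0, h.pos⟩⟩
  have key : ∀ n, ⨆ k, ∫ ω, (samples fs y k n ω + stepSize γ b * v k n ω) ^ 2 ∂μ =
      peakPower C H / fs ^ 2 + stepSize γ b ^ 2 / 6 := by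
    intro n
    have h1 : ∀ k, ∫ ω, (samples fs y k n ω + stepSize γ b * v k n ω) ^ 2 ∂μ =
        (∫ f, (specForm (C f) (H f k) (H f k)).re) / fs ^ 2 + stepSize γ b ^ 2 / 6 := by
      intro k
      rw [integral_sq_add_dither h.sup_sigma_le (h.dither.measurable k n) (h.dither.law k n)
        (indep_of_indep_of_le_left h.dither.indep_input
          (le_iSup (fun p : Fin K × ℤ => MeasurableSpace.comap (v p.1 p.2) inferInstance) (k, n)))
        ((h.aestronglyMeasurable_samples hy fs k n).mono le_sup_left) (memLp_samples hy fs k n),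
        ← hy.integral_sq h.wss k ((n : ℝ) * (1 / fs))]
      simp only [samples, mul_pow]
      rw [integral_const_mul]
      ring
    simp_rw [h1]
    rw [← ciSup_add (Set.finite_range _).bddAbove, peakPower]
    congr 1
    simp_rw [div_eq_mul_inv]
    rw [Real.iSup_mul_of_nonneg (by positivity)]
  unfold IsDynamicRange
  simp_rw [key]
  exact and_congr_right fun _ => ⟨fun h => h 0, fun h _ => h⟩

lemma stepSize_sq (γ : ℝ) (b : ℕ) : stepSize γ b ^ 2 = 4 * γ ^ 2 / 2 ^ (2 * b) := by
  unfold stepSize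
  rw [div_pow, mul_pow, ← pow_mul, mul_comm b 2]
  norm_num

/-- With `q = peakPower C H / fs ^ 2` and `B = 2 ^ (2 * b)`, the step satisfies `Δ² = 4γ² / B`, so
the range equation becomes `γ² (1 - 2η² / (3B)) = η² q`. Then `Δ² / 4 = γ² / B` is the stated
variance, eliminating `γ` from the problem. -/
lemma noise_variance_of_isDynamicRange (h : IsTaskSetting μ x C s Γ u v)
    (hy : IsFilterOutput μ C x H y) {η fnyq fs γ : ℝ} {b : ℕ} (hc : IsConfig η fnyq fs b)
    (hγ : IsDynamicRange μ η b (samples fs y) v γ) :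
    stepSize γ b ^ 2 / 4 = noiseFactor η b * peakPower C H / fs ^ 2 := by
  have h1 := ((h.isDynamicRange_iff hy η fs γ b).1 hγ).2
  have hd := hc.noiseFactor_denom_pos
  rw [stepSize_sq] at *
  unfold noiseFactor
  have hB : (0 : ℝ) < 2 ^ (2 * b) := by positivity
  have hB0 := hB.ne'
  have hd0 := hd.ne'
  have hfs := hc.1.ne'
  generalize (2 : ℝ) ^ (2 * b) = B at *
  rw [show η ^ 2 / (B - 2 * η ^ 2 / 3) * peakPower C H / fs ^ 2 =
    η ^ 2 * (peakPower C H / fs ^ 2) / (B - 2 * η ^ 2 / 3) by ring, eq_div_iff hd0]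
  generalize peakPower C H / fs ^ 2 = q at *
  field_simp
  field_simp at h1
  nlinarith

lemma exists_isDynamicRange (h : IsTaskSetting μ x C s Γ u v)
    (hy : IsFilterOutput μ C x H y) {η fnyq fs : ℝ} {b : ℕ} (hc : IsConfig η fnyq fs b) :
    ∃ γ, IsDynamicRange μ η b (samples fs y) v γ := by
  have hd := hc.noiseFactor_denom_pos
  have hQ := peakPower_nonneg (C := C) h.wss.psd_posSemidef H
  have hpos : 0 ≤ noiseFactor η b * 2 ^ (2 * b) * (peakPower C H / fs ^ 2) :=
    mul_nonneg (mul_nonneg hc.noiseFactor_nonneg (by positivity)) (by positivity)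
  refine ⟨√(noiseFactor η b * 2 ^ (2 * b) * (peakPower C H / fs ^ 2)),
    (h.isDynamicRange_iff hy η fs _ b).2 ⟨Real.sqrt_nonneg _, ?_⟩⟩
  rw [stepSize_sq, Real.sq_sqrt hpos]
  unfold noiseFactor
  have hB : (0 : ℝ) < 2 ^ (2 * b) := by positivity
  generalize (2 : ℝ) ^ (2 * b) = B at *
  generalize peakPower C H / fs ^ 2 = q at *
  have hB0 := hB.ne'
  rw [show 4 * (η ^ 2 / (B - 2 * η ^ 2 / 3) * B * q) / B =
    4 * (η ^ 2 / (B - 2 * η ^ 2 / 3) * q) by field_simp]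
  generalize hD : B - 2 * η ^ 2 / 3 = D at *
  obtain rfl : B = D + 2 * η ^ 2 / 3 := by linarith
  have hD0 := hd.ne'
  field_simp
  ring

lemma quantized_ae_eq (h : IsTaskSetting μ x C s Γ u v)
    (hy : IsFilterOutput μ C x H y) {η fs γ : ℝ} (hη : 0 < η) (hfs : 0 < fs) {b : ℕ}
    (hγ : IsDynamicRange μ η b (samples fs y) v γ) (k : Fin K) (n : ℤ) :
    quantized γ b (samples fs y) v k n =ᵐ[μ] fun ω => samples fs y k n ω +
      scaledQuantError (stepSize γ b) (samples fs y k n ω, v k n ω) := by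
  -- A zero step makes the quantizer output `0`, with `a / 0 = 0` inside the floor. It occurs only
  -- for zero peak power, since `η > 0`; the samples then vanish almost surely, and the identity
  -- persists.
  by_cases hδ : stepSize γ b = 0
  · have h1 := ((h.isDynamicRange_iff hy η fs γ b).1 hγ).2
    have hγ0 : γ = 0 := by simpa [stepSize] using hδ
    rw [hδ, hγ0] at h1
    have hP : peakPower C H = 0 := by
      have h2 : η ^ 2 * (peakPower C H / fs ^ 2) = 0 := by linarith
      rcases mul_eq_zero.1 h2 with h3 | h3
      · exact absurd h3 (by positivity)
      · rcases div_eq_zero_iff.1 h3 with h4 | h4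
        · exact h4
        · exact absurd h4 (by positivity)
    have h2 : ∫ ω, y k ((n : ℝ) * (1 / fs)) ω ^ 2 ∂μ = 0 := by
      refine le_antisymm ?_ (integral_nonneg fun _ => sq_nonneg _)
      rw [hy.integral_sq h.wss, ← hP]
      exact peakPower_le k
    rw [integral_eq_zero_iff_of_nonneg (fun _ => sq_nonneg _) (hy.memLp k _).integrable_sq] at h2
    filter_upwards [h2] with ω hω
    have hω' : y k ((n : ℝ) * (1 / fs)) ω = 0 := by simpa using hω
    have hs0 : samples fs y k n ω = 0 := by simp only [samples, hω', mul_zero]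
    simp [quantized, scaledQuantError, hδ, midRise, hs0]
  · refine .of_forall fun ω => ?_
    simp only [quantized, scaledQuantError, quantError, midRise]
    rw [add_div, mul_div_cancel_left₀ _ hδ]
    field_simp
    ring

/-- Two orthogonalities: the noise is orthogonal to the functions of input and task, in particular
to the task minus the unquantized estimate; and the residual of the conditional expectation is
orthogonal to the functions of the input. -/
lemma integral_sq_sub_linComb (h : IsTaskSetting μ x C s Γ u v)
    (hy : IsFilterOutput μ C x H y) {η fnyq fs γ : ℝ} (hη : 0 < η) {b : ℕ}
    (hc : IsConfig η fnyq fs b) (hγ : IsDynamicRange μ η b (samples fs y) v γ)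
    (S : Finset ℤ) (g : Fin K → ℤ → ℝ) (i : Fin N) :
    ∫ ω, (s i ω - linComb S g (quantized γ b (samples fs y) v) ω) ^ 2 ∂μ =
      ∫ ω, (s i ω - u i 0 ω) ^ 2 ∂μ + ∫ ω, (u i 0 ω - linComb S g (samples fs y) ω) ^ 2 ∂μ +
      noiseFactor η b * peakPower C H / fs ^ 2 * ∑ k, ∑ n ∈ S, g k n ^ 2 := by
  have hm := h.sup_sigma_le
  have hY := memLp_linComb (memLp_samples hy fs) S g
  have hYm : AEStronglyMeasurable[inputSigma x] (linComb S g (samples fs y)) μ :=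
    aestronglyMeasurable_finset_sum _ fun k _ => aestronglyMeasurable_finset_sum _ fun n _ =>
      (h.aestronglyMeasurable_samples hy fs k n).const_mul _
  have hW := isWhiteNoise_quantError hm (v := fun p : Fin K × ℤ => v p.1 p.2)
    (y := fun p : Fin K × ℤ => samples fs y p.1 p.2) (fun p => h.dither.measurable p.1 p.2)
    (fun p => h.dither.law p.1 p.2) h.dither.iIndep h.dither.indep_input
    (fun p => (h.aestronglyMeasurable_samples hy fs p.1 p.2).mono le_sup_left) (stepSize γ b)
  have hsm' : Measurable[inputSigma x ⊔ sigmaGen s] (s i) :=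
    (measurable_sigmaGen s i).mono le_sup_right le_rfl
  have hsm : AEStronglyMeasurable[inputSigma x ⊔ sigmaGen s] (s i) μ :=
    hsm'.stronglyMeasurable.aestronglyMeasurable
  have h1 := hW.integral_sq_sub (A := fun ω => s i ω - linComb S g (samples fs y) ω)
    ((h.task_memLp i).sub hY) (hsm.sub (hYm.mono le_sup_left)) (Finset.univ ×ˢ S)
    (fun p => g p.1 p.2)
  rw [h.noise_variance_of_isDynamicRange hy hc hγ, Finset.sum_product] at h1
  have h2 : ∫ ω, (s i ω - linComb S g (quantized γ b (samples fs y) v) ω) ^ 2 ∂μ =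
      ∫ ω, (s i ω - linComb S g (samples fs y) ω - ∑ p ∈ Finset.univ ×ˢ S, g p.1 p.2 *
        scaledQuantError (stepSize γ b) (samples fs y p.1 p.2 ω, v p.1 p.2 ω)) ^ 2 ∂μ := by
    refine integral_congr_ae ?_
    have hall : ∀ᵐ ω ∂μ, ∀ k n, quantized γ b (samples fs y) v k n ω = samples fs y k n ω +
        scaledQuantError (stepSize γ b) (samples fs y k n ω, v k n ω) :=
      ae_all_iff.2 fun k => ae_all_iff.2 fun n => h.quantized_ae_eq hy hη hc.1 hγ k n
    filter_upwards [hall] with ω hω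
    rw [Finset.sum_product]
    simp only [linComb, hω, mul_add, Finset.sum_add_distrib]
    congr 1
    ring
  have h3 : ∫ ω, (s i ω - linComb S g (samples fs y) ω) ^ 2 ∂μ =
      ∫ ω, (s i ω - u i 0 ω) ^ 2 ∂μ + ∫ ω, (u i 0 ω - linComb S g (samples fs y) ω) ^ 2 ∂μ := by
    have hu := h.estimator.memLp i 0
    have hD : MemLp (fun ω => u i 0 ω - linComb S g (samples fs y) ω) 2 μ := hu.sub hY
    have hR : MemLp (fun ω => s i ω - u i 0 ω) 2 μ := (h.task_memLp i).sub hu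
    have horth : ∫ ω, (s i ω - u i 0 ω) * (u i 0 ω - linComb S g (samples fs y) ω) ∂μ = 0 := by
      have := integral_condExp_mul h.wss.inputSigma_le (h.task_memLp i) hD
        ((h.estimator.aestronglyMeasurable_inputSigma h.wss i 0).sub hYm)
      simp only [sub_mul]
      rw [integral_sub (MemLp.integrable_mul_two (h.task_memLp i) hD)
        (MemLp.integrable_mul_two hu hD), ← this, sub_eq_zero]
      refine integral_congr_ae ?_
      filter_upwards [h.mmse i] with ω hω
      rw [hω]
    have hexp : ∀ ω, (s i ω - linComb S g (samples fs y) ω) ^ 2 = (s i ω - u i 0 ω) ^ 2 +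
        2 * ((s i ω - u i 0 ω) * (u i 0 ω - linComb S g (samples fs y) ω)) +
        (u i 0 ω - linComb S g (samples fs y) ω) ^ 2 := fun ω => by ring
    have hRD := MemLp.integrable_mul_two hR hD
    simp_rw [hexp]
    rw [integral_add (hR.integrable_sq.fun_add (hRD.const_mul _)) hD.integrable_sq,
      integral_add hR.integrable_sq (hRD.const_mul _), integral_const_mul, horth]
    ring
  rw [h2, h1, h3]

lemma memLp_quantized (h : IsTaskSetting μ x C s Γ u v)
    (hy : IsFilterOutput μ C x H y) {η fs γ : ℝ} (hη : 0 < η) (hfs : 0 < fs) {b : ℕ}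
    (hγ : IsDynamicRange μ η b (samples fs y) v γ) (k : Fin K) (n : ℤ) :
    MemLp (quantized γ b (samples fs y) v k n) 2 μ := by
  have hW := isWhiteNoise_quantError h.sup_sigma_le (v := fun p : Fin K × ℤ => v p.1 p.2)
    (y := fun p : Fin K × ℤ => samples fs y p.1 p.2) (fun p => h.dither.measurable p.1 p.2)
    (fun p => h.dither.law p.1 p.2) h.dither.iIndep h.dither.indep_input
    (fun p => (h.aestronglyMeasurable_samples hy fs p.1 p.2).mono le_sup_left) (stepSize γ b)
  exact ((memLp_samples hy fs k n).add (hW.memLp (k, n))).ae_eq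
    (h.quantized_ae_eq hy hη hfs hγ k n).symm

lemma mse_linComb (h : IsTaskSetting μ x C s Γ u v)
    (hy : IsFilterOutput μ C x H y) {η fnyq fs γ : ℝ} (hη : 0 < η) {b : ℕ}
    (hc : IsConfig η fnyq fs b) (hγ : IsDynamicRange μ η b (samples fs y) v γ)
    (S : Finset ℤ) (g : Fin N → Fin K → ℤ → ℝ) :
    mse μ s (fun i => linComb S (g i) (quantized γ b (samples fs y) v)) =
      finiteMSE μ C s u η fs b H y S g := by
  unfold mse finiteMSE mmseError recoveryError tapEnergy
  have hz := h.memLp_quantized hy hη hc.1 hγ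
  have hi : ∀ i, Integrable (fun ω =>
      (s i ω - linComb S (g i) (quantized γ b (samples fs y) v) ω) ^ 2) μ := fun i =>
    ((h.task_memLp i).sub (memLp_linComb hz S (g i))).integrable_sq
  rw [integral_finsetSum _ fun i _ => hi i]
  simp_rw [h.integral_sq_sub_linComb hy hη hc hγ S]
  rw [Finset.sum_add_distrib, Finset.sum_add_distrib, Finset.mul_sum]

/-- Every system with finitely many taps is an acquisition system. -/
lemma finiteMSE_mem_achievableMSE (h : IsTaskSetting μ x C s Γ u v)
    (hy : IsFilterOutput μ C x H y) {η fnyq fs : ℝ} (hη : 0 < η) {b : ℕ}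
    (hc : IsConfig η fnyq fs b) (S : Finset ℤ) (g : Fin N → Fin K → ℤ → ℝ) :
    finiteMSE μ C s u η fs b H y S g ∈ achievableMSE μ x C s v η fs b := by
  obtain ⟨γ, hγ⟩ := h.exists_isDynamicRange hy hc
  have hz := h.memLp_quantized hy hη hc.1 hγ
  -- The series is written with `G (-n)`, so the taps are reflected and extended by zero. The
  -- symmetric partial sums become constant as soon as their window contains `S`.
  refine ⟨H, y, γ, fun n i k => if -n ∈ S then g i k (-n) else 0,
    fun i => linComb S (g i) (quantized γ b (samples fs y) v), hy, hγ, fun i =>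
    ⟨memLp_linComb hz S (g i), ?_⟩, (h.mse_linComb hy hη hc hγ S g).symm⟩
  refine tendsto_const_nhds.congr' ?_
  obtain ⟨J₀, hJ₀⟩ : ∃ J₀ : ℕ, ∀ n ∈ S, |n| ≤ J₀ := by
    refine ⟨S.sup Int.natAbs, fun n hn => ?_⟩
    rw [Int.abs_eq_natAbs]
    exact_mod_cast Finset.le_sup (f := Int.natAbs) hn
  filter_upwards [eventually_ge_atTop J₀] with J hJ
  have hS : S ⊆ Finset.Icc (-(J : ℤ)) (J : ℤ) := fun n hn => by
    have h1 := abs_le.1 ((hJ₀ n hn).trans (by exact_mod_cast hJ : (J₀ : ℤ) ≤ J))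
    exact Finset.mem_Icc.2 h1
  have hzero : ∀ ω, (∑ n ∈ Finset.Icc (-(J : ℤ)) (J : ℤ), ∑ k, (if - -n ∈ S then g i k (- -n)
      else 0) * quantized γ b (samples fs y) v k n ω) -
      linComb S (g i) (quantized γ b (samples fs y) v) ω = 0 := by
    intro ω
    rw [sub_eq_zero, linComb, Finset.sum_comm]
    refine Finset.sum_congr rfl fun k _ => ?_
    simp only [neg_neg, ite_mul, zero_mul]
    rw [← Finset.sum_filter, Finset.filter_mem_eq_inter, Finset.inter_eq_right.2 hS]
  simp_rw [hzero]
  simp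

/-- The MSE of an acquisition system is approximated by truncating its digital filter. -/
lemma exists_finiteMSE_le (h : IsTaskSetting μ x C s Γ u v) {η fnyq fs : ℝ} (hη : 0 < η) {b : ℕ}
    (hc : IsConfig η fnyq fs b) {e : ℝ} (he : e ∈ achievableMSE μ x C s v η fs b) {ε : ℝ}
    (hε : 0 < ε) : ∃ (H : ℝ → Matrix (Fin K) (Fin M) ℂ) (y : Fin K → ℝ → Ω → ℝ) (S : Finset ℤ)
      (g : Fin N → Fin K → ℤ → ℝ), IsFilterOutput μ C x H y ∧
      finiteMSE μ C s u η fs b H y S g ≤ e + ε := by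
  obtain ⟨H, y, γ, G, shat, hy, hγ, hG, rfl⟩ := he
  have hz := h.memLp_quantized hy hη hc.1 hγ
  set Z : ℕ → Fin N → Ω → ℝ := fun J i =>
    linComb (Finset.Icc (-(J : ℤ)) J) (fun k n => G (-n) i k) (quantized γ b (samples fs y) v)
  have hZ : ∀ J i, MemLp (Z J i) 2 μ := fun J i => memLp_linComb hz _ _
  have hlim : Tendsto (fun J => mse μ s (Z J)) atTop (𝓝 (mse μ s shat)) := by
    unfold mse
    have hD : ∀ J i, MemLp (fun ω => s i ω - Z J i ω) 2 μ := fun J i =>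
      (h.task_memLp i).sub (hZ J i)
    have hD' : ∀ i, MemLp (fun ω => s i ω - shat i ω) 2 μ := fun i =>
      (h.task_memLp i).sub (hG i).1
    rw [integral_finsetSum _ fun i _ => (hD' i).integrable_sq]
    simp_rw [fun J => integral_finsetSum (μ := μ) Finset.univ
      fun i (_ : i ∈ Finset.univ) => (hD J i).integrable_sq]
    refine tendsto_finsetSum _ fun i _ => ?_
    have hl : Tendsto (fun J => eLpNorm (fun ω => (s i ω - Z J i ω) - (s i ω - shat i ω)) 2 μ)
        atTop (𝓝 0) := by
      refine (hG i).2.congr fun J => ?_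
      rw [← eLpNorm_neg]
      congr 1
      ext ω
      simp only [Pi.neg_apply, Z, linComb]
      rw [Finset.sum_comm]
      ring
    simpa only [sq] using tendsto_integral_mul_of_tendsto_eLpNorm (hD' i) (hD' i)
      (fun J => hD J i) (fun J => hD J i) hl hl
  obtain ⟨J, hJ⟩ := (hlim.eventually (gt_mem_nhds (lt_add_of_pos_right _ hε))).exists
  refine ⟨H, y, Finset.Icc (-(J : ℤ)) J, fun i k n => G (-n) i k, hy, ?_⟩
  rw [← h.mse_linComb hy hη hc hγ]
  exact hJ.le

end IsTaskSetting

end System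

end TaskADC

end

noncomputable section

namespace TaskADC

/-! ### Trigonometric polynomials -/

section Trigonometric

/-- The trigonometric polynomial with frequencies in `ℤ / T`. -/
def trigPoly (T : ℝ) (S : Finset ℤ) (c : ℤ → ℂ) (f : ℝ) : ℂ :=
  ∑ n ∈ S, c n * phase ((n : ℝ) * (1 / T)) f

lemma continuous_phase (t : ℝ) : Continuous (phase t) :=
  continuous_phase_uncurry.comp (Continuous.prodMk_right t)

lemma continuous_trigPoly (T : ℝ) (S : Finset ℤ) (c : ℤ → ℂ) : Continuous (trigPoly T S c) :=
  continuous_finsetSum _ fun _ _ => continuous_const.mul (continuous_phase _)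

lemma intervalIntegral_phase {T : ℝ} (hT : 0 < T) (n : ℤ) :
    ∫ f in (-T / 2)..(T / 2), phase ((n : ℝ) * (1 / T)) f = if n = 0 then (T : ℂ) else 0 := by
  split_ifs with hn
  · subst hn
    simp only [Int.cast_zero, zero_mul, phase_zero, intervalIntegral.integral_const]
    rw [Complex.real_smul]
    push_cast
    ring
  · have hT' : (T : ℂ) ≠ 0 := by exact_mod_cast hT.ne'
    have hc : (2 * Real.pi * Complex.I * (n / T) : ℂ) ≠ 0 :=
      mul_ne_zero Complex.two_pi_I_ne_zero (div_ne_zero (by exact_mod_cast hn) hT')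
    have e : ∀ f : ℝ, phase ((n : ℝ) * (1 / T)) f =
        Complex.exp ((2 * Real.pi * Complex.I * (n / T) : ℂ) * f) := fun f => by
      unfold phase; congr 1; push_cast; ring
    simp_rw [e]
    rw [integral_exp_mul_complex hc, div_eq_zero_iff]
    left
    rw [sub_eq_zero]
    have e2 : (2 * Real.pi * Complex.I * (n / T) : ℂ) * ((T / 2 : ℝ) : ℂ) =
        (2 * Real.pi * Complex.I * (n / T) : ℂ) * ((-T / 2 : ℝ) : ℂ) +
          n * (2 * Real.pi * Complex.I) := by
      push_cast
      field_simp
      ring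
    rw [e2, Complex.exp_add, Complex.exp_int_mul_two_pi_mul_I, mul_one]

/-- Parseval's identity for trigonometric polynomials. -/
lemma intervalIntegral_norm_sq_trigPoly {T : ℝ} (hT : 0 < T) (S : Finset ℤ) (c : ℤ → ℂ) :
    ∫ f in (-T / 2)..(T / 2), ‖trigPoly T S c f‖ ^ 2 = T * ∑ n ∈ S, ‖c n‖ ^ 2 := by
  have e : ∀ f, ((‖trigPoly T S c f‖ ^ 2 : ℝ) : ℂ) =
      ∑ n ∈ S, ∑ m ∈ S, (c n * star (c m)) * phase (((n - m : ℤ) : ℝ) * (1 / T)) f := by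
    intro f
    rw [Complex.ofReal_pow, ← Complex.mul_conj']
    simp only [← Complex.star_def, trigPoly, star_sum, Finset.sum_mul_sum, star_mul', star_phase]
    refine Finset.sum_congr rfl fun n _ => Finset.sum_congr rfl fun m _ => ?_
    rw [Int.cast_sub, sub_mul, sub_eq_add_neg ((n : ℝ) * (1 / T)), phase_add]
    ring
  have hi : ∀ n m : ℤ, IntervalIntegrable
      (fun f => (c n * star (c m)) * phase (((n - m : ℤ) : ℝ) * (1 / T)) f) volume
      (-T / 2) (T / 2) := fun n m =>
    (continuous_const.mul (continuous_phase _)).intervalIntegrable _ _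
  apply Complex.ofReal_injective
  rw [← intervalIntegral.integral_ofReal]
  simp_rw [e]
  have hi' : ∀ n : ℤ, IntervalIntegrable
      (fun f => ∑ m ∈ S, (c n * star (c m)) * phase (((n - m : ℤ) : ℝ) * (1 / T)) f) volume
      (-T / 2) (T / 2) := fun n =>
    (continuous_finsetSum _ fun m _ => continuous_const.mul
      (continuous_phase _)).intervalIntegrable _ _
  rw [intervalIntegral.integral_finsetSum fun n _ => hi' n]
  simp_rw [fun n => intervalIntegral.integral_finsetSum (s := S) fun m _ => hi n m,
    intervalIntegral.integral_const_mul, intervalIntegral_phase hT, sub_eq_zero]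
  push_cast
  rw [Finset.mul_sum]
  refine Finset.sum_congr rfl fun n hn => ?_
  simp only [mul_ite, mul_zero]
  rw [Finset.sum_ite_eq S n, if_pos hn, ← Complex.mul_conj', Complex.star_def]
  ring

lemma norm_add_sq_le (a b : ℂ) : ‖a + b‖ ^ 2 ≤ 2 * ‖a‖ ^ 2 + 2 * ‖b‖ ^ 2 := by
  have h := norm_add_le a b
  have h2 : ‖a + b‖ ^ 2 ≤ (‖a‖ + ‖b‖) ^ 2 := by gcongr
  nlinarith [sq_nonneg (‖a‖ - ‖b‖)]

/-- Trigonometric polynomials are dense in weighted `L²` spaces on a period. -/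
lemma exists_trigPoly_approx {T : ℝ} (hT : 0 < T) {W : ℝ → ℝ} (hW : Integrable W)
    (hW0 : ∀ f, 0 ≤ W f) {a : ℝ → ℂ} (ha : Continuous a) {ε : ℝ} (hε : 0 < ε) :
    ∃ (S : Finset ℤ) (c : ℤ → ℂ),
      ∫ f in Set.Ioc (-T / 2) (T / 2), (1 + W f) * ‖trigPoly T S c f - a f‖ ^ 2 ≤ ε := by
  have : Fact (0 < T) := ⟨hT⟩
  set I : Set ℝ := Set.Ioc (-T / 2) (T / 2) with hIdef
  have hI : I = Set.Ioc (-T / 2) (-T / 2 + T) := by rw [hIdef]; congr 1; ring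
  have hImeas : MeasurableSet I := measurableSet_Ioc
  -- The weight `1 + W` lets one approximation control two norms: the unweighted one, which governs
  -- tap energy, and the one weighted by signal power, which governs recovery error.
  set w : ℝ → ℝ := fun f => 1 + W f with hw
  have hw0 : ∀ f, 0 ≤ w f := fun f => add_nonneg zero_le_one (hW0 f)
  have hwI : IntegrableOn w I := (integrableOn_const (by simp [I])).add hW.integrableOn
  set ν : Measure ℝ := (volume.restrict I).withDensity fun f => ENNReal.ofReal (w f) with hν
  have : IsFiniteMeasure ν := isFiniteMeasure_withDensity_ofReal hwI.2
  have hint : ∀ g : ℝ → ℝ, ∫ f, g f ∂ν = ∫ f in I, w f * g f := by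
    intro g
    rw [hν, integral_withDensity_eq_integral_toReal_smul₀ hwI.1.aemeasurable.ennreal_ofReal
      (.of_forall fun _ => ENNReal.ofReal_lt_top)]
    refine integral_congr_ae (.of_forall fun f => ?_)
    simp only [smul_eq_mul]
    rw [ENNReal.toReal_ofReal (hw0 f)]
  have hcoe : Measurable ((↑) : ℝ → AddCircle T) := AddCircle.measurable_mk'
  set ν' : Measure (AddCircle T) := ν.map ((↑) : ℝ → AddCircle T) with hν'
  -- The target need not be periodic, so on the circle it may jump at the cut point. It is first
  -- approximated by a continuous function in `L²` of the weighted measure, and that function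
  -- uniformly by trigonometric polynomials.
  set A : AddCircle T → ℂ := AddCircle.liftIoc T (-T / 2) a with hA
  have hAm : Measurable A := by
    have : A = (fun z : Set.Ioc (-T / 2) (-T / 2 + T) => a z) ∘
      AddCircle.measurableEquivIoc T (-T / 2) := rfl
    rw [this]
    exact (ha.measurable.comp measurable_subtype_coe).comp (MeasurableEquiv.measurable _)
  have hAI : ∀ f ∈ I, A f = a f := fun f hf =>
    AddCircle.liftIoc_coe_apply (hI ▸ hf)
  have hAL : MemLp A (ENNReal.ofReal 2) ν' := by
    obtain ⟨B, hB⟩ := (isCompact_Icc (a := -T / 2) (b := T / 2)).exists_bound_of_continuousOn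
      ha.continuousOn
    refine MemLp.of_bound hAm.aestronglyMeasurable B (.of_forall fun z => ?_)
    set p := AddCircle.measurableEquivIoc T (-T / 2) z
    have : A z = a p := rfl
    rw [this]
    have hp : (p : ℝ) ∈ I := hI.symm.subset p.2
    exact hB _ ⟨hp.1.le, hp.2⟩
  set B : ℝ := ∫ f in I, w f with hB
  have hB0 : 0 ≤ B := integral_nonneg fun f => hw0 f
  obtain ⟨g, hg, hgL⟩ := hAL.exists_boundedContinuous_integral_rpow_sub_le two_pos
    (show 0 < ε / 4 by positivity)
  set g' : C(AddCircle T, ℂ) := g.toContinuousMap with hg'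
  -- The uniform error is integrated against total mass `B`, so it costs at most `ε / 4`, as does
  -- the `L²` error; splitting the square doubles both.
  set ε' : ℝ := ε / (4 * (B + 1)) with hε'
  have hε'0 : 0 < ε' := by positivity
  have hdense : g' ∈ (Submodule.span ℂ (Set.range (@fourier T))).topologicalClosure := by
    rw [span_fourier_closure_eq_top]; trivial
  obtain ⟨q, hq, hqd⟩ := Metric.mem_closure_iff.1 hdense (√ε') (Real.sqrt_pos.2 hε'0)
  obtain ⟨c, rfl⟩ := (Finsupp.mem_span_range_iff_exists_finsupp).1 hq
  refine ⟨c.support, c, ?_⟩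
  have hpoly : ∀ f : ℝ, (c.sum fun i b => b • @fourier T i) (f : AddCircle T) =
      trigPoly T c.support c f := by
    intro f
    rw [Finsupp.sum, ContinuousMap.coe_sum, Finset.sum_apply]
    refine Finset.sum_congr rfl fun n _ => ?_
    rw [ContinuousMap.coe_smul, Pi.smul_apply, fourier_coe_apply, smul_eq_mul]
    unfold phase
    congr 2
    push_cast
    ring
  have hclose : ∀ f : ℝ, ‖trigPoly T c.support c f - g f‖ ^ 2 ≤ ε' := by
    intro f
    rw [← hpoly, ← Real.sq_sqrt hε'0.le, norm_sub_rev]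
    have h1 : ‖g' f - (c.sum fun i b => b • @fourier T i) (f : AddCircle T)‖ ≤
        ‖g' - c.sum fun i b => b • @fourier T i‖ :=
      ContinuousMap.norm_coe_le_norm (g' - c.sum fun i b => b • @fourier T i) (f : AddCircle T)
    have h2 := h1.trans (dist_eq_norm g' _ ▸ hqd.le)
    exact pow_le_pow_left₀ (norm_nonneg _) h2 2
  have hgA : ∫ f in I, w f * ‖(g f : ℂ) - a f‖ ^ 2 ≤ ε / 4 := by
    refine le_trans (le_of_eq ?_) hg
    rw [hν', integral_map hcoe.aemeasurable, hint]
    · refine setIntegral_congr_fun hImeas fun f hf => ?_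
      rw [hAI f hf, norm_sub_rev]
      norm_num
    · exact ((hAm.sub g.continuous.measurable).norm.pow_const _).aestronglyMeasurable
  have hgc : Continuous fun f : ℝ => (g (f : AddCircle T) : ℂ) :=
    g.continuous.comp (AddCircle.continuous_mk' T)
  have hbddint : ∀ d : ℝ → ℂ, Continuous d → IntegrableOn (fun f => w f * ‖d f‖ ^ 2) I := by
    intro d hd
    obtain ⟨D, hD⟩ := (isCompact_Icc (a := -T / 2) (b := T / 2)).exists_bound_of_continuousOn
      (f := fun f => ‖d f‖ ^ 2) (hd.norm.pow 2).continuousOn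
    refine Integrable.mul_bdd (c := D) hwI (hd.norm.pow 2).aestronglyMeasurable ?_
    filter_upwards [ae_restrict_mem hImeas] with f hf
    exact hD f ⟨hf.1.le, hf.2⟩
  have i1 := hbddint (fun f => trigPoly T c.support c f - g f)
    ((continuous_trigPoly _ _ _).sub hgc)
  have i2 := hbddint (fun f => (g f : ℂ) - a f) (hgc.sub ha)
  calc ∫ f in I, w f * ‖trigPoly T c.support c f - a f‖ ^ 2
      ≤ ∫ f in I, (2 * (w f * ‖trigPoly T c.support c f - g f‖ ^ 2) +
          2 * (w f * ‖(g f : ℂ) - a f‖ ^ 2)) := by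
        refine integral_mono (hbddint _ ((continuous_trigPoly _ _ _).sub ha))
          ((i1.const_mul 2).add (i2.const_mul 2)) fun f => ?_
        have h1 := norm_add_sq_le (trigPoly T c.support c f - g f) ((g f : ℂ) - a f)
        rw [sub_add_sub_cancel] at h1
        have h2 := mul_le_mul_of_nonneg_left h1 (hw0 f)
        simp only
        linarith
    _ = 2 * (∫ f in I, w f * ‖trigPoly T c.support c f - g f‖ ^ 2) +
          2 * ∫ f in I, w f * ‖(g f : ℂ) - a f‖ ^ 2 := by
        rw [integral_add (i1.const_mul 2) (i2.const_mul 2), integral_const_mul,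
          integral_const_mul]
    _ ≤ 2 * (B * ε') + 2 * (ε / 4) := by
        gcongr
        rw [hB, ← integral_mul_const]
        exact integral_mono i1 (hwI.mul_const ε') fun f =>
          mul_le_mul_of_nonneg_left (hclose f) (hw0 f)
    _ ≤ ε := by
        have : B * ε' ≤ ε / 4 := by
          rw [hε', mul_div_assoc', div_le_div_iff₀ (by positivity) (by norm_num)]
          nlinarith
        linarith

end Trigonometric

end TaskADC

end

noncomputable section

namespace TaskADC

/-! ### Resampling -/

section Resampling

variable {Ω : Type*} [MeasurableSpace Ω] {μ : Measure Ω} {M N K : ℕ}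
  {C : ℝ → Matrix (Fin M) (Fin M) ℂ} {x : Fin M → ℝ → Ω → ℝ}

lemma SpectralFamily.comp {ι κ : Type*} {X : ι → Ω → ℝ} {a : ι → ℝ → Fin M → ℂ}
    (h : SpectralFamily μ C X a) (e : κ → ι) :
    SpectralFamily μ C (fun k => X (e k)) (fun k => a (e k)) :=
  ⟨fun k => h.memLp (e k), fun k => h.measurable (e k), fun k => h.integrable (e k),
    fun k l => h.inner (e k) (e l)⟩

lemma add_sq_le_weighted (p q : ℝ) {r : ℝ} (hr : 0 < r) :
    (p + q) ^ 2 ≤ (1 + r) * p ^ 2 + (1 + r⁻¹) * q ^ 2 := by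
  have h : (1 + r) * p ^ 2 + (1 + r⁻¹) * q ^ 2 - (p + q) ^ 2 = r⁻¹ * (r * p - q) ^ 2 := by
    field_simp
    ring
  have := mul_nonneg (inv_nonneg.2 hr.le) (sq_nonneg (r * p - q))
  linarith

/-- First `r` is chosen so that `r * A ≤ ε / 2`, then `δ` small enough to absorb the large factor `1
+ r⁻¹`. It turns a small perturbation in norm into a small perturbation of the square. -/
lemma exists_weights {A ε : ℝ} (hA : 0 ≤ A) (hε : 0 < ε) :
    ∃ r > 0, ∃ δ > 0, (1 + r) * A + (1 + r⁻¹) * δ ≤ A + ε := by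
  have hr : 0 < ε / (2 * (A + 1)) := by positivity
  refine ⟨_, hr, ε / (2 * (1 + (ε / (2 * (A + 1)))⁻¹)), by positivity, ?_⟩
  set r := ε / (2 * (A + 1)) with hrd
  have h1 : r * A ≤ ε / 2 := by
    rw [hrd, div_mul_eq_mul_div, div_le_div_iff₀ (by positivity) (by norm_num)]
    nlinarith
  have h2 : (1 + r⁻¹) * (ε / (2 * (1 + r⁻¹))) = ε / 2 := by
    have : (1 + r⁻¹) ≠ 0 := by positivity
    field_simp
  linarith

/-- Samples of one channel taken at the rate `fs` are, up to a small error, filtered samples taken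
at a lower rate `fs'` that still exceeds the Nyquist rate. -/
lemma IsFilterOutput.exists_resampled [IsFiniteMeasure μ] {H : ℝ → Matrix (Fin K) (Fin M) ℂ}
    {y : Fin K → ℝ → Ω → ℝ} (hy : IsFilterOutput μ C x H y) (hx : IsWSSWithPSD μ x C)
    (k : Fin K) {fs fs' : ℝ} (h0 : 0 < fs') (hle : fs' ≤ fs)
    (hband : ∀ f : ℝ, fs' / 2 < |f| → C f = 0) (S : Finset ℤ) (g : ℤ → ℝ) {ε : ℝ} (hε : 0 < ε) :
    ∃ (S' : Finset ℤ) (c : ℤ → ℝ), (∀ n ∉ S', c n = 0) ∧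
      ∫ ω, (∑ n ∈ S', c n * samples fs' y k n ω - ∑ n ∈ S, g n * samples fs y k n ω) ^ 2 ∂μ ≤ ε ∧
      ∑ n ∈ S', c n ^ 2 ≤ fs' / fs * ∑ n ∈ S, g n ^ 2 + ε := by
  classical
  have hfs : 0 < fs := h0.trans_le hle
  set G := ∑ n ∈ S, g n ^ 2 with hG
  have hG0 : 0 ≤ G := Finset.sum_nonneg fun _ _ => sq_nonneg _
  obtain ⟨r, hr, δ, hδ, hrδ⟩ := exists_weights (A := fs' / fs * G) (by positivity) hε
  set W : ℝ → ℝ := fun f => (specForm (C f) (H f k) (H f k)).re with hW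
  have hWi : Integrable W := hy.integrable_power hx k
  have hW0 : ∀ f, 0 ≤ W f := fun f => specForm_self_re_nonneg (hx.psd_posSemidef f) _
  set a₀ : ℝ → ℂ := trigPoly fs S (fun n => (g n : ℂ)) with ha₀
  have ha₀c : Continuous a₀ := continuous_trigPoly _ _ _
  -- The factor `fs' / fs` compensates for the normalization of the samples by `1 / fs'` instead of
  -- `1 / fs`. On the shorter band `a` is the ideal new digital response.
  set a : ℝ → ℂ := fun f => ((fs' / fs : ℝ) : ℂ) * a₀ f with ha
  have hac : Continuous a := continuous_const.mul ha₀c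
  -- The two bounds in the minimum serve the tap energy and the recovery error respectively.
  obtain ⟨S', c, hc⟩ := exists_trigPoly_approx h0 hWi hW0 hac
    (show 0 < min (δ * fs') (ε * fs' ^ 2) by positivity)
  set p : ℝ → ℂ := trigPoly fs' S' c with hp
  have hpc : Continuous p := continuous_trigPoly _ _ _
  set I : Set ℝ := Set.Ioc (-fs' / 2) (fs' / 2) with hI
  have hbdd : ∀ d : ℝ → ℂ, Continuous d → ∀ w : ℝ → ℝ, IntegrableOn w I →
      IntegrableOn (fun f => w f * ‖d f‖ ^ 2) I := by
    intro d hd w hw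
    obtain ⟨D, hD⟩ := (isCompact_Icc (a := -fs' / 2) (b := fs' / 2)).exists_bound_of_continuousOn
      (f := fun f => ‖d f‖ ^ 2) (hd.norm.pow 2).continuousOn
    refine Integrable.mul_bdd (c := D) hw (hd.norm.pow 2).aestronglyMeasurable ?_
    filter_upwards [ae_restrict_mem measurableSet_Ioc] with f hf
    exact hD f ⟨hf.1.le, hf.2⟩
  have hone : IntegrableOn (fun _ : ℝ => (1 : ℝ)) I := integrableOn_const (by simp [I])
  have hi1 : IntegrableOn (fun f => (1 + W f) * ‖p f - a f‖ ^ 2) I :=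
    hbdd _ (hpc.sub hac) _ (hone.add hWi.integrableOn)
  have hsq : ∀ d : ℝ → ℂ, Continuous d → IntegrableOn (fun f => ‖d f‖ ^ 2) I := fun d hd => by
    simpa using hbdd d hd _ hone
  refine ⟨S', fun n => if n ∈ S' then (c n).re else 0, fun n hn => if_neg hn, ?_, ?_⟩
  -- The approximation gives complex taps; only their real parts are used, which does not increase
  -- the error by `integral_sq_sum_re_le`. The difference of the two combinations has response `(1 /
  -- fs') (p - a) H`.
  · have hfam := (hy.spectralFamily hy hx).comp (fun n : ℤ ⊕ ℤ => Sum.inr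
      (k, Sum.elim (fun n : ℤ => (n : ℝ) * (1 / fs')) (fun n : ℤ => (n : ℝ) * (1 / fs)) n))
    have h1 := hfam.integral_sq_sum_re_le hx.psd_posSemidef hx.aestronglyMeasurable_psd
      (S'.disjSum S) (Sum.elim (fun n => c n * ((1 / fs' : ℝ) : ℂ))
        (fun n => ((-(g n * (1 / fs)) : ℝ) : ℂ)))
    simp only [Finset.sum_disjSum, Sum.elim_inl, Sum.elim_inr, Complex.re_mul_ofReal,
      Complex.ofReal_re] at h1
    have h2 : ∀ f, (specForm (C f)
        (∑ n ∈ S', (c n * ((1 / fs' : ℝ) : ℂ)) • phase ((n : ℝ) * (1 / fs')) f • H f k +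
          ∑ n ∈ S, ((-(g n * (1 / fs)) : ℝ) : ℂ) • phase ((n : ℝ) * (1 / fs)) f • H f k)
        (∑ n ∈ S', (c n * ((1 / fs' : ℝ) : ℂ)) • phase ((n : ℝ) * (1 / fs')) f • H f k +
          ∑ n ∈ S, ((-(g n * (1 / fs)) : ℝ) : ℂ) • phase ((n : ℝ) * (1 / fs)) f • H f k)).re =
        (1 / fs') ^ 2 * (W f * ‖p f - a f‖ ^ 2) := by
      intro f
      have e : ∑ n ∈ S', (c n * ((1 / fs' : ℝ) : ℂ)) • phase ((n : ℝ) * (1 / fs')) f • H f k +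
          ∑ n ∈ S, ((-(g n * (1 / fs)) : ℝ) : ℂ) • phase ((n : ℝ) * (1 / fs)) f • H f k =
          (((1 / fs' : ℝ) : ℂ) * (p f - a f)) • H f k := by
        simp only [smul_smul, ← Finset.sum_smul, ← add_smul]
        congr 1
        simp only [hp, ha, ha₀, trigPoly]
        rw [mul_sub, sub_eq_add_neg, Finset.mul_sum, ← mul_assoc, ← Complex.ofReal_mul,
          show 1 / fs' * (fs' / fs) = 1 / fs by field_simp, Finset.mul_sum,
          ← Finset.sum_neg_distrib]
        congr 1
        · exact Finset.sum_congr rfl fun n _ => by ring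
        · refine Finset.sum_congr rfl fun n _ => ?_
          rw [Complex.ofReal_neg, Complex.ofReal_mul]
          ring
      rw [e, specForm_smul_left, specForm_smul_right, ← mul_assoc, Complex.star_def,
        Complex.mul_conj', norm_mul, Complex.norm_real, Real.norm_eq_abs, ← Complex.ofReal_pow,
        Complex.re_ofReal_mul, mul_pow, sq_abs]
      ring
    have h3 : ∫ ω, (∑ n ∈ S', (if n ∈ S' then (c n).re else 0) * samples fs' y k n ω -
        ∑ n ∈ S, g n * samples fs y k n ω) ^ 2 ∂μ ≤
        ∫ f, (1 / fs') ^ 2 * (W f * ‖p f - a f‖ ^ 2) := by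
      simp_rw [← h2]
      refine le_trans (le_of_eq ?_) h1
      refine integral_congr_ae (.of_forall fun ω => ?_)
      simp only [samples]
      rw [sub_eq_add_neg, ← Finset.sum_neg_distrib]
      congr 2
      · refine Finset.sum_congr rfl fun n hn => ?_
        rw [if_pos hn]
        ring
      · exact Finset.sum_congr rfl fun n _ => by ring
    refine h3.trans ?_
    rw [integral_const_mul]
    -- The band limit confines the integral to one period. The closed interval is used because the
    -- PSD may be nonzero at the endpoints.
    have h4 : ∫ f, W f * ‖p f - a f‖ ^ 2 = ∫ f in I, W f * ‖p f - a f‖ ^ 2 := by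
      rw [hI, ← integral_Icc_eq_integral_Ioc, setIntegral_eq_integral_of_forall_compl_eq_zero]
      intro f hf
      have : fs' / 2 < |f| := by
        by_contra! hle'
        rw [abs_le] at hle'
        exact hf ⟨by linarith [hle'.1], hle'.2⟩
      simp [hW, hband f this, specForm_zero_matrix]
    have h5 : ∫ f in I, W f * ‖p f - a f‖ ^ 2 ≤ ∫ f in I, (1 + W f) * ‖p f - a f‖ ^ 2 := by
      refine integral_mono (hbdd _ (hpc.sub hac) _ hWi.integrableOn) hi1 fun f => ?_
      exact mul_le_mul_of_nonneg_right (by linarith) (sq_nonneg _)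
    calc (1 / fs') ^ 2 * ∫ f, W f * ‖p f - a f‖ ^ 2
        ≤ (1 / fs') ^ 2 * (ε * fs' ^ 2) := by
          rw [h4]
          exact mul_le_mul_of_nonneg_left (h5.trans (hc.trans (min_le_right _ _))) (by positivity)
      _ = ε := by field_simp
  · have hIoc : ∀ F : ℝ → ℝ, ∫ f in I, F f = ∫ f in (-fs' / 2)..(fs' / 2), F f := fun F => by
      rw [intervalIntegral.integral_of_le (by linarith)]
    have e1 : ∫ f in I, ‖p f‖ ^ 2 = fs' * ∑ n ∈ S', ‖c n‖ ^ 2 := by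
      rw [hIoc, hp, intervalIntegral_norm_sq_trigPoly h0]
    -- Here the energy gain arises: Parseval over the full period `fs` bounds the integral over the
    -- shorter band, and of the two factors `fs' / fs` one is absorbed by the length of the new
    -- period.
    have e2 : ∫ f in I, ‖a f‖ ^ 2 ≤ fs' * (fs' / fs * G) := by
      have e3 : ∫ f in Set.Ioc (-fs / 2) (fs / 2), ‖a₀ f‖ ^ 2 = fs * G := by
        rw [← intervalIntegral.integral_of_le (by linarith), ha₀,
          intervalIntegral_norm_sq_trigPoly hfs]
        simp [hG]
      have e4 : ∫ f in I, ‖a₀ f‖ ^ 2 ≤ ∫ f in Set.Ioc (-fs / 2) (fs / 2), ‖a₀ f‖ ^ 2 := by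
        refine setIntegral_mono_set ?_ (.of_forall fun f => sq_nonneg _)
          (Set.Ioc_subset_Ioc (by linarith) (by linarith)).eventuallyLE
        exact ((ha₀c.norm.pow 2).integrableOn_Icc).mono_set Set.Ioc_subset_Icc_self
      simp only [ha, norm_mul, mul_pow, Complex.norm_real, Real.norm_eq_abs, sq_abs]
      rw [integral_const_mul]
      calc (fs' / fs) ^ 2 * ∫ f in I, ‖a₀ f‖ ^ 2 ≤ (fs' / fs) ^ 2 * (fs * G) :=
            mul_le_mul_of_nonneg_left (e4.trans e3.le) (by positivity)
        _ = fs' * (fs' / fs * G) := by field_simp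
    have e5 : ∫ f in I, ‖p f - a f‖ ^ 2 ≤ δ * fs' := by
      refine le_trans ?_ (hc.trans (min_le_left _ _))
      refine integral_mono (hsq _ (hpc.sub hac)) hi1 fun f => ?_
      have := mul_nonneg (hW0 f) (sq_nonneg ‖p f - a f‖)
      simp only
      linarith
    have hpa : IntegrableOn (fun f => ‖p f - a f‖ ^ 2) I := hsq _ (hpc.sub hac)
    have e6 : ∫ f in I, ‖p f‖ ^ 2 ≤ (1 + r) * (∫ f in I, ‖a f‖ ^ 2) +
        (1 + r⁻¹) * ∫ f in I, ‖p f - a f‖ ^ 2 := by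
      rw [← integral_const_mul, ← integral_const_mul,
        ← integral_add ((hsq _ hac).const_mul _) (hpa.const_mul _)]
      refine integral_mono (hsq _ hpc)
        (((hsq _ hac).const_mul _).add (hpa.const_mul _)) fun f => ?_
      have h1 : ‖p f‖ ≤ ‖a f‖ + ‖p f - a f‖ := by
        simpa using norm_add_le (a f) (p f - a f)
      calc ‖p f‖ ^ 2 ≤ (‖a f‖ + ‖p f - a f‖) ^ 2 := by gcongr
        _ ≤ _ := add_sq_le_weighted _ _ hr
    have e7 : fs' * ∑ n ∈ S', ‖c n‖ ^ 2 ≤ fs' * (fs' / fs * G + ε) := by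
      rw [← e1]
      calc ∫ f in I, ‖p f‖ ^ 2 ≤ (1 + r) * (fs' * (fs' / fs * G)) + (1 + r⁻¹) * (δ * fs') :=
            e6.trans (add_le_add (mul_le_mul_of_nonneg_left e2 (by positivity))
              (mul_le_mul_of_nonneg_left e5 (by positivity)))
        _ = fs' * ((1 + r) * (fs' / fs * G) + (1 + r⁻¹) * δ) := by ring
        _ ≤ _ := mul_le_mul_of_nonneg_left hrδ h0.le
    refine le_trans (Finset.sum_le_sum fun n hn => ?_) (le_of_mul_le_mul_left e7 h0)
    simp only [if_pos hn]
    rw [← sq_abs]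
    exact pow_le_pow_left₀ (abs_nonneg _) (Complex.abs_re_le_norm _) 2

/-- Resampling of a system with finitely many taps. -/
lemma IsFilterOutput.exists_resampled_system [IsFiniteMeasure μ]
    {H : ℝ → Matrix (Fin K) (Fin M) ℂ}
    {y : Fin K → ℝ → Ω → ℝ} (hy : IsFilterOutput μ C x H y) (hx : IsWSSWithPSD μ x C)
    {u : Fin N → ℝ → Ω → ℝ} (hu : ∀ i, MemLp (u i 0) 2 μ)
    {fs fs' : ℝ} (h0 : 0 < fs') (hle : fs' ≤ fs)
    (hband : ∀ f : ℝ, fs' / 2 < |f| → C f = 0) (S : Finset ℤ) (g : Fin N → Fin K → ℤ → ℝ)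
    {ε : ℝ} (hε : 0 < ε) :
    ∃ (S' : Finset ℤ) (g' : Fin N → Fin K → ℤ → ℝ),
      recoveryError μ u fs' y S' g' ≤ recoveryError μ u fs y S g + ε ∧
      tapEnergy S' g' ≤ fs' / fs * tapEnergy S g + ε := by
  classical
  have hA0 : 0 ≤ recoveryError μ u fs y S g :=
    Finset.sum_nonneg fun _ _ => integral_nonneg fun _ => sq_nonneg _
  obtain ⟨r, hr, δ, hδ, hrδ⟩ := exists_weights hA0 hε
  -- Cauchy-Schwarz over channels makes the squared error at most `K * K * ε₁` for each of `N`
  -- outputs, and the energies add `N * K * ε₁`. The increments by one keep the divisors positive.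
  set ε₁ := min (δ / ((N + 1) * (K + 1) ^ 2)) (ε / ((N + 1) * (K + 1))) with hε₁
  have hε₁0 : 0 < ε₁ := by positivity
  have hex := fun (i : Fin N) (k : Fin K) =>
    hy.exists_resampled hx k h0 hle hband S (g i k) hε₁0
  choose S₁ c hc0 hcd hce using hex
  set S' : Finset ℤ := Finset.univ.biUnion fun i => Finset.univ.biUnion fun k => S₁ i k with hS'
  have hsub : ∀ i k, S₁ i k ⊆ S' := fun i k n hn =>
    Finset.mem_biUnion.2 ⟨i, Finset.mem_univ _, Finset.mem_biUnion.2 ⟨k, Finset.mem_univ _, hn⟩⟩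
  -- All outputs and channels must share one tap window, so each family of taps, zero off its own
  -- window, is extended to the union.
  have hext : ∀ i k (F : ℤ → ℝ → ℝ), (∀ n, F n 0 = 0) →
      ∑ n ∈ S', F n (c i k n) = ∑ n ∈ S₁ i k, F n (c i k n) := fun i k F hF =>
    (Finset.sum_subset (hsub i k) fun n _ hn => by rw [hc0 i k n hn, hF]).symm
  refine ⟨S', c, ?_, ?_⟩
  · have hY := fun i => memLp_linComb (memLp_samples hy fs) S (g i)
    have hY' := fun i => memLp_linComb (memLp_samples hy fs') S' (c i)
    have hdist : ∀ i, ∫ ω, (linComb S (g i) (samples fs y) ω -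
        linComb S' (c i) (samples fs' y) ω) ^ 2 ∂μ ≤ K * (K * ε₁) := by
      intro i
      set d : Fin K → Ω → ℝ := fun k ω => ∑ n ∈ S₁ i k, c i k n * samples fs' y k n ω -
        ∑ n ∈ S, g i k n * samples fs y k n ω with hd
      have hdL : ∀ k, MemLp (d k) 2 μ := fun k =>
        (memLp_finsetSum _ fun n _ => (memLp_samples hy fs' k n).const_mul _).sub
          (memLp_finsetSum _ fun n _ => (memLp_samples hy fs k n).const_mul _)
      have h1 : ∀ ω, (linComb S (g i) (samples fs y) ω -
          linComb S' (c i) (samples fs' y) ω) ^ 2 ≤ K * ∑ k, d k ω ^ 2 := by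
        intro ω
        have e : linComb S (g i) (samples fs y) ω - linComb S' (c i) (samples fs' y) ω =
            -∑ k, d k ω := by
          simp only [linComb, hd, Finset.sum_sub_distrib, neg_sub]
          congr 1
          exact Finset.sum_congr rfl fun k _ =>
            hext i k (fun n t => t * samples fs' y k n ω) fun n => zero_mul _
        rw [e, neg_sq]
        simpa using sq_sum_le_card_mul_sum_sq (s := Finset.univ) (f := fun k => d k ω)
      calc ∫ ω, (linComb S (g i) (samples fs y) ω - linComb S' (c i) (samples fs' y) ω) ^ 2 ∂μ
          ≤ ∫ ω, K * ∑ k, d k ω ^ 2 ∂μ :=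
            integral_mono ((hY i).sub (hY' i)).integrable_sq
              ((integrable_finsetSum _ fun k _ => (hdL k).integrable_sq).const_mul _) h1
        _ = K * ∑ k, ∫ ω, d k ω ^ 2 ∂μ := by
            rw [integral_const_mul, integral_finsetSum _ fun k _ => (hdL k).integrable_sq]
        _ ≤ K * ∑ _k : Fin K, ε₁ := by
            gcongr with k
            exact hcd i k
        _ = K * (K * ε₁) := by simp
    have hstep : ∀ i, ∫ ω, (u i 0 ω - linComb S' (c i) (samples fs' y) ω) ^ 2 ∂μ ≤
        (1 + r) * ∫ ω, (u i 0 ω - linComb S (g i) (samples fs y) ω) ^ 2 ∂μ +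
        (1 + r⁻¹) * (K * (K * ε₁)) := by
      intro i
      have hU : MemLp (fun ω => u i 0 ω - linComb S (g i) (samples fs y) ω) 2 μ := (hu i).sub (hY i)
      have hD : MemLp (fun ω => linComb S (g i) (samples fs y) ω -
        linComb S' (c i) (samples fs' y) ω) 2 μ := (hY i).sub (hY' i)
      have h1 : ∫ ω, (u i 0 ω - linComb S' (c i) (samples fs' y) ω) ^ 2 ∂μ ≤
          (1 + r) * ∫ ω, (u i 0 ω - linComb S (g i) (samples fs y) ω) ^ 2 ∂μ +
          (1 + r⁻¹) * ∫ ω, (linComb S (g i) (samples fs y) ω -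
            linComb S' (c i) (samples fs' y) ω) ^ 2 ∂μ := by
        rw [← integral_const_mul, ← integral_const_mul, ← integral_add
          (hU.integrable_sq.const_mul _) (hD.integrable_sq.const_mul _)]
        refine integral_mono ((hu i).sub (hY' i)).integrable_sq
          ((hU.integrable_sq.const_mul _).add (hD.integrable_sq.const_mul _)) fun ω => ?_
        have := add_sq_le_weighted (u i 0 ω - linComb S (g i) (samples fs y) ω)
          (linComb S (g i) (samples fs y) ω - linComb S' (c i) (samples fs' y) ω) hr
        rwa [sub_add_sub_cancel] at this
      exact h1.trans (add_le_add le_rfl (mul_le_mul_of_nonneg_left (hdist i) (by positivity)))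
    have hsmall : (N : ℝ) * (K * (K * ε₁)) ≤ δ := by
      have h1 : ε₁ * ((N + 1) * (K + 1) ^ 2) ≤ δ := by
        rw [← le_div_iff₀ (by positivity)]
        exact min_le_left _ _
      refine le_trans ?_ h1
      have h2 : (N : ℝ) * K ^ 2 ≤ (N + 1) * (K + 1) ^ 2 := by
        gcongr <;> linarith
      nlinarith
    calc recoveryError μ u fs' y S' c
        ≤ ∑ i, ((1 + r) * ∫ ω, (u i 0 ω - linComb S (g i) (samples fs y) ω) ^ 2 ∂μ +
          (1 + r⁻¹) * (K * (K * ε₁))) := Finset.sum_le_sum fun i _ => hstep i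
      _ = (1 + r) * recoveryError μ u fs y S g + (1 + r⁻¹) * (N * (K * (K * ε₁))) := by
          rw [Finset.sum_add_distrib, ← Finset.mul_sum, recoveryError]
          simp
          ring
      _ ≤ (1 + r) * recoveryError μ u fs y S g + (1 + r⁻¹) * δ :=
          add_le_add le_rfl (mul_le_mul_of_nonneg_left hsmall (by positivity))
      _ ≤ _ := hrδ
  · have h1 : tapEnergy S' c ≤ ∑ i : Fin N, ∑ k : Fin K,
        (fs' / fs * ∑ n ∈ S, g i k n ^ 2 + ε₁) := by
      refine Finset.sum_le_sum fun i _ => Finset.sum_le_sum fun k _ => ?_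
      rw [hext i k (fun _ t => t ^ 2) fun n => by simp]
      exact hce i k
    refine h1.trans ?_
    simp only [Finset.sum_add_distrib, ← Finset.mul_sum, Finset.sum_const, Finset.card_univ,
      Fintype.card_fin, nsmul_eq_mul]
    refine add_le_add le_rfl ?_
    have h2 : ε₁ * ((N + 1) * (K + 1)) ≤ ε := by
      rw [← le_div_iff₀ (by positivity)]
      exact min_le_right _ _
    have h3 : (N : ℝ) * K ≤ (N + 1) * (K + 1) := by
      gcongr <;> linarith
    nlinarith

end Resampling

end TaskADC

end

noncomputable section

namespace TaskADC

/-! ### A lower bound for the recovery error -/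

section LowerBound

variable {Ω : Type*} [MeasurableSpace Ω] {μ : Measure Ω} {M N K : ℕ}

lemma sqrt_specForm_add_le {A : Matrix (Fin M) (Fin M) ℂ} (hA : A.PosSemidef)
    (a b : Fin M → ℂ) : √(specForm A (a + b) (a + b)).re ≤
      √(specForm A a a).re + √(specForm A b b).re := by
  refine Real.sqrt_le_iff.2 ⟨by positivity, ?_⟩
  have h1 := (Complex.re_le_norm _).trans (norm_specForm_le hA a b)
  have h2 := (Complex.re_le_norm _).trans (norm_specForm_le hA b a)
  have ha := Real.sq_sqrt (specForm_self_re_nonneg hA a)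
  have hb := Real.sq_sqrt (specForm_self_re_nonneg hA b)
  simp only [specForm_add_left, specForm_add_right, Complex.add_re]
  nlinarith

lemma sqrt_specForm_smul {A : Matrix (Fin M) (Fin M) ℂ} (c : ℂ) (a : Fin M → ℂ) :
    √(specForm A (c • a) (c • a)).re = ‖c‖ * √(specForm A a a).re := by
  rw [specForm_smul_left, specForm_smul_right, ← mul_assoc, Complex.star_def, Complex.mul_conj',
    ← Complex.ofReal_pow, Complex.re_ofReal_mul, Real.sqrt_mul (by positivity),
    Real.sqrt_sq (norm_nonneg _)]

lemma sqrt_specForm_sum_le {A : Matrix (Fin M) (Fin M) ℂ} (hA : A.PosSemidef) {ι : Type*}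
    (F : Finset ι) (c : ι → ℂ) (a : ι → Fin M → ℂ) :
    √(specForm A (∑ i ∈ F, c i • a i) (∑ i ∈ F, c i • a i)).re ≤
      ∑ i ∈ F, ‖c i‖ * √(specForm A (a i) (a i)).re := by
  classical
  induction F using Finset.induction_on with
  | empty => simp [specForm]
  | insert i F hi ih =>
    rw [Finset.sum_insert hi, Finset.sum_insert hi]
    refine (sqrt_specForm_add_le hA _ _).trans ?_
    rw [sqrt_specForm_smul]
    exact add_le_add le_rfl ih

/-- The triangle inequality for the seminorm applied to `d = (d - b) + b`. Capping at `B` makes the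
cross term at most `2 * √B` times the seminorm bound for `b`, and the arithmetic-geometric
inequality separates the digital gains `c i` from the analog powers of `a i`. Without the cap, an
unbounded power spectrum of the target would prevent a bound by tap energy. -/
lemma min_specForm_le {A : Matrix (Fin M) (Fin M) ℂ} (hA : A.PosSemidef) {ι : Type*}
    (F : Finset ι) (c : ι → ℂ) (a : ι → Fin M → ℂ) (d : Fin M → ℂ) {B l : ℝ} (hB : 0 ≤ B)
    (hl : 0 < l) :
    min (specForm A d d).re B ≤
      (specForm A (d - ∑ i ∈ F, c i • a i) (d - ∑ i ∈ F, c i • a i)).re +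
        ∑ i ∈ F, (l * B * ‖c i‖ ^ 2 + l⁻¹ * (specForm A (a i) (a i)).re) := by
  set b := ∑ i ∈ F, c i • a i with hb
  have hU0 := specForm_self_re_nonneg hA d
  set V := min (specForm A d d).re B with hV
  have hV0 : 0 ≤ V := le_min hU0 hB
  set α := √(specForm A (d - b) (d - b)).re with hα
  have hα0 : 0 ≤ α := Real.sqrt_nonneg _
  rw [← Real.sq_sqrt (specForm_self_re_nonneg hA (d - b)), ← hα]
  set T := ∑ i ∈ F, ‖c i‖ * √(specForm A (a i) (a i)).re with hT
  have hT0 : 0 ≤ T := Finset.sum_nonneg fun _ _ => by positivity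
  have h1 : √V ≤ α + T := by
    refine (Real.sqrt_le_sqrt (min_le_left _ _)).trans ?_
    have := sqrt_specForm_add_le hA (d - b) b
    rw [sub_add_cancel] at this
    exact this.trans (add_le_add le_rfl (sqrt_specForm_sum_le hA F c a))
  have h2 : V ≤ α ^ 2 + 2 * √B * T := by
    have hVB : √V ≤ √B := Real.sqrt_le_sqrt (min_le_right _ _)
    -- If `√V ≤ T`, then `V ≤ √V * T`; otherwise `(√V - T)² ≤ α²` is expanded.
    have h3 : V ≤ α ^ 2 + 2 * √V * T := by
      have hs := Real.sq_sqrt hV0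
      have hs0 := Real.sqrt_nonneg V
      rcases le_total (√V) T with h | h
      · nlinarith
      · nlinarith [mul_self_le_mul_self (sub_nonneg.2 h) (show √V - T ≤ α by linarith)]
    refine h3.trans (add_le_add le_rfl ?_)
    exact mul_le_mul_of_nonneg_right (by linarith) hT0
  refine h2.trans (add_le_add le_rfl ?_)
  rw [hT, Finset.mul_sum]
  refine Finset.sum_le_sum fun i _ => ?_
  have hW := Real.sq_sqrt (specForm_self_re_nonneg hA (a i))
  have hBs := Real.sq_sqrt hB
  set w := √(specForm A (a i) (a i)).re
  rw [← hW, ← hBs, Real.sqrt_sq (Real.sqrt_nonneg B)]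
  have e : l * √B ^ 2 * ‖c i‖ ^ 2 + l⁻¹ * w ^ 2 - 2 * √B * (‖c i‖ * w) =
      l⁻¹ * (l * √B * ‖c i‖ - w) ^ 2 := by
    field_simp
    ring
  have := mul_nonneg (inv_nonneg.2 hl.le) (sq_nonneg (l * √B * ‖c i‖ - w))
  linarith

variable {C : ℝ → Matrix (Fin M) (Fin M) ℂ} {x : Fin M → ℝ → Ω → ℝ}
  {Γ : ℝ → Matrix (Fin N) (Fin M) ℂ} {u : Fin N → ℝ → Ω → ℝ}
  {H : ℝ → Matrix (Fin K) (Fin M) ℂ} {y : Fin K → ℝ → Ω → ℝ}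

/-- Sampling and digital filtering combine into time shifts of each channel, so channel `k`
contributes the response `(1 / fs) * trigPoly * H k`; the target at time zero carries phase one. -/
lemma integral_sq_sub_linComb_eq [IsFiniteMeasure μ] (hu : IsFilterOutput μ C x Γ u)
    (hy : IsFilterOutput μ C x H y) (hx : IsWSSWithPSD μ x C) (fs : ℝ) (i : Fin N) (S : Finset ℤ)
    (g : Fin K → ℤ → ℝ) :
    Integrable (fun f => (specForm (C f)
      (Γ f i - ∑ k, (((1 / fs : ℝ) : ℂ) * trigPoly fs S (fun n => (g k n : ℂ)) f) • H f k)
      (Γ f i - ∑ k, (((1 / fs : ℝ) : ℂ) * trigPoly fs S (fun n => (g k n : ℂ)) f) • H f k)).re) ∧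
    ∫ ω, (u i 0 ω - linComb S g (samples fs y) ω) ^ 2 ∂μ = ∫ f, (specForm (C f)
      (Γ f i - ∑ k, (((1 / fs : ℝ) : ℂ) * trigPoly fs S (fun n => (g k n : ℂ)) f) • H f k)
      (Γ f i - ∑ k, (((1 / fs : ℝ) : ℂ) * trigPoly fs S (fun n => (g k n : ℂ)) f) • H f k)).re := by
  have hfam := ((hu.spectralFamily hy hx).comp (Sum.elim (fun _ : Unit => Sum.inl (i, 0))
    (fun p : Fin K × ℤ => Sum.inr (p.1, (p.2 : ℝ) * (1 / fs))))).sum hx.psd_posSemidef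
      hx.aestronglyMeasurable_psd (Finset.univ.disjSum (Finset.univ ×ˢ S))
      (fun (_ : Unit) => Sum.elim (fun _ => 1) fun p => -(1 / fs * g p.1 p.2))
  have e1 : ∀ f, ∑ j ∈ Finset.univ.disjSum (Finset.univ ×ˢ S),
      ((Sum.elim (fun _ => 1) (fun p => -(1 / fs * g p.1 p.2)) j : ℝ) : ℂ) •
      (Sum.elim (fun p f => phase p.2 f • Γ f p.1) (fun p f => phase p.2 f • H f p.1)
        ((Sum.elim (fun _ : Unit => Sum.inl (i, 0))
          (fun p : Fin K × ℤ => Sum.inr (p.1, (p.2 : ℝ) * (1 / fs)))) j) : ℝ → Fin M → ℂ) f =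
      Γ f i - ∑ k, (((1 / fs : ℝ) : ℂ) * trigPoly fs S (fun n => (g k n : ℂ)) f) • H f k := by
    intro f
    rw [Finset.sum_disjSum, Finset.sum_product]
    simp only [Sum.elim_inl, Sum.elim_inr, Finset.univ_unique, Finset.sum_singleton, phase_zero,
      Complex.ofReal_one, one_smul, trigPoly, Finset.mul_sum, Finset.sum_smul, smul_smul]
    rw [sub_eq_add_neg, ← Finset.sum_neg_distrib]
    congr 1
    refine Finset.sum_congr rfl fun k _ => ?_
    rw [← Finset.sum_neg_distrib]
    refine Finset.sum_congr rfl fun n _ => ?_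
    rw [← neg_smul]
    congr 1
    push_cast
    ring
  have e2 : ∀ ω, ∑ j ∈ Finset.univ.disjSum (Finset.univ ×ˢ S),
      (Sum.elim (fun _ => 1) (fun p => -(1 / fs * g p.1 p.2)) j : ℝ) *
      (Sum.elim (fun p : Fin N × ℝ => u p.1 p.2) (fun p : Fin K × ℝ => y p.1 p.2)
        ((Sum.elim (fun _ : Unit => Sum.inl (i, 0))
          (fun p : Fin K × ℤ => Sum.inr (p.1, (p.2 : ℝ) * (1 / fs)))) j)) ω =
      u i 0 ω - linComb S g (samples fs y) ω := by
    intro ω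
    rw [Finset.sum_disjSum, Finset.sum_product]
    simp only [Sum.elim_inl, Sum.elim_inr, Finset.univ_unique, Finset.sum_singleton, one_mul,
      linComb, samples]
    rw [sub_eq_add_neg, ← Finset.sum_neg_distrib]
    congr 1
    refine Finset.sum_congr rfl fun k _ => ?_
    rw [← Finset.sum_neg_distrib]
    exact Finset.sum_congr rfl fun n _ => by ring
  have h1 := hfam.integrable ()
  have h2 := hfam.integral_sq hx.psd_posSemidef ()
  simp only [e1] at h1 h2
  simp only [e2] at h2
  exact ⟨h1, h2⟩

/-- `min_specForm_le` integrated over one sampling period, which contains the band. Parseval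
converts the digital gains into tap energy, and the analog powers are bounded by the peak power. -/
lemma integral_min_le [IsFiniteMeasure μ] (hu : IsFilterOutput μ C x Γ u)
    (hy : IsFilterOutput μ C x H y) (hx : IsWSSWithPSD μ x C) {fs : ℝ} (hfs : 0 < fs)
    (hband : ∀ f : ℝ, fs / 2 < |f| → C f = 0) (i : Fin N) (S : Finset ℤ)
    (g : Fin K → ℤ → ℝ) {B l : ℝ} (hB : 0 ≤ B) (hl : 0 < l) :
    ∫ f, min (specForm (C f) (Γ f i) (Γ f i)).re B ≤
      ∫ ω, (u i 0 ω - linComb S g (samples fs y) ω) ^ 2 ∂μ +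
        (l * (B / fs * ∑ k, ∑ n ∈ S, g k n ^ 2) + l⁻¹ * (K * peakPower C H)) := by
  obtain ⟨hi, he⟩ := integral_sq_sub_linComb_eq hu hy hx fs i S g
  set c : Fin K → ℝ → ℂ := fun k f =>
    ((1 / fs : ℝ) : ℂ) * trigPoly fs S (fun n => (g k n : ℂ)) f with hc
  have hcc : ∀ k, Continuous (c k) := fun k => continuous_const.mul (continuous_trigPoly _ _ _)
  set I : Set ℝ := Set.Ioc (-fs / 2) (fs / 2) with hI
  have hUi := hu.integrable_power hx i
  have hmin : Integrable fun f => min (specForm (C f) (Γ f i) (Γ f i)).re B := by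
    refine hUi.mono' (hUi.1.inf aestronglyMeasurable_const) (.of_forall fun f => ?_)
    have h0 := specForm_self_re_nonneg (hx.psd_posSemidef f) (Γ f i)
    rw [Real.norm_eq_abs, abs_of_nonneg (le_min h0 hB)]
    exact min_le_left _ _
  have hI1 : ∫ f, min (specForm (C f) (Γ f i) (Γ f i)).re B =
      ∫ f in I, min (specForm (C f) (Γ f i) (Γ f i)).re B := by
    rw [hI, ← integral_Icc_eq_integral_Ioc, setIntegral_eq_integral_of_forall_compl_eq_zero]
    intro f hf
    have : fs / 2 < |f| := by
      by_contra! hle'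
      rw [abs_le] at hle'
      exact hf ⟨by linarith [hle'.1], hle'.2⟩
    simp [hband f this, specForm_zero_matrix, hB]
  have hci : ∀ k, IntegrableOn (fun f => ‖c k f‖ ^ 2) I := fun k =>
    (((hcc k).norm.pow 2).integrableOn_Icc).mono_set Set.Ioc_subset_Icc_self
  have hWi : ∀ k, Integrable fun f => (specForm (C f) (H f k) (H f k)).re :=
    fun k => hy.integrable_power hx k
  have hterm : ∀ k, IntegrableOn (fun f => l * B * ‖c k f‖ ^ 2 +
      l⁻¹ * (specForm (C f) (H f k) (H f k)).re) I := fun k =>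
    ((hci k).const_mul _).add ((hWi k).integrableOn.const_mul _)
  have hck : ∀ k, ∫ f in I, ‖c k f‖ ^ 2 = 1 / fs * ∑ n ∈ S, g k n ^ 2 := by
    intro k
    simp only [hc, norm_mul, mul_pow, Complex.norm_real, Real.norm_eq_abs, sq_abs]
    rw [integral_const_mul, hI, ← intervalIntegral.integral_of_le (by linarith),
      intervalIntegral_norm_sq_trigPoly hfs]
    simp only [Complex.norm_real, Real.norm_eq_abs, sq_abs]
    field_simp
  rw [he, hI1]
  calc ∫ f in I, min (specForm (C f) (Γ f i) (Γ f i)).re B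
      ≤ ∫ f in I, ((specForm (C f) (Γ f i - ∑ k, c k f • H f k)
          (Γ f i - ∑ k, c k f • H f k)).re +
          ∑ k, (l * B * ‖c k f‖ ^ 2 + l⁻¹ * (specForm (C f) (H f k) (H f k)).re)) :=
        integral_mono hmin.integrableOn
          (hi.integrableOn.add (integrable_finsetSum _ fun k _ => hterm k)) fun f =>
          min_specForm_le (hx.psd_posSemidef f) Finset.univ (fun k => c k f) (fun k => H f k)
            (Γ f i) hB hl
    _ = (∫ f in I, (specForm (C f) (Γ f i - ∑ k, c k f • H f k)
          (Γ f i - ∑ k, c k f • H f k)).re) +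
          ∑ k, (l * B * (1 / fs * ∑ n ∈ S, g k n ^ 2) +
            l⁻¹ * ∫ f in I, (specForm (C f) (H f k) (H f k)).re) := by
        rw [integral_add hi.integrableOn (integrable_finsetSum _ fun k _ => hterm k),
          integral_finsetSum _ fun k _ => hterm k]
        congr 1
        refine Finset.sum_congr rfl fun k _ => ?_
        rw [integral_add ((hci k).const_mul _) ((hWi k).integrableOn.const_mul _),
          integral_const_mul, integral_const_mul, hck]
    _ ≤ (∫ f, (specForm (C f) (Γ f i - ∑ k, c k f • H f k)
          (Γ f i - ∑ k, c k f • H f k)).re) +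
          ∑ k, (l * B * (1 / fs * ∑ n ∈ S, g k n ^ 2) + l⁻¹ * peakPower C H) := by
        refine add_le_add (setIntegral_le_integral hi (.of_forall fun f =>
          specForm_self_re_nonneg (hx.psd_posSemidef f) _)) (Finset.sum_le_sum fun k _ => ?_)
        refine add_le_add le_rfl (mul_le_mul_of_nonneg_left ?_ (inv_nonneg.2 hl.le))
        exact (setIntegral_le_integral (hWi k) (.of_forall fun f =>
          specForm_self_re_nonneg (hx.psd_posSemidef f) _)).trans (peakPower_le k)
    _ = _ := by
        rw [Finset.sum_add_distrib, ← Finset.mul_sum, ← Finset.mul_sum]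
        simp only [Finset.sum_const, Finset.card_univ, Fintype.card_fin, nsmul_eq_mul]
        ring

/-- Optimal choice of the weight in a sum of a linear and an inverse term. -/
lemma exists_weight_le {a θ : ℝ} (ha : 0 ≤ a) (hθ : 0 < θ) {q : ℝ} (hq : 0 ≤ q) :
    ∃ l > 0, l * a + l⁻¹ * q ≤ θ + θ⁻¹ * (a * q) := by
  rcases hq.eq_or_lt with rfl | hq'
  · refine ⟨θ / (a + 1), by positivity, ?_⟩
    have : θ / (a + 1) * a ≤ θ := by
      rw [div_mul_eq_mul_div, div_le_iff₀ (by positivity)]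
      nlinarith
    simpa using this
  · refine ⟨q / θ, by positivity, le_of_eq ?_⟩
    field_simp
    ring

/-- The recovery error is close to that of the zero estimate if the noise level is low. -/
lemma exists_recoveryError_ge [IsFiniteMeasure μ] (hu : IsFilterOutput μ C x Γ u)
    (hx : IsWSSWithPSD μ x C) {fs : ℝ} (hfs : 0 < fs)
    (hband : ∀ f : ℝ, fs / 2 < |f| → C f = 0) {ε : ℝ} (hε : 0 < ε) :
    ∃ D, 0 ≤ D ∧ ∀ (H : ℝ → Matrix (Fin K) (Fin M) ℂ) (y : Fin K → ℝ → Ω → ℝ)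
      (S : Finset ℤ) (g : Fin N → Fin K → ℤ → ℝ), IsFilterOutput μ C x H y →
      ∑ i, ∫ ω, u i 0 ω ^ 2 ∂μ ≤
        recoveryError μ u fs y S g + ε + D * (peakPower C H * tapEnergy S g) := by
  set θ : ℝ := ε / (2 * (N + 1)) with hθ
  have hθ0 : 0 < θ := by positivity
  -- The capped spectra increase to the true one, so dominated convergence gives a cap losing at
  -- most `θ`. The cap depends only on the target, which makes `D` uniform over all systems.
  have hlim : ∀ i, ∃ B : ℕ, ∫ ω, u i 0 ω ^ 2 ∂μ ≤
      (∫ f, min (specForm (C f) (Γ f i) (Γ f i)).re B) + θ := by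
    intro i
    have hUi := hu.integrable_power hx i
    have h1 : Tendsto (fun B : ℕ => ∫ f, min (specForm (C f) (Γ f i) (Γ f i)).re (B : ℝ)) atTop
        (𝓝 (∫ f, (specForm (C f) (Γ f i) (Γ f i)).re)) := by
      refine tendsto_integral_of_dominated_convergence
        (fun f => (specForm (C f) (Γ f i) (Γ f i)).re)
        (fun B => hUi.1.inf aestronglyMeasurable_const) hUi (fun B => .of_forall fun f => ?_)
        (.of_forall fun f => ?_)
      · have h0 := specForm_self_re_nonneg (hx.psd_posSemidef f) (Γ f i)
        rw [Real.norm_eq_abs, abs_of_nonneg (le_min h0 (Nat.cast_nonneg B))]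
        exact min_le_left _ _
      · refine tendsto_const_nhds.congr' ?_
        filter_upwards [eventually_ge_atTop ⌈(specForm (C f) (Γ f i) (Γ f i)).re⌉₊] with B hB
        rw [min_eq_left (Nat.ceil_le.1 hB)]
    obtain ⟨B, hB⟩ := (h1.eventually (lt_mem_nhds (sub_lt_self _ hθ0))).exists
    exact ⟨B, by rw [hu.integral_sq hx]; linarith⟩
  choose B hB using hlim
  set D : ℝ := θ⁻¹ * (∑ i, (B i : ℝ)) / fs * K with hD
  refine ⟨D, by positivity, fun H y S g hy => ?_⟩
  have hQ := peakPower_nonneg hx.psd_posSemidef H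
  have hE : ∀ i, 0 ≤ ∑ k, ∑ n ∈ S, g i k n ^ 2 := fun i =>
    Finset.sum_nonneg fun _ _ => Finset.sum_nonneg fun _ _ => sq_nonneg _
  have hone : ∀ i, ∫ ω, u i 0 ω ^ 2 ∂μ ≤
      ∫ ω, (u i 0 ω - linComb S (g i) (samples fs y) ω) ^ 2 ∂μ + 2 * θ +
        D * (peakPower C H * ∑ k, ∑ n ∈ S, g i k n ^ 2) := by
    intro i
    -- The weight `l` may depend on the system. Optimizing it replaces the sum of tap energy and
    -- peak power by their product, the quantity that occurs in the noise term.
    obtain ⟨l, hl, hl2⟩ := exists_weight_le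
      (a := (B i : ℝ) / fs * ∑ k, ∑ n ∈ S, g i k n ^ 2)
      (mul_nonneg (by positivity) (hE i)) hθ0 (q := K * peakPower C H) (by positivity)
    have h1 := integral_min_le hu hy hx hfs hband i S (g i) (Nat.cast_nonneg (B i)) hl
    have h2 : θ⁻¹ * ((B i : ℝ) / fs * (∑ k, ∑ n ∈ S, g i k n ^ 2) * (K * peakPower C H)) ≤
        D * (peakPower C H * ∑ k, ∑ n ∈ S, g i k n ^ 2) := by
      have hBi : (B i : ℝ) ≤ ∑ i, (B i : ℝ) :=
        Finset.single_le_sum (f := fun i => (B i : ℝ)) (fun i _ => Nat.cast_nonneg _)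
          (Finset.mem_univ i)
      have hEi := hE i
      calc θ⁻¹ * ((B i : ℝ) / fs * (∑ k, ∑ n ∈ S, g i k n ^ 2) * (K * peakPower C H))
          = (θ⁻¹ * B i / fs * K) * (peakPower C H * ∑ k, ∑ n ∈ S, g i k n ^ 2) := by ring
        _ ≤ D * (peakPower C H * ∑ k, ∑ n ∈ S, g i k n ^ 2) := by
          refine mul_le_mul_of_nonneg_right ?_ (by positivity)
          rw [hD]
          gcongr
    linarith [hB i]
  calc ∑ i, ∫ ω, u i 0 ω ^ 2 ∂μ
      ≤ ∑ i, (∫ ω, (u i 0 ω - linComb S (g i) (samples fs y) ω) ^ 2 ∂μ + 2 * θ +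
        D * (peakPower C H * ∑ k, ∑ n ∈ S, g i k n ^ 2)) := Finset.sum_le_sum fun i _ => hone i
    _ = recoveryError μ u fs y S g + N * (2 * θ) +
        D * (peakPower C H * tapEnergy S g) := by
      simp only [Finset.sum_add_distrib, recoveryError, tapEnergy, Finset.sum_const,
        Finset.card_univ, Fintype.card_fin, nsmul_eq_mul, Finset.mul_sum]
    _ ≤ _ := by
      have : N * (2 * θ) ≤ ε := by
        rw [hθ, show N * (2 * (ε / (2 * (N + 1)))) = N * ε / (N + 1) by field_simp,
          div_le_iff₀ (by positivity)]
        nlinarith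
      linarith

end LowerBound

end TaskADC

end

noncomputable section

namespace TaskADC

/-! ### Comparison of configurations -/

section Comparison

/-- Reduces to `d + 1 ≤ 4 ^ d` with `d = b' - b - 1`. Equality holds at `b = 1`, `b' = 2`, so `3/4`
is the best constant this inequality allows. -/
lemma four_mul_le_three_mul_four_pow {b b' : ℕ} (hb : 1 ≤ b) (hlt : b < b') :
    4 * ((b' : ℝ) + 1) ≤ 3 * (b * 4 ^ (b' - b)) := by
  obtain ⟨d, rfl⟩ := Nat.exists_eq_add_of_lt hlt
  rw [show b + d + 1 - b = d + 1 by omega]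
  have h1 : (d : ℝ) + 1 ≤ 4 ^ d := by
    exact_mod_cast Nat.succ_le_of_lt (Nat.lt_pow_self (by norm_num : 1 < 4))
  have h2 : (1 : ℝ) ≤ b := by exact_mod_cast hb
  have h3 : (0 : ℝ) ≤ d := Nat.cast_nonneg d
  push_cast
  rw [pow_succ]
  nlinarith [mul_le_mul_of_nonneg_left h1 (by linarith : (0 : ℝ) ≤ b),
    mul_nonneg h3 (by linarith : (0 : ℝ) ≤ b - 1)]

/-- Trading sampling rate for resolution reduces the density of the quantization noise. -/
lemma noiseFactor_mul_le {η fnyq fs fs' : ℝ} {b b' : ℕ} (hq : IsConfig η fnyq fs b)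
    (hp : IsConfig η fnyq fs' b') (hlt : b < b') (hle : fs' ≤ fs)
    (hrate : fs * b ≤ fs' * (b' + 1)) :
    noiseFactor η b' * fs ≤ 3 / 4 * noiseFactor η b * fs' := by
  have hd := hq.noiseFactor_denom_pos
  have hd' := hp.noiseFactor_denom_pos
  have hb : (1 : ℝ) ≤ b := by exact_mod_cast hq.2.2.1
  have hfs := hq.1
  have hfs' := hp.1
  have hpow : (2 : ℝ) ^ (2 * b') = 2 ^ (2 * b) * 4 ^ (b' - b) := by
    rw [show (4 : ℝ) = 2 ^ 2 by norm_num, ← pow_mul, ← pow_add]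
    congr 1
    omega
  -- The rate hypothesis bounds `fs / fs'` by `(b' + 1) / b`, where the `+ 1` allows for rounding
  -- down.
  have hX : 4 * fs ≤ 3 * (fs' * 4 ^ (b' - b)) := by
    have h1 := mul_le_mul_of_nonneg_left (four_mul_le_three_mul_four_pow hq.2.2.1 hlt) hfs'.le
    have h2 : b * (4 * fs) ≤ b * (3 * (fs' * 4 ^ (b' - b))) := by nlinarith
    exact le_of_mul_le_mul_left h2 (by linarith)
  have hkey : 4 * fs * (2 ^ (2 * b) - 2 * η ^ 2 / 3) ≤
      3 * fs' * (2 ^ (2 * b') - 2 * η ^ 2 / 3) := by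
    rw [hpow]
    have h1 := mul_le_mul_of_nonneg_left hX (by positivity : (0 : ℝ) ≤ 2 ^ (2 * b))
    -- The corrections `2η²/3` of the denominators have the favorable sign because `fs' ≤ fs` gives
    -- `4 * fs ≥ 3 * fs'`.
    nlinarith [sq_nonneg η, mul_nonneg (sq_nonneg η) (by linarith : 0 ≤ 4 * fs - 3 * fs')]
  unfold noiseFactor
  rw [show 3 / 4 * (η ^ 2 / ((2 : ℝ) ^ (2 * b) - 2 * η ^ 2 / 3)) * fs' =
    3 / 4 * η ^ 2 * fs' / ((2 : ℝ) ^ (2 * b) - 2 * η ^ 2 / 3) by ring, div_mul_eq_mul_div,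
    div_le_div_iff₀ hd' hd]
  nlinarith [mul_le_mul_of_nonneg_left hkey (sq_nonneg η)]

/-! ### Comparison of the minimum errors -/

variable {Ω : Type*} [MeasurableSpace Ω] {μ : Measure Ω} {M N K : ℕ}

/-- A single row of a matrix, moved to the row `k₀` of a matrix which is zero elsewhere. -/
def singleRow {R : Type*} [Zero R] (A : Matrix (Fin N) (Fin M) R) (i : Fin N) (k₀ : Fin K) :
    Matrix (Fin K) (Fin M) R :=
  fun k m => if k = k₀ then A i m else 0

lemma singleRow_apply {R : Type*} [Zero R] (A : Matrix (Fin N) (Fin M) R) (i : Fin N)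
    (k₀ k : Fin K) (m : Fin M) : singleRow A i k₀ k m = if k = k₀ then A i m else 0 := rfl

lemma singleRow_row_eq {R : Type*} [Zero R] (A : Matrix (Fin N) (Fin M) R) (i : Fin N)
    (k₀ k : Fin K) : singleRow A i k₀ k = if k = k₀ then A i else 0 := by
  ext m
  by_cases hk : k = k₀ <;> simp [hk, singleRow_apply]

/-- A single row of a filter, assigned to one of `K` channels. -/
lemma IsFilterOutput.single_row {C : ℝ → Matrix (Fin M) (Fin M) ℂ} {x : Fin M → ℝ → Ω → ℝ}
    {Γ : ℝ → Matrix (Fin N) (Fin M) ℂ} {u : Fin N → ℝ → Ω → ℝ} (hC : ∀ f, (C f).PosSemidef)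
    (hu : IsFilterOutput μ C x Γ u) (i : Fin N) (k₀ : Fin K) :
    IsFilterOutput μ C x (fun f => singleRow (Γ f) i k₀)
      (fun k t => if k = k₀ then u i t else 0) := by
  obtain ⟨h, hint, hH, hy⟩ := hu.approx
  refine ⟨fun k m => ?_, fun k t => ?_, fun j τ => singleRow (h j τ) i k₀,
    fun j k m => ?_, ?_, fun k t => ?_⟩
  · by_cases hk : k = k₀
    · simpa [hk, singleRow_apply] using hu.measurable i m
    · simp [hk, singleRow_apply]
  · by_cases hk : k = k₀
    · simpa [hk] using hu.memLp i t
    · simp [hk]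
  · by_cases hk : k = k₀
    · simpa [hk, singleRow_apply] using hint j i m
    · simp [hk, singleRow_apply]
  · refine tendsto_of_tendsto_of_tendsto_of_le_of_le tendsto_const_nhds hH (fun _ => zero_le) ?_
    intro j
    refine lintegral_mono fun f => ENNReal.ofReal_le_ofReal ?_
    rw [trace_mul_mul_conjTranspose, trace_mul_mul_conjTranspose]
    have h1 : freqResp (fun τ => singleRow (h j τ) i k₀) f - singleRow (Γ f) i k₀ =
        singleRow (freqResp (h j) f - Γ f) i k₀ := by
      ext k m
      by_cases hk : k = k₀ <;> simp [hk, freqResp, Real.fourier_eq, singleRow_apply]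
    simp_rw [h1, singleRow_row_eq]
    rw [Finset.sum_eq_single k₀ (fun k _ hk => by simp [hk, specForm]) (by simp), if_pos rfl,
      Complex.re_sum]
    exact Finset.single_le_sum
      (f := fun i => (specForm (C f) ((freqResp (h j) f - Γ f) i) ((freqResp (h j) f - Γ f) i)).re)
      (fun i _ => specForm_self_re_nonneg (hC f) _) (Finset.mem_univ i)
  · by_cases hk : k = k₀
    · simpa [hk, convOut, singleRow_apply] using hy i t
    · simp [hk, convOut, singleRow_apply]

lemma bddBelow_achievableMSE (x : Fin M → ℝ → Ω → ℝ) (C : ℝ → Matrix (Fin M) (Fin M) ℂ)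
    (s : Fin N → Ω → ℝ) (v : Fin K → ℤ → Ω → ℝ) (η fs : ℝ) (b : ℕ) :
    BddBelow (achievableMSE μ x C s v η fs b) := by
  refine ⟨0, ?_⟩
  rintro e ⟨H, y, γ, G, shat, -, -, -, rfl⟩
  exact integral_nonneg fun ω => Finset.sum_nonneg fun i _ => sq_nonneg _

namespace IsTaskSetting

variable {C : ℝ → Matrix (Fin M) (Fin M) ℂ} {x : Fin M → ℝ → Ω → ℝ}
  {s : Fin N → Ω → ℝ} {Γ : ℝ → Matrix (Fin N) (Fin M) ℂ} {u : Fin N → ℝ → Ω → ℝ}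
  {v : Fin K → ℤ → Ω → ℝ} {H : ℝ → Matrix (Fin K) (Fin M) ℂ} {y : Fin K → ℝ → Ω → ℝ}
  {η fnyq fs fs' : ℝ} {b b' : ℕ} [IsProbabilityMeasure μ]

lemma minMSE_le_finiteMSE (h : IsTaskSetting μ x C s Γ u v) (hy : IsFilterOutput μ C x H y)
    (hη : 0 < η) (hc : IsConfig η fnyq fs b) (S : Finset ℤ) (g : Fin N → Fin K → ℤ → ℝ) :
    minMSE μ x C s v η fs b ≤ finiteMSE μ C s u η fs b H y S g :=
  csInf_le (bddBelow_achievableMSE x C s v η fs b) (h.finiteMSE_mem_achievableMSE hy hη hc S g)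

/-- Truncating the digital filter changes the error arbitrarily little, so lower bounds need only be
checked for finitely many taps. -/
lemma le_of_mem_achievableMSE (h : IsTaskSetting μ x C s Γ u v) (hη : 0 < η)
    (hc : IsConfig η fnyq fs b) {a e : ℝ} (he : e ∈ achievableMSE μ x C s v η fs b)
    (ha : ∀ (H : ℝ → Matrix (Fin K) (Fin M) ℂ) (y : Fin K → ℝ → Ω → ℝ) (S : Finset ℤ)
      (g : Fin N → Fin K → ℤ → ℝ), IsFilterOutput μ C x H y →
      a ≤ finiteMSE μ C s u η fs b H y S g) : a ≤ e := by
  refine le_of_forall_pos_le_add fun ε hε => ?_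
  obtain ⟨H, y, S, g, hy, hle⟩ := h.exists_finiteMSE_le hη hc he hε
  exact (ha H y S g hy).trans hle

/-- The zero system is always available. Nonemptiness rules out the default value `0` of `sInf` at
the empty set. -/
lemma achievableMSE_nonempty (h : IsTaskSetting μ x C s Γ u v) (hη : 0 < η)
    (hc : IsConfig η fnyq fs b) : (achievableMSE μ x C s v η fs b).Nonempty := by
  have hy : IsFilterOutput μ C x (0 : ℝ → Matrix (Fin K) (Fin M) ℂ) 0 := by
    refine ⟨fun k m => measurable_const, fun k t => MemLp.zero, fun _ _ => 0, ?_, ?_, ?_⟩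
    · simp
    · have h0 : ∀ f, freqResp (fun _ => (0 : Matrix (Fin K) (Fin M) ℝ)) f = 0 := by
        intro f
        ext k m
        simp [freqResp, Real.fourier_eq]
      simp [h0]
    · simp [convOut]
  exact ⟨_, h.finiteMSE_mem_achievableMSE hy hη hc ∅ 0⟩

/-- With a lower sampling rate and a higher resolution, the distortion of the estimate from
unquantized samples is preserved and the contribution of the quantization noise is smaller. -/
lemma minMSE_le_of_resampling (h : IsTaskSetting μ x C s Γ u v)
    (hband : ∀ f : ℝ, fnyq / 2 < |f| → C f = 0) (hη : 0 < η) (hq : IsConfig η fnyq fs b)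
    (hp : IsConfig η fnyq fs' b') (hlt : b < b') (hle : fs' ≤ fs)
    (hrate : fs * b ≤ fs' * (b' + 1)) (hy : IsFilterOutput μ C x H y) (S : Finset ℤ)
    (g : Fin N → Fin K → ℤ → ℝ) :
    minMSE μ x C s v η fs' b' ≤ mmseError μ s u + recoveryError μ u fs y S g +
      3 / 4 * (noiseFactor η b * peakPower C H / fs ^ 2 * tapEnergy S g) := by
  have hfs := hq.1
  have hfs' := hp.1
  have hQ := peakPower_nonneg h.wss.psd_posSemidef H
  have hE := tapEnergy_nonneg S g
  have hκ' := hp.noiseFactor_nonneg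
  set A := noiseFactor η b' * peakPower C H / fs' ^ 2 with hA
  have hA0 : 0 ≤ A := by positivity
  have hnoise : A * (fs' / fs * tapEnergy S g) ≤
      3 / 4 * (noiseFactor η b * peakPower C H / fs ^ 2 * tapEnergy S g) := by
    have h1 := noiseFactor_mul_le hq hp hlt hle hrate
    have h2 : A * (fs' / fs * tapEnergy S g) =
        noiseFactor η b' * fs * (peakPower C H * tapEnergy S g / (fs' * fs ^ 2)) := by
      rw [hA]
      field_simp
    have h3 : 3 / 4 * (noiseFactor η b * peakPower C H / fs ^ 2 * tapEnergy S g) =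
        3 / 4 * noiseFactor η b * fs' * (peakPower C H * tapEnergy S g / (fs' * fs ^ 2)) := by
      field_simp
    rw [h2, h3]
    exact mul_le_mul_of_nonneg_right h1 (by positivity)
  refine le_of_forall_pos_le_add fun ε hε => ?_
  -- The resampling error enters once through the recovery error and `A` times through the tap
  -- energy, hence the tolerance `ε / (1 + A)`.
  obtain ⟨S', g', hrec, htap⟩ := hy.exists_resampled_system h.wss
    (fun i => h.estimator.memLp i 0) hfs' hle
    (fun f hf => hband f (lt_of_le_of_lt (by linarith [hp.2.1]) hf)) S g
    (div_pos hε (by linarith : 0 < 1 + A))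
  have h1 := h.minMSE_le_finiteMSE hy hη hp S' g'
  unfold finiteMSE at h1
  rw [← hA] at h1
  have h2 := mul_le_mul_of_nonneg_left htap hA0
  have h3 : ε / (1 + A) + A * (ε / (1 + A)) = ε := by
    field_simp
  linarith

lemma minMSE_le_minMSE (h : IsTaskSetting μ x C s Γ u v)
    (hband : ∀ f : ℝ, fnyq / 2 < |f| → C f = 0) (hη : 0 < η) (hq : IsConfig η fnyq fs b)
    (hp : IsConfig η fnyq fs' b') (hlt : b < b') (hle : fs' ≤ fs)
    (hrate : fs * b ≤ fs' * (b' + 1)) :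
    minMSE μ x C s v η fs' b' ≤ minMSE μ x C s v η fs b := by
  refine le_csInf (h.achievableMSE_nonempty hη hq) fun e he =>
    h.le_of_mem_achievableMSE hη hq he fun H y S g hy => ?_
  refine (h.minMSE_le_of_resampling hband hη hq hp hlt hle hrate hy S g).trans ?_
  have h1 : 0 ≤ noiseFactor η b * peakPower C H / fs ^ 2 * tapEnergy S g :=
    mul_nonneg (div_nonneg (mul_nonneg hq.noiseFactor_nonneg
      (peakPower_nonneg h.wss.psd_posSemidef H)) (sq_nonneg _)) (tapEnergy_nonneg S g)
  unfold finiteMSE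
  linarith

/-- If the MMSE estimate is nonzero, then some acquisition system does better than the zero
estimate. -/
lemma minMSE_lt_of_not_ae_eq_zero (h : IsTaskSetting μ x C s Γ u v) (hη : 0 < η)
    (hc : IsConfig η fnyq fs b) {i : Fin N} (hi : ¬ u i 0 =ᵐ[μ] 0) :
    minMSE μ x C s v η fs b < mmseError μ s u + ∑ i, ∫ ω, u i 0 ω ^ 2 ∂μ := by
  classical
  have hui := h.estimator.memLp i 0
  have hP : 0 < ∫ ω, u i 0 ω ^ 2 ∂μ := by
    refine lt_of_le_of_ne (integral_nonneg fun _ => sq_nonneg _) fun h0 => hi ?_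
    rw [eq_comm, integral_eq_zero_iff_of_nonneg (fun _ => sq_nonneg _) hui.integrable_sq] at h0
    filter_upwards [h0] with ω hω
    simpa using hω
  set P := ∫ ω, u i 0 ω ^ 2 ∂μ with hPdef
  let k₀ : Fin K := ⟨0, h.pos⟩
  have : Nonempty (Fin K) := ⟨k₀⟩
  have hy := h.estimator.single_row h.wss.psd_posSemidef i k₀
  have hκ := hc.noiseFactor_nonneg
  have hfs := hc.1
  set κ := noiseFactor η b
  -- The system sends one nonzero component of the estimate through one channel and scales it by
  -- `β`. This value minimizes `(1 - β)² + κ β²`, with minimum `1 - β < 1`.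
  set β := (1 + κ)⁻¹ with hβ
  have hβ0 : 0 < β := by positivity
  have hβκ : β * (1 + κ) = 1 := inv_mul_cancel₀ (by positivity)
  -- A single tap at time zero; its factor `fs` cancels the normalization of the samples.
  refine (h.minMSE_le_finiteMSE hy hη hc {0}
    (fun i' k _ => if i' = i ∧ k = k₀ then fs * β else 0)).trans_lt ?_
  have hQ : peakPower C (fun f => singleRow (Γ f) i k₀) ≤ P := by
    refine ciSup_le fun k => ?_
    simp_rw [singleRow_row_eq]
    by_cases hk : k = k₀
    · simp only [hk, if_true]
      exact (h.estimator.integral_sq h.wss i 0).ge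
    · simp only [hk, if_false]
      simpa [specForm] using hP.le
  have hT : tapEnergy {0} (fun (i' : Fin N) (k : Fin K) (_ : ℤ) =>
      if i' = i ∧ k = k₀ then fs * β else 0) = (fs * β) ^ 2 := by
    unfold tapEnergy
    rw [Finset.sum_eq_single i (fun i' _ hi' => by simp [hi']) (by simp),
      Finset.sum_eq_single k₀ (fun k _ hk => by simp [hk]) (by simp)]
    simp
  have hlin : ∀ i' ω, linComb {0} (fun (k : Fin K) (_ : ℤ) =>
      if i' = i ∧ k = k₀ then fs * β else 0)
      (samples fs (fun k t => if k = k₀ then u i t else 0)) ω =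
      if i' = i then β * u i 0 ω else 0 := by
    intro i' ω
    unfold linComb samples
    rw [Finset.sum_eq_single k₀ (fun k _ hk => by simp [hk]) (by simp)]
    by_cases hi' : i' = i
    · simp [hi']
      field_simp
    · simp [hi']
  have hR : recoveryError μ u fs (fun k t => if k = k₀ then u i t else 0) {0}
      (fun (i' : Fin N) (k : Fin K) (_ : ℤ) => if i' = i ∧ k = k₀ then fs * β else 0) =
      ∑ i, ∫ ω, u i 0 ω ^ 2 ∂μ - P + (1 - β) ^ 2 * P := by
    unfold recoveryError
    simp_rw [hlin]
    rw [← Finset.add_sum_erase _ _ (Finset.mem_univ i),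
      ← Finset.add_sum_erase _ (fun i => ∫ ω, u i 0 ω ^ 2 ∂μ) (Finset.mem_univ i)]
    have h1 : ∫ ω, (u i 0 ω - if i = i then β * u i 0 ω else 0) ^ 2 ∂μ = (1 - β) ^ 2 * P := by
      rw [hPdef, ← integral_const_mul]
      congr 1
      ext ω
      simp
      ring
    have h2 : ∑ j ∈ Finset.univ.erase i,
        ∫ ω, (u j 0 ω - if j = i then β * u i 0 ω else 0) ^ 2 ∂μ =
        ∑ j ∈ Finset.univ.erase i, ∫ ω, u j 0 ω ^ 2 ∂μ :=
      Finset.sum_congr rfl fun j hj => by simp [Finset.ne_of_mem_erase hj]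
    rw [h1, h2]
    ring
  unfold finiteMSE
  rw [hT, hR]
  have h1 : κ * peakPower C (fun f => singleRow (Γ f) i k₀) / fs ^ 2 * (fs * β) ^ 2 =
      κ * β ^ 2 * peakPower C (fun f => singleRow (Γ f) i k₀) := by
    field_simp
  have h2 := mul_le_mul_of_nonneg_left hQ (by positivity : 0 ≤ κ * β ^ 2)
  have h3 : (1 - β) ^ 2 * P + κ * β ^ 2 * P = P - β * P := by
    linear_combination (β * P) * hβκ
  have h4 : 0 < β * P := by positivity
  rw [h1]
  linarith

/-- Since infima need not be attained, a gap uniform over all competitors is produced. A large noise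
term `ν` yields a gain of `ν / 4` by resampling; a small one forces an error near that of the zero
estimate, which the other configuration strictly beats. -/
lemma minMSE_lt_minMSE (h : IsTaskSetting μ x C s Γ u v)
    (hband : ∀ f : ℝ, fnyq / 2 < |f| → C f = 0) (hη : 0 < η) (hq : IsConfig η fnyq fs b)
    (hp : IsConfig η fnyq fs' b') (hlt : b < b') (hle : fs' ≤ fs)
    (hrate : fs * b ≤ fs' * (b' + 1)) (hne : ∃ i, ¬ μ[s i | inputSigma x] =ᵐ[μ] 0) :
    minMSE μ x C s v η fs' b' < minMSE μ x C s v η fs b := by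
  obtain ⟨i, hi⟩ := hne
  have hW := h.minMSE_lt_of_not_ae_eq_zero hη hp (i := i)
    fun h0 => hi ((h.mmse i).trans h0)
  set I := minMSE μ x C s v η fs' b'
  set W := mmseError μ s u + ∑ i, ∫ ω, u i 0 ω ^ 2 ∂μ with hWdef
  obtain ⟨D, hD0, hD⟩ := exists_recoveryError_ge h.estimator h.wss hq.1
    (fun f hf => hband f (lt_of_le_of_lt (by linarith [hq.2.1]) hf))
    (by linarith : 0 < (W - I) / 2) (K := K)
  have hfs := hq.1
  have hκ : 0 < noiseFactor η b := div_pos (by positivity) hq.noiseFactor_denom_pos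
  -- Rescales `D` so that the product of peak power and tap energy is expressed through the noise
  -- term `ν`.
  set D' := D * fs ^ 2 / noiseFactor η b with hD'
  have hD'0 : 0 ≤ D' := by positivity
  -- The gap balances the lower bounds `ν / 4` and `(W - I) / 2 - D' * ν` for `e - I`: adding `4 *
  -- D'` times the first to the second eliminates `ν`.
  have hδ : 0 < (W - I) / 2 / (1 + 4 * D') := div_pos (by linarith) (by positivity)
  refine lt_of_lt_of_le (lt_add_of_pos_right I hδ) (le_csInf (h.achievableMSE_nonempty hη hq)
    fun e he => h.le_of_mem_achievableMSE hη hq he fun H y S g hy => ?_)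
  have h1 := h.minMSE_le_of_resampling hband hη hq hp hlt hle hrate hy S g
  have h2 := hD H y S g hy
  have h3 : D * (peakPower C H * tapEnergy S g) =
      D' * (noiseFactor η b * peakPower C H / fs ^ 2 * tapEnergy S g) := by
    rw [hD']
    field_simp
  have hν : 0 ≤ noiseFactor η b * peakPower C H / fs ^ 2 * tapEnergy S g :=
    mul_nonneg (div_nonneg (mul_nonneg hκ.le
      (peakPower_nonneg h.wss.psd_posSemidef H)) (sq_nonneg _)) (tapEnergy_nonneg S g)
  rw [h3] at h2
  unfold finiteMSE
  set ν := noiseFactor η b * peakPower C H / fs ^ 2 * tapEnergy S g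
  rw [← le_sub_iff_add_le', div_le_iff₀ (by positivity)]
  set e := mmseError μ s u + recoveryError μ u fs y S g + ν with he'
  have h4 : ν / 4 ≤ e - I := by linarith
  have h5 : (W - I) / 2 - D' * ν ≤ e - I := by linarith
  nlinarith [mul_le_mul_of_nonneg_left h4 hD'0]

end IsTaskSetting

/-! ### Arithmetic of configurations sharing a rate budget -/

lemma rate_eq_of_mem_budgetConfigs {η fnyq R : ℝ} (hK : 1 ≤ K) {p q : ℝ × ℕ}
    (hp : p ∈ budgetConfigs K η fnyq R) (hq : q ∈ budgetConfigs K η fnyq R) :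
    q.1 * q.2 = p.1 * p.2 := by
  have hK' : (0 : ℝ) < K := by exact_mod_cast hK
  have h1 := hp.2.symm.trans hq.2
  rw [mul_assoc, mul_assoc] at h1
  exact (mul_left_cancel₀ hK'.ne' h1).symm

/-- Each floor traps `R` between `b K fs` and `(b + 1) K fs`. Fewer bits force a rate at least as
high, and the lower bound of one configuration against the upper bound of the other gives the
comparison with the `+ 1`. -/
lemma rate_le_of_mem_roundedConfigs {η fnyq R : ℝ} (hK : 1 ≤ K) {p q : ℝ × ℕ}
    (hp : p ∈ roundedConfigs K η fnyq R) (hq : q ∈ roundedConfigs K η fnyq R)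
    (hlt : q.2 < p.2) : p.1 ≤ q.1 ∧ q.1 * q.2 ≤ p.1 * (p.2 + 1) := by
  have hK' : (0 : ℝ) < K := by exact_mod_cast hK
  have hp0 : 0 < K * p.1 := mul_pos hK' hp.1.1
  have hq0 : 0 < K * q.1 := mul_pos hK' hq.1.1
  have h1 : (q.2 : ℝ) * (K * q.1) ≤ R := by
    rw [← le_div_iff₀ hq0]
    refine (Nat.le_floor_iff' (by have := hq.1.2.2.1; omega)).1 hq.2.le
  have h2 : R < (p.2 + 1) * (K * p.1) := by
    rw [← div_lt_iff₀ hp0, hp.2]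
    exact Nat.lt_floor_add_one _
  have h3 : (p.2 : ℝ) * (K * p.1) ≤ R := by
    rw [← le_div_iff₀ hp0]
    refine (Nat.le_floor_iff' (by have := hp.1.2.2.1; omega)).1 hp.2.le
  refine ⟨?_, ?_⟩
  · have h4 : R < (q.2 + 1) * (K * q.1) := by
      rw [← div_lt_iff₀ hq0, hq.2]
      exact Nat.lt_floor_add_one _
    have h5 : (q.2 : ℝ) + 1 ≤ p.2 := by exact_mod_cast hlt
    have h6 : K * p.1 ≤ K * q.1 := by
      by_contra! h7
      have : (0 : ℝ) ≤ q.2 := Nat.cast_nonneg _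
      nlinarith
    exact le_of_mul_le_mul_left h6 hK'
  · refine le_of_mul_le_mul_left (?_ : (K : ℝ) * _ ≤ K * _) hK'
    linarith

end Comparison

end TaskADC

end

theorem corollary3 {Ω : Type*} [MeasurableSpace Ω] (μ : Measure Ω) [IsProbabilityMeasure μ]
    {M N K : ℕ} (hK : 1 ≤ K)
    (x : Fin M → ℝ → Ω → ℝ) (C : ℝ → Matrix (Fin M) (Fin M) ℂ)
    (hx : TaskADC.IsWSSWithPSD μ x C)
    (fnyq : ℝ) (hband : ∀ f : ℝ, fnyq / 2 < |f| → C f = 0)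
    (s : Fin N → Ω → ℝ) (hs_meas : ∀ i, Measurable (s i)) (hs : ∀ i, MemLp (s i) 2 μ)
    (hs_mean : ∀ i, ∫ ω, s i ω ∂μ = 0)
    (Γ : ℝ → Matrix (Fin N) (Fin M) ℂ) (u : Fin N → ℝ → Ω → ℝ)
    (hΓ : TaskADC.IsFilterOutput μ C x Γ u)
    (hmmse : ∀ i, μ[s i | TaskADC.inputSigma x] =ᵐ[μ] u i 0)
    (v : Fin K → ℤ → Ω → ℝ) (hv : TaskADC.IsDither μ x s v)
    (η : ℝ) (hη : 0 < η) (R : ℝ) :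
    -- the MSE is minimized by the configuration with the largest resolution
    (∀ p ∈ TaskADC.budgetConfigs K η fnyq R,
      (∀ q ∈ TaskADC.budgetConfigs K η fnyq R, q.2 ≤ p.2) →
      (∀ q ∈ TaskADC.budgetConfigs K η fnyq R,
        TaskADC.minMSE μ x C s v η p.1 p.2 ≤ TaskADC.minMSE μ x C s v η q.1 q.2) ∧
      ((∃ i, ¬ μ[s i | TaskADC.inputSigma x] =ᵐ[μ] 0) →
        ∀ q ∈ TaskADC.budgetConfigs K η fnyq R, q ≠ p →
          TaskADC.minMSE μ x C s v η p.1 p.2 < TaskADC.minMSE μ x C s v η q.1 q.2)) ∧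
    -- more generally, higher sampling rates with fewer bits are inferior, also for rounded resolutions
    (∀ p ∈ TaskADC.roundedConfigs K η fnyq R, ∀ q ∈ TaskADC.roundedConfigs K η fnyq R,
      q.2 < p.2 →
      TaskADC.minMSE μ x C s v η p.1 p.2 ≤ TaskADC.minMSE μ x C s v η q.1 q.2 ∧
      ((∃ i, ¬ μ[s i | TaskADC.inputSigma x] =ᵐ[μ] 0) →
        TaskADC.minMSE μ x C s v η p.1 p.2 < TaskADC.minMSE μ x C s v η q.1 q.2)) := by
  have h : TaskADC.IsTaskSetting μ x C s Γ u v := ⟨hK, hx, hs_meas, hs, hΓ, hmmse, hv⟩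
  -- With an exactly spent budget the resolution determines the rate, so a different configuration
  -- has strictly fewer bits than the maximal one and falls under the general comparison; this is
  -- what makes the minimizer unique.
  have hrates : ∀ p ∈ TaskADC.budgetConfigs K η fnyq R, ∀ q ∈ TaskADC.budgetConfigs K η fnyq R,
      q.2 ≤ p.2 → q = p ∨ (q.2 < p.2 ∧ p.1 ≤ q.1 ∧ q.1 * q.2 ≤ p.1 * (p.2 + 1)) := by
    intro p hp q hq hle
    have heq := TaskADC.rate_eq_of_mem_budgetConfigs hK hp hq
    have hp1 := hp.1.1
    have hq1 : (1 : ℝ) ≤ q.2 := by exact_mod_cast hq.1.2.2.1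
    rcases hle.eq_or_lt with h2 | h2
    · rw [h2] at heq hq1
      exact .inl (Prod.ext (mul_right_cancel₀ (by linarith) heq) h2)
    · have h3 : (q.2 : ℝ) < p.2 := by exact_mod_cast h2
      refine .inr ⟨h2, ?_, by linarith⟩
      by_contra! h4
      nlinarith [hq.1.1]
  refine ⟨fun p hp hmax => ⟨fun q hq => ?_, fun hne q hq hqp => ?_⟩, fun p hp q hq hlt => ?_⟩
  · rcases hrates p hp q hq (hmax q hq) with rfl | ⟨h1, h2, h3⟩
    · exact le_rfl
    · exact h.minMSE_le_minMSE hband hη hq.1 hp.1 h1 h2 h3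
  · rcases hrates p hp q hq (hmax q hq) with h0 | ⟨h1, h2, h3⟩
    · exact absurd h0 hqp
    · exact h.minMSE_lt_minMSE hband hη hq.1 hp.1 h1 h2 h3 hne
  · obtain ⟨h2, h3⟩ := TaskADC.rate_le_of_mem_roundedConfigs hK hp hq hlt
    exact ⟨h.minMSE_le_minMSE hband hη hq.1 hp.1 hlt h2 h3,
      h.minMSE_lt_minMSE hband hη hq.1 hp.1 hlt h2 h3⟩
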